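/- Let $\lambda$ be Lebesgue measure on $\mathbb{C}$, let $|\cdot|_2$ be the Hilbert--Schmidt norm, and let $M_n$ be the algebra of complex $n\times n$ matrices, with $e_1,\dots,e_n$ the standard basis of $\mathbb{C}^n$. For a Borel set $\Omega\subset\mathbb{C}$ let $\Lambda(\Omega)$ be the set of $f\in L^\infty(\Omega,\lambda)$ whose difference quotient $Df(s,t)=\frac{f(s)-f(t)}{s-t}$ is in $L^\infty(\Omega\times\Omega,\lambda\otimes\lambda)$, and let $M_f$ be the operator of multiplication by $f$ on $L^2(\Omega)=L^2(\Omega,\lambda)$. For $T\in\mathcal{B}(L^2(\Omega))$ put $$L(T)=\sup\{\,|[M_f,T]|_2 : f\in\Lambda(\Omega),\ \|Df\|_\infty\le 1\,\},\qquad |||T|||=\|T\|+L(T),$$ and let $E\Lambda(\Omega)=\{T\in\mathcal{B}(L^2(\Omega)) : L(T)<\infty\}$, which is a unital $*$-subalgebra of $\mathcal{B}(L^2(\Omega))$. Let $E\Lambda(\Omega)_0$ be the closure in $E\Lambda(\Omega)$, with respect to $|||\cdot|||$, of the set of all operators $T\oplus 0$ on $L^2(\Omega)=L^2(\Omega_1)\oplus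 L^2(\Omega\setminus\Omega_1)$, where $\Omega_1\subset\Omega$ is a bounded Borel set and $T\in E\Lambda(\Omega_1)$; it is a $*$-subalgebra. Elements $T\otimes m$ of $E\Lambda(\Omega)\otimes M_n$ and $E\Lambda(\Omega)_0\otimes M_n$ (algebraic tensor products) act on $L^2(\Omega)\otimes\mathbb{C}^n$ by $h\otimes v\mapsto Th\otimes mv$. **Proposition.** Let $n\ge 1$ and let $\Omega\subset\mathbb{C}$ be a Borel set. There are $U_1,\dots,U_n\in E\Lambda(\Omega)$ such that $$U:L^2(\Omega)\to L^2(\Omega)\otimes\mathbb{C}^n,\qquad Uh=\sum_{k=1}^n U_kh\otimes e_k,$$ is a unitary operator, with the following properties. 1. $U\,E\Lambda(\Omega)\,U^*=E\Lambda(\Omega)\otimes M_n$ (as sets of operators on $L^2(\Omega)\otimes\mathbb{C}^n$), and $T\mapsto UTU^*$ is an isomorphism of $*$-algebras $E\Lambda(\Omega)\to E\Lambda(\Omega)\otimes M_n$. 2. If $\Omega=\mathbb{C}$, then moreover $U\,E\Lambda(\mathbb{C})_0\,U^*=E\Lambda(\mathbb{C})_0\otimes M_n$, and $T\mapsto UTU^*$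 is an isomorphism of $*$-algebras $E\Lambda(\mathbb{C})_0\to E\Lambda(\mathbb{C})_0\otimes M_n$. -/

import Mathlib

open MeasureTheory
open scoped ENNReal TensorProduct

noncomputable section

/-! ## The Hilbert–Schmidt norm -/

section HilbertSchmidt

variable {H K : Type*} [NormedAddCommGroup H] [InnerProductSpace ℂ H] [CompleteSpace H]
  [NormedAddCommGroup K] [InnerProductSpace ℂ K] [CompleteSpace K]

/-- The Hilbert–Schmidt norm `|T|₂ = (∑ ‖T bᵢ‖²)^(1/2) ∈ [0, ∞]`, computed in a chosen Hilbert
basis. By `hsNorm_eq` below, the basis does not matter. -/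
def hsNorm (T : H →L[ℂ] K) : ℝ≥0∞ :=
  (∑' i, ‖T ((exists_hilbertBasis ℂ H).choose_spec.choose i)‖ₑ ^ 2) ^ (1 / 2 : ℝ)

theorem parseval_enorm {ι : Type*} (b : HilbertBasis ι ℂ H) (x : H) :
    ∑' i, ‖inner ℂ (b i) x‖ₑ ^ 2 = ‖x‖ₑ ^ 2 := by
  have h := (b.hasSum_inner_mul_inner x x)
  have h2 : HasSum (fun i => ‖inner ℂ (b i) x‖ ^ 2) (‖x‖ ^ 2) := by
    have := (Complex.hasSum_re h)
    convert this using 1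
    · ext i
      rw [← inner_conj_symm x (b i), ← Complex.normSq_eq_conj_mul_self, Complex.ofReal_re,
        Complex.normSq_eq_norm_sq]
    · exact (inner_self_eq_norm_sq (𝕜 := ℂ) x).symm
  have h3 : ∀ y : ℝ, 0 ≤ y → ENNReal.ofReal (y ^ 2) = ENNReal.ofReal y ^ 2 :=
    fun y hy => ENNReal.ofReal_pow hy 2
  rw [← ofReal_norm x, ← h3 _ (norm_nonneg _), ← h2.tsum_eq,
    ENNReal.ofReal_tsum_of_nonneg (fun i => by positivity) h2.summable]
  refine tsum_congr fun i => ?_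
  rw [h3 _ (norm_nonneg _), ofReal_norm]

theorem hs_sum_adjoint {ι κ : Type*} (b : HilbertBasis ι ℂ H) (c : HilbertBasis κ ℂ K)
    (T : H →L[ℂ] K) :
    ∑' i, ‖T (b i)‖ₑ ^ 2 = ∑' k, ‖ContinuousLinearMap.adjoint T (c k)‖ₑ ^ 2 := by
  simp_rw [← parseval_enorm c (T _), ← parseval_enorm b (ContinuousLinearMap.adjoint T _)]
  rw [ENNReal.tsum_comm]
  refine tsum_congr fun k => tsum_congr fun i => ?_
  rw [ContinuousLinearMap.adjoint_inner_right, ← inner_conj_symm]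
  rw [← ofReal_norm, RCLike.norm_conj, ofReal_norm]

theorem hsNorm_eq {ι : Type*} (b : HilbertBasis ι ℂ H) (T : H →L[ℂ] K) :
    hsNorm T = (∑' i, ‖T (b i)‖ₑ ^ 2) ^ (1 / 2 : ℝ) := by
  obtain ⟨w, c, -⟩ := exists_hilbertBasis ℂ K
  rw [hsNorm, hs_sum_adjoint _ c, ← hs_sum_adjoint b c]

theorem hsNorm_adjoint (T : H →L[ℂ] K) : hsNorm (ContinuousLinearMap.adjoint T) = hsNorm T := by
  obtain ⟨w, b, -⟩ := exists_hilbertBasis ℂ H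
  obtain ⟨w', c, -⟩ := exists_hilbertBasis ℂ K
  rw [hsNorm_eq b, hsNorm_eq c, hs_sum_adjoint b c]

theorem hsNorm_zero : hsNorm (0 : H →L[ℂ] K) = 0 := by
  simp [hsNorm]

theorem hsNorm_add_le (S T : H →L[ℂ] K) : hsNorm (S + T) ≤ hsNorm S + hsNorm T := by
  obtain ⟨w, b, -⟩ := exists_hilbertBasis ℂ H
  simp only [hsNorm_eq b]
  rw [one_div, ENNReal.rpow_inv_le_iff (by norm_num : (0 : ℝ) < 2)]
  rw [ENNReal.tsum_eq_iSup_sum]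
  refine iSup_le fun s => ?_
  rw [← ENNReal.rpow_inv_le_iff (by norm_num : (0 : ℝ) < 2)]
  have h1 := ENNReal.Lp_add_le s (fun i => ‖S (b i)‖ₑ) (fun i => ‖T (b i)‖ₑ)
    (by norm_num : (1 : ℝ) ≤ 2)
  simp only [one_div] at h1
  have key : ∀ f : w → ℝ≥0∞, ∑ i ∈ s, f i ^ (2 : ℝ) = ∑ i ∈ s, f i ^ 2 :=
    fun f => Finset.sum_congr rfl fun i _ => ENNReal.rpow_two _
  simp only [key] at h1
  calc (∑ i ∈ s, ‖(S + T) (b i)‖ₑ ^ 2) ^ (2 : ℝ)⁻¹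
      ≤ (∑ i ∈ s, (‖S (b i)‖ₑ + ‖T (b i)‖ₑ) ^ 2) ^ (2 : ℝ)⁻¹ := by
        gcongr with i hi
        exact enorm_add_le _ _
    _ ≤ _ := h1
    _ ≤ _ := by
        gcongr <;> exact ENNReal.sum_le_tsum _

theorem hsNorm_comp_le {G : Type*} [NormedAddCommGroup G] [InnerProductSpace ℂ G] [CompleteSpace G]
    (A : K →L[ℂ] G) (T : H →L[ℂ] K) : hsNorm (A ∘L T) ≤ ‖A‖ₑ * hsNorm T := by
  obtain ⟨w, b, -⟩ := exists_hilbertBasis ℂ H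
  simp only [hsNorm_eq b]
  have : ‖A‖ₑ = (‖A‖ₑ ^ 2) ^ (1 / 2 : ℝ) := by
    rw [← ENNReal.rpow_two, ← ENNReal.rpow_mul]; norm_num
  rw [this, ← ENNReal.mul_rpow_of_nonneg _ _ (by norm_num), ← ENNReal.tsum_mul_left]
  gcongr with i
  rw [← mul_pow]
  gcongr
  exact A.le_opENorm _

theorem hsNorm_comp_le' {G : Type*} [NormedAddCommGroup G] [InnerProductSpace ℂ G]
    [CompleteSpace G] (T : K →L[ℂ] G) (A : H →L[ℂ] K) : hsNorm (T ∘L A) ≤ hsNorm T * ‖A‖ₑ := by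
  rw [← hsNorm_adjoint, ContinuousLinearMap.adjoint_comp, mul_comm, ← hsNorm_adjoint T]
  refine (hsNorm_comp_le _ _).trans_eq ?_
  congr 1
  rw [← ofReal_norm, ← ofReal_norm, LinearIsometryEquiv.norm_map]

end HilbertSchmidt

namespace ELam

/-! ## The algebras -/

/-- Lebesgue measure `λ` on `Ω ⊆ ℂ`. -/
abbrev leb (Ω : Set ℂ) : Measure ℂ := volume.restrict Ω

/-- The Hilbert space `L²(Ω, λ)`. -/
abbrev L2 (Ω : Set ℂ) : Type := Lp ℂ 2 (leb Ω)

/-- The multiplication operator `M_f` on `L²(Ω, λ)`, for `f ∈ L^∞(Ω, λ)`. -/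
def mulOp {Ω : Set ℂ} (f : Lp ℂ ∞ (leb Ω)) : L2 Ω →L[ℂ] L2 Ω :=
  (ContinuousLinearMap.mul ℂ ℂ).holderL (leb Ω) ∞ 2 2 f

/-- The difference quotient `Df(s,t) = (f(s) - f(t)) / (s - t)`. -/
def diffQuot {Ω : Set ℂ} (f : Lp ℂ ∞ (leb Ω)) (p : ℂ × ℂ) : ℂ :=
  (f p.1 - f p.2) / (p.1 - p.2)

/-- The space `Λ(Ω)` of essentially Lipschitz functions: those `f ∈ L^∞(Ω)` with
`Df ∈ L^∞(Ω × Ω)`. -/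
def lipAlg (Ω : Set ℂ) : Set (Lp ℂ ∞ (leb Ω)) :=
  {f | MemLp (diffQuot f) ∞ ((leb Ω).prod (leb Ω))}

/-- `L(T) = sup {|[M_f, T]|₂ : f ∈ Λ(Ω), ‖Df‖_∞ ≤ 1} ∈ [0, ∞]`. -/
def lipNorm {Ω : Set ℂ} (T : L2 Ω →L[ℂ] L2 Ω) : ℝ≥0∞ :=
  ⨆ f ∈ {f ∈ lipAlg Ω | eLpNorm (diffQuot f) ∞ ((leb Ω).prod (leb Ω)) ≤ 1},
    hsNorm (mulOp f * T - T * mulOp f)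

/-- The norm `|||T||| = ‖T‖ + L(T)`. -/
def tripleNorm {Ω : Set ℂ} (T : L2 Ω →L[ℂ] L2 Ω) : ℝ≥0∞ := ‖T‖ₑ + lipNorm T

section Basic

variable {Ω : Set ℂ}

theorem coeFn_mulOp (f : Lp ℂ ∞ (leb Ω)) (g : L2 Ω) :
    mulOp f g =ᵐ[leb Ω] fun x => f x * g x :=
  (ContinuousLinearMap.mul ℂ ℂ).coeFn_holder f g

theorem mulOp_adjoint (f : Lp ℂ ∞ (leb Ω)) : star (mulOp f) = mulOp (star f) := by
  rw [ContinuousLinearMap.star_eq_adjoint]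
  symm
  rw [ContinuousLinearMap.eq_adjoint_iff]
  intro g h
  rw [L2.inner_def, L2.inner_def]
  refine integral_congr_ae ?_
  filter_upwards [coeFn_mulOp f h, coeFn_mulOp (star f) g, Lp.coeFn_star f] with x h1 h2 h3
  simp only [h1, h2, h3, Pi.star_apply, RCLike.inner_apply, map_mul, RCLike.star_def,
    RCLike.conj_conj]
  ring

theorem diffQuot_star (f : Lp ℂ ∞ (leb Ω)) :
    ∀ᵐ p ∂((leb Ω).prod (leb Ω)), ‖diffQuot (star f) p‖ = ‖diffQuot f p‖ := by
  have h1 := Measure.quasiMeasurePreserving_fst (μ := leb Ω) (ν := leb Ω) |>.ae (Lp.coeFn_star f)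
  have h2 := Measure.quasiMeasurePreserving_snd (μ := leb Ω) (ν := leb Ω) |>.ae (Lp.coeFn_star f)
  filter_upwards [h1, h2] with p h1 h2
  simp only [diffQuot, h1, h2, Pi.star_apply, norm_div, ← star_sub, norm_star]

theorem aestronglyMeasurable_diffQuot (f : Lp ℂ ∞ (leb Ω)) :
    AEStronglyMeasurable (diffQuot f) ((leb Ω).prod (leb Ω)) := by
  have h := (Lp.aestronglyMeasurable f)
  have h1 := h.comp_fst (ν := leb Ω)
  have h2 := h.comp_snd (μ := leb Ω)
  exact ((h1.sub h2).aemeasurable.div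
    (measurable_fst.sub measurable_snd).aemeasurable).aestronglyMeasurable

theorem eLpNorm_diffQuot_star (f : Lp ℂ ∞ (leb Ω)) :
    eLpNorm (diffQuot (star f)) ∞ ((leb Ω).prod (leb Ω)) =
      eLpNorm (diffQuot f) ∞ ((leb Ω).prod (leb Ω)) :=
  eLpNorm_congr_norm_ae (diffQuot_star f)

theorem le_lipNorm (T : L2 Ω →L[ℂ] L2 Ω) (f : Lp ℂ ∞ (leb Ω))
    (hf : eLpNorm (diffQuot f) ∞ ((leb Ω).prod (leb Ω)) ≤ 1) :
    hsNorm (mulOp f * T - T * mulOp f) ≤ lipNorm T :=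
  le_iSup₂_of_le f ⟨⟨aestronglyMeasurable_diffQuot f, hf.trans_lt ENNReal.one_lt_top⟩, hf⟩ le_rfl

theorem lipNorm_le (T : L2 Ω →L[ℂ] L2 Ω) (C : ℝ≥0∞)
    (h : ∀ f : Lp ℂ ∞ (leb Ω), eLpNorm (diffQuot f) ∞ ((leb Ω).prod (leb Ω)) ≤ 1 →
      hsNorm (mulOp f * T - T * mulOp f) ≤ C) : lipNorm T ≤ C :=
  iSup₂_le fun f hf => h f hf.2

theorem lipNorm_add_le (S T : L2 Ω →L[ℂ] L2 Ω) : lipNorm (S + T) ≤ lipNorm S + lipNorm T := by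
  refine lipNorm_le _ _ fun f hf => ?_
  have : mulOp f * (S + T) - (S + T) * mulOp f
      = (mulOp f * S - S * mulOp f) + (mulOp f * T - T * mulOp f) := by noncomm_ring
  rw [this]
  exact (hsNorm_add_le _ _).trans (add_le_add (le_lipNorm _ f hf) (le_lipNorm _ f hf))

theorem lipNorm_mul_le (S T : L2 Ω →L[ℂ] L2 Ω) :
    lipNorm (S * T) ≤ lipNorm S * ‖T‖ₑ + ‖S‖ₑ * lipNorm T := by
  refine lipNorm_le _ _ fun f hf => ?_
  have : mulOp f * (S * T) - (S * T) * mulOp f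
      = (mulOp f * S - S * mulOp f) * T + S * (mulOp f * T - T * mulOp f) := by noncomm_ring
  rw [this]
  refine (hsNorm_add_le _ _).trans (add_le_add ?_ ?_)
  · exact (hsNorm_comp_le' _ _).trans (by gcongr; exact le_lipNorm _ f hf)
  · exact (hsNorm_comp_le _ _).trans (by gcongr; exact le_lipNorm _ f hf)

theorem lipNorm_star_le (T : L2 Ω →L[ℂ] L2 Ω) : lipNorm (star T) ≤ lipNorm T := by
  refine lipNorm_le _ _ fun f hf => ?_
  have : mulOp f * star T - star T * mulOp f
      = star (-1 * (mulOp (star f) * T - T * mulOp (star f))) := by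
    simp only [star_mul, star_sub, mulOp_adjoint, star_star, star_neg, star_one]
    noncomm_ring
  rw [this, ContinuousLinearMap.star_eq_adjoint, hsNorm_adjoint]
  refine (hsNorm_comp_le _ _).trans ?_
  refine (mul_le_mul_left (α := ℝ≥0∞) (b := ‖(-1 : L2 Ω →L[ℂ] L2 Ω)‖ₑ) (c := 1) ?_ _).trans ?_
  · rw [enorm_neg, ← ofReal_norm]
    exact ENNReal.ofReal_le_one.2 ContinuousLinearMap.norm_id_le
  · rw [one_mul]
    exact le_lipNorm T (star f) (by rwa [eLpNorm_diffQuot_star])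

theorem lipNorm_star (T : L2 Ω →L[ℂ] L2 Ω) : lipNorm (star T) = lipNorm T :=
  le_antisymm (lipNorm_star_le T) (by simpa using lipNorm_star_le (star T))

theorem lipNorm_algebraMap (c : ℂ) : lipNorm (algebraMap ℂ (L2 Ω →L[ℂ] L2 Ω) c) = 0 := by
  refine le_antisymm (lipNorm_le _ _ fun f _ => ?_) bot_le
  rw [Algebra.commutes, sub_self, hsNorm_zero]

theorem tripleNorm_add_le (S T : L2 Ω →L[ℂ] L2 Ω) :
    tripleNorm (S + T) ≤ tripleNorm S + tripleNorm T :=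
  (add_le_add (enorm_add_le S T) (lipNorm_add_le S T)).trans_eq (by simp only [tripleNorm]; ring)

theorem enorm_op_mul_le (S T : L2 Ω →L[ℂ] L2 Ω) : ‖S * T‖ₑ ≤ ‖S‖ₑ * ‖T‖ₑ := by
  simp only [← ofReal_norm]
  rw [← ENNReal.ofReal_mul (norm_nonneg _)]
  exact ENNReal.ofReal_le_ofReal (norm_mul_le S T)

theorem tripleNorm_mul_le (S T : L2 Ω →L[ℂ] L2 Ω) :
    tripleNorm (S * T) ≤ tripleNorm S * tripleNorm T := by
  refine (add_le_add (enorm_op_mul_le S T) (lipNorm_mul_le S T)).trans ?_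
  simp only [tripleNorm, add_mul, mul_add]
  rw [← add_assoc]
  calc ‖S‖ₑ * ‖T‖ₑ + lipNorm S * ‖T‖ₑ + ‖S‖ₑ * lipNorm T
      ≤ ‖S‖ₑ * ‖T‖ₑ + lipNorm S * ‖T‖ₑ + ‖S‖ₑ * lipNorm T + lipNorm S * lipNorm T :=
        le_self_add
    _ = _ := by ring

theorem tripleNorm_star (T : L2 Ω →L[ℂ] L2 Ω) : tripleNorm (star T) = tripleNorm T := by
  rw [tripleNorm, tripleNorm, lipNorm_star, ContinuousLinearMap.star_eq_adjoint, ← ofReal_norm,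
    ← ofReal_norm, LinearIsometryEquiv.norm_map]

theorem tripleNorm_zero : tripleNorm (0 : L2 Ω →L[ℂ] L2 Ω) = 0 := by
  have := lipNorm_algebraMap (Ω := Ω) 0
  rw [map_zero] at this
  rw [tripleNorm, this, add_zero, ← ofReal_norm, norm_zero, ENNReal.ofReal_zero]

theorem tripleNorm_algebraMap_lt_top (c : ℂ) :
    tripleNorm (algebraMap ℂ (L2 Ω →L[ℂ] L2 Ω) c) < ∞ := by
  rw [tripleNorm, lipNorm_algebraMap, add_zero]
  exact enorm_lt_top

theorem tripleNorm_lt_top_iff (T : L2 Ω →L[ℂ] L2 Ω) : tripleNorm T < ∞ ↔ lipNorm T < ∞ := by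
  simp [tripleNorm, ENNReal.add_lt_top]

end Basic

/-- The involutive algebra `EΛ(Ω) = {T ∈ B(L²(Ω, λ)) : L(T) < ∞}`. -/
def EL (Ω : Set ℂ) : StarSubalgebra ℂ (L2 Ω →L[ℂ] L2 Ω) where
  carrier := {T | lipNorm T < ∞}
  mul_mem' {S T} hS hT := (lipNorm_mul_le S T).trans_lt
    (ENNReal.add_lt_top.2 ⟨ENNReal.mul_lt_top hS enorm_lt_top, ENNReal.mul_lt_top enorm_lt_top hT⟩)
  add_mem' {S T} hS hT := (lipNorm_add_le S T).trans_lt (ENNReal.add_lt_top.2 ⟨hS, hT⟩)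
  algebraMap_mem' c := by simp [lipNorm_algebraMap]
  star_mem' {T} hT := (lipNorm_star_le T).trans_lt hT

theorem mem_EL {Ω : Set ℂ} {T : L2 Ω →L[ℂ] L2 Ω} : T ∈ EL Ω ↔ lipNorm T < ∞ := Iff.rfl

/-! ## The inclusions `i(Ω₂, Ω₁)` -/

section Inclusion

variable {Ω₁ Ω₂ Ω₃ : Set ℂ}

theorem leb_mono (h : Ω₁ ⊆ Ω₂) : leb Ω₁ ≤ leb Ω₂ := Measure.restrict_mono h le_rfl

/-- Restriction of functions, `L^p(Ω₂) → L^p(Ω₁)`, for `Ω₁ ⊆ Ω₂`. -/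
def resFun {p : ℝ≥0∞} (h : Ω₁ ⊆ Ω₂) (g : Lp ℂ p (leb Ω₂)) : Lp ℂ p (leb Ω₁) :=
  ((Lp.memLp g).mono_measure (leb_mono h)).toLp g

theorem coeFn_resFun {p : ℝ≥0∞} (h : Ω₁ ⊆ Ω₂) (g : Lp ℂ p (leb Ω₂)) :
    resFun h g =ᵐ[leb Ω₁] g := MemLp.coeFn_toLp _

theorem ae_leb_mono (h : Ω₁ ⊆ Ω₂) {P : ℂ → Prop} (hP : ∀ᵐ x ∂(leb Ω₂), P x) :
    ∀ᵐ x ∂(leb Ω₁), P x := ae_mono (leb_mono h) hP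

/-- Restriction of functions as a bounded operator `L²(Ω₂) → L²(Ω₁)`. -/
def resOp (h : Ω₁ ⊆ Ω₂) : L2 Ω₂ →L[ℂ] L2 Ω₁ :=
  LinearMap.mkContinuous
    { toFun := resFun h
      map_add' := fun f g => by
        apply Lp.ext
        filter_upwards [coeFn_resFun h (f + g), Lp.coeFn_add (resFun h f) (resFun h g),
          coeFn_resFun h f, coeFn_resFun h g, ae_leb_mono h (Lp.coeFn_add f g)]
          with x h1 h2 h3 h4 h5
        simp only [h1, h2, h3, h4, h5, Pi.add_apply]
      map_smul' := fun c f => by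
        apply Lp.ext
        filter_upwards [coeFn_resFun h (c • f), Lp.coeFn_smul c (resFun h f),
          coeFn_resFun h f, ae_leb_mono h (Lp.coeFn_smul c f)] with x h1 h2 h3 h4
        simp only [RingHom.id_apply, h1, h2, h3, h4, Pi.smul_apply] }
    1 (fun f => by
      rw [one_mul]
      change ‖resFun h f‖ ≤ _
      rw [Lp.norm_def, Lp.norm_def]
      refine ENNReal.toReal_mono (Lp.eLpNorm_ne_top f) ?_
      rw [eLpNorm_congr_ae (coeFn_resFun h f)]
      exact eLpNorm_mono_measure _ (leb_mono h))

theorem leb_restrict (h : Ω₁ ⊆ Ω₂) (hm : MeasurableSet Ω₁) :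
    (leb Ω₂).restrict Ω₁ = leb Ω₁ := by
  rw [leb, Measure.restrict_restrict hm, Set.inter_eq_self_of_subset_left h]

/-- Extension of a function by zero, from `Ω₁` to `Ω₂ ⊇ Ω₁`. -/
def extFun (h : Ω₁ ⊆ Ω₂) (hm : MeasurableSet Ω₁) (g : L2 Ω₁) : L2 Ω₂ :=
  MemLp.toLp (Ω₁.indicator g) ((memLp_indicator_iff_restrict hm).2
    ((leb_restrict h hm).symm ▸ Lp.memLp g))

theorem coeFn_extFun (h : Ω₁ ⊆ Ω₂) (hm : MeasurableSet Ω₁) (g : L2 Ω₁) :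
    extFun h hm g =ᵐ[leb Ω₂] Ω₁.indicator g := MemLp.coeFn_toLp _

theorem ae_leb_imp (h : Ω₁ ⊆ Ω₂) (hm : MeasurableSet Ω₁) {P : ℂ → Prop}
    (hP : ∀ᵐ x ∂(leb Ω₁), P x) : ∀ᵐ x ∂(leb Ω₂), x ∈ Ω₁ → P x := by
  rw [← leb_restrict h hm] at hP
  exact (ae_restrict_iff' hm).1 hP

/-- Extension by zero as a bounded operator `L²(Ω₁) → L²(Ω₂)`; it is the inclusion of the first
summand of `L²(Ω₂) = L²(Ω₁) ⊕ L²(Ω₂ ∖ Ω₁)`. -/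
def extOp (h : Ω₁ ⊆ Ω₂) (hm : MeasurableSet Ω₁) : L2 Ω₁ →L[ℂ] L2 Ω₂ :=
  LinearMap.mkContinuous
    { toFun := extFun h hm
      map_add' := fun f g => by
        apply Lp.ext
        filter_upwards [coeFn_extFun h hm (f + g), Lp.coeFn_add (extFun h hm f) (extFun h hm g),
          coeFn_extFun h hm f, coeFn_extFun h hm g, ae_leb_imp h hm (Lp.coeFn_add f g)]
          with x h1 h2 h3 h4 h5
        rw [h1, h2, Pi.add_apply, h3, h4]
        by_cases hx : x ∈ Ω₁
        · simp only [Set.indicator_of_mem hx, h5 hx, Pi.add_apply]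
        · simp only [Set.indicator_of_notMem hx, add_zero]
      map_smul' := fun c f => by
        apply Lp.ext
        filter_upwards [coeFn_extFun h hm (c • f), Lp.coeFn_smul c (extFun h hm f),
          coeFn_extFun h hm f, ae_leb_imp h hm (Lp.coeFn_smul c f)] with x h1 h2 h3 h4
        by_cases hx : x ∈ Ω₁ <;> simp [h1, h2, h3, h4, hx] }
    1 (fun f => by
      rw [one_mul]
      change ‖extFun h hm f‖ ≤ _
      rw [Lp.norm_def, Lp.norm_def]
      refine ENNReal.toReal_mono (Lp.eLpNorm_ne_top f) ?_
      rw [eLpNorm_congr_ae (coeFn_extFun h hm f), eLpNorm_indicator_eq_eLpNorm_restrict hm,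
        leb_restrict h hm])

/-- The inclusion homomorphism `i(Ω₂, Ω₁)(T) = T ⊕ 0`, with respect to
`L²(Ω₂) = L²(Ω₁) ⊕ L²(Ω₂ ∖ Ω₁)`. -/
def incl (h : Ω₁ ⊆ Ω₂) (hm : MeasurableSet Ω₁) (T : L2 Ω₁ →L[ℂ] L2 Ω₁) : L2 Ω₂ →L[ℂ] L2 Ω₂ :=
  extOp h hm ∘L T ∘L resOp h

theorem coeFn_resOp (h : Ω₁ ⊆ Ω₂) (g : L2 Ω₂) : resOp h g =ᵐ[leb Ω₁] g := coeFn_resFun h g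

theorem coeFn_extOp (h : Ω₁ ⊆ Ω₂) (hm : MeasurableSet Ω₁) (g : L2 Ω₁) :
    extOp h hm g =ᵐ[leb Ω₂] Ω₁.indicator g := coeFn_extFun h hm g

theorem resOp_extOp (h : Ω₁ ⊆ Ω₂) (hm : MeasurableSet Ω₁) (g : L2 Ω₁) :
    resOp h (extOp h hm g) = g := by
  apply Lp.ext
  filter_upwards [coeFn_resOp h (extOp h hm g), ae_leb_mono h (coeFn_extOp h hm g),
    ae_restrict_mem hm] with x h1 h2 h3
  rw [h1, h2, Set.indicator_of_mem h3]

theorem extOp_adjoint (h : Ω₁ ⊆ Ω₂) (hm : MeasurableSet Ω₁) :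
    ContinuousLinearMap.adjoint (extOp h hm) = resOp h := by
  symm
  rw [ContinuousLinearMap.eq_adjoint_iff]
  intro g f
  rw [L2.inner_def, L2.inner_def]
  have hi : ∀ F : ℂ → ℂ, ∫ x, F x ∂(leb Ω₁) = ∫ x, Ω₁.indicator F x ∂(leb Ω₂) := fun F => by
    rw [integral_indicator hm, leb_restrict h hm]
  rw [hi]
  refine integral_congr_ae ?_
  filter_upwards [coeFn_extOp h hm f, ae_leb_imp h hm (coeFn_resOp h g)] with x h1 h2
  by_cases hx : x ∈ Ω₁ <;> simp [h1, h2, hx]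

theorem incl_add (h : Ω₁ ⊆ Ω₂) (hm : MeasurableSet Ω₁) (S T : L2 Ω₁ →L[ℂ] L2 Ω₁) :
    incl h hm (S + T) = incl h hm S + incl h hm T := by
  ext1 x; simp [incl]

theorem incl_mul (h : Ω₁ ⊆ Ω₂) (hm : MeasurableSet Ω₁) (S T : L2 Ω₁ →L[ℂ] L2 Ω₁) :
    incl h hm (S * T) = incl h hm S * incl h hm T := by
  ext1 x; simp [incl, resOp_extOp]

theorem incl_star (h : Ω₁ ⊆ Ω₂) (hm : MeasurableSet Ω₁) (T : L2 Ω₁ →L[ℂ] L2 Ω₁) :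
    incl h hm (star T) = star (incl h hm T) := by
  rw [ContinuousLinearMap.star_eq_adjoint, ContinuousLinearMap.star_eq_adjoint, incl, incl,
    ContinuousLinearMap.adjoint_comp, ContinuousLinearMap.adjoint_comp, extOp_adjoint,
    ← extOp_adjoint h hm, ContinuousLinearMap.adjoint_adjoint, ContinuousLinearMap.comp_assoc]

theorem incl_incl (h : Ω₁ ⊆ Ω₂) (h' : Ω₂ ⊆ Ω₃) (hm : MeasurableSet Ω₁) (hm' : MeasurableSet Ω₂)
    (T : L2 Ω₁ →L[ℂ] L2 Ω₁) : incl h' hm' (incl h hm T) = incl (h.trans h') hm T := by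
  have hr : ∀ x, resOp h (resOp h' x) = resOp (h.trans h') x := fun x => by
    apply Lp.ext
    filter_upwards [coeFn_resOp h (resOp h' x), ae_leb_mono h (coeFn_resOp h' x),
      coeFn_resOp (h.trans h') x] with z h1 h2 h3
    rw [h1, h2, h3]
  have he : ∀ x, extOp h' hm' (extOp h hm x) = extOp (h.trans h') hm x := fun x => by
    apply Lp.ext
    filter_upwards [coeFn_extOp h' hm' (extOp h hm x), ae_leb_imp h' hm' (coeFn_extOp h hm x),
      coeFn_extOp (h.trans h') hm x] with z h1 h2 h3
    rw [h1, h3]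
    by_cases hz : z ∈ Ω₂
    · rw [Set.indicator_of_mem hz, h2 hz]
    · rw [Set.indicator_of_notMem hz, Set.indicator_of_notMem (fun h4 => hz (h h4))]
  ext1 x
  simp [incl, hr, he]

theorem resOp_mulOp (h : Ω₁ ⊆ Ω₂) (f : Lp ℂ ∞ (leb Ω₂)) (g : L2 Ω₂) :
    resOp h (mulOp f g) = mulOp (resFun h f) (resOp h g) := by
  apply Lp.ext
  filter_upwards [coeFn_resOp h (mulOp f g), ae_leb_mono h (coeFn_mulOp f g),
    coeFn_mulOp (resFun h f) (resOp h g), coeFn_resFun h f, coeFn_resOp h g] with x h1 h2 h3 h4 h5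
  rw [h1, h2, h3, h4, h5]

theorem mulOp_extOp (h : Ω₁ ⊆ Ω₂) (hm : MeasurableSet Ω₁) (f : Lp ℂ ∞ (leb Ω₂)) (g : L2 Ω₁) :
    mulOp f (extOp h hm g) = extOp h hm (mulOp (resFun h f) g) := by
  apply Lp.ext
  filter_upwards [coeFn_mulOp f (extOp h hm g), coeFn_extOp h hm g,
    coeFn_extOp h hm (mulOp (resFun h f) g), ae_leb_imp h hm (coeFn_mulOp (resFun h f) g),
    ae_leb_imp h hm (coeFn_resFun h f)] with x h1 h2 h3 h4 h5
  rw [h1, h2, h3]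
  by_cases hx : x ∈ Ω₁
  · simp [hx, h4, h5]
  · simp [hx]

theorem eLpNorm_diffQuot_resFun_le (h : Ω₁ ⊆ Ω₂) (f : Lp ℂ ∞ (leb Ω₂)) :
    eLpNorm (diffQuot (resFun h f)) ∞ ((leb Ω₁).prod (leb Ω₁)) ≤
      eLpNorm (diffQuot f) ∞ ((leb Ω₂).prod (leb Ω₂)) := by
  have h1 := Measure.quasiMeasurePreserving_fst (μ := leb Ω₁) (ν := leb Ω₁) |>.ae
    (coeFn_resFun h f)
  have h2 := Measure.quasiMeasurePreserving_snd (μ := leb Ω₁) (ν := leb Ω₁) |>.ae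
    (coeFn_resFun h f)
  have : diffQuot (resFun h f) =ᵐ[(leb Ω₁).prod (leb Ω₁)] diffQuot f := by
    filter_upwards [h1, h2] with p h1 h2
    simp only [diffQuot, h1, h2]
  rw [eLpNorm_congr_ae this]
  exact eLpNorm_mono_measure _ (Measure.prod_mono (leb_mono h) (leb_mono h))

theorem lipNorm_incl_le (h : Ω₁ ⊆ Ω₂) (hm : MeasurableSet Ω₁) (T : L2 Ω₁ →L[ℂ] L2 Ω₁) :
    lipNorm (incl h hm T) ≤ ‖extOp h hm‖ₑ * (lipNorm T * ‖resOp h‖ₑ) := by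
  refine lipNorm_le _ _ fun f hf => ?_
  have : mulOp f * incl h hm T - incl h hm T * mulOp f =
      extOp h hm ∘L (mulOp (resFun h f) * T - T * mulOp (resFun h f)) ∘L resOp h := by
    ext1 x
    simp [incl, mulOp_extOp, resOp_mulOp]
  rw [this]
  refine (hsNorm_comp_le _ _).trans ?_
  gcongr
  refine (hsNorm_comp_le' _ _).trans ?_
  gcongr
  exact le_lipNorm T _ ((eLpNorm_diffQuot_resFun_le h f).trans hf)

theorem incl_mem_EL (h : Ω₁ ⊆ Ω₂) (hm : MeasurableSet Ω₁) {T : L2 Ω₁ →L[ℂ] L2 Ω₁}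
    (hT : T ∈ EL Ω₁) : incl h hm T ∈ EL Ω₂ :=
  (lipNorm_incl_le h hm T).trans_lt
    (ENNReal.mul_lt_top enorm_lt_top (ENNReal.mul_lt_top hT enorm_lt_top))

end Inclusion

/-- The union of the `i(Ω, Ω₁) EΛ(Ω₁)` over all bounded Borel sets `Ω₁ ⊆ Ω`. -/
def bddPart (Ω : Set ℂ) : Set (L2 Ω →L[ℂ] L2 Ω) :=
  {T | ∃ (Ω₁ : Set ℂ) (h : Ω₁ ⊆ Ω) (hm : MeasurableSet Ω₁), Bornology.IsBounded Ω₁ ∧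
    ∃ S ∈ EL Ω₁, T = incl h hm S}

section BddPart

variable {Ω : Set ℂ} {S T : L2 Ω →L[ℂ] L2 Ω}

theorem bddPart_subset : bddPart Ω ⊆ EL Ω := by
  rintro _ ⟨Ω₁, h, hm, -, S, hS, rfl⟩
  exact incl_mem_EL h hm hS

theorem bddPart_common (hS : S ∈ bddPart Ω) (hT : T ∈ bddPart Ω) :
    ∃ (Ω₁ : Set ℂ) (h : Ω₁ ⊆ Ω) (hm : MeasurableSet Ω₁), Bornology.IsBounded Ω₁ ∧
      ∃ S' ∈ EL Ω₁, ∃ T' ∈ EL Ω₁, S = incl h hm S' ∧ T = incl h hm T' := by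
  obtain ⟨Ω₁, h, hm, hb, S', hS', rfl⟩ := hS
  obtain ⟨Ω₂, h', hm', hb', T', hT', rfl⟩ := hT
  refine ⟨Ω₁ ∪ Ω₂, Set.union_subset h h', hm.union hm', hb.union hb',
    incl Set.subset_union_left hm S', incl_mem_EL _ _ hS',
    incl Set.subset_union_right hm' T', incl_mem_EL _ _ hT', ?_, ?_⟩ <;> rw [incl_incl]

theorem bddPart_add (hS : S ∈ bddPart Ω) (hT : T ∈ bddPart Ω) : S + T ∈ bddPart Ω := by
  obtain ⟨Ω₁, h, hm, hb, S', hS', T', hT', rfl, rfl⟩ := bddPart_common hS hT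
  exact ⟨Ω₁, h, hm, hb, S' + T', add_mem hS' hT', (incl_add _ _ _ _).symm⟩

theorem bddPart_mul (hS : S ∈ bddPart Ω) (hT : T ∈ bddPart Ω) : S * T ∈ bddPart Ω := by
  obtain ⟨Ω₁, h, hm, hb, S', hS', T', hT', rfl, rfl⟩ := bddPart_common hS hT
  exact ⟨Ω₁, h, hm, hb, S' * T', mul_mem hS' hT', (incl_mul _ _ _ _).symm⟩

theorem bddPart_star (hT : T ∈ bddPart Ω) : star T ∈ bddPart Ω := by
  obtain ⟨Ω₁, h, hm, hb, T', hT', rfl⟩ := hT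
  exact ⟨Ω₁, h, hm, hb, star T', star_mem hT', (incl_star _ _ _).symm⟩

theorem bddPart_smul (c : ℂ) (hT : T ∈ bddPart Ω) : c • T ∈ bddPart Ω := by
  obtain ⟨Ω₁, h, hm, hb, T', hT', rfl⟩ := hT
  exact ⟨Ω₁, h, hm, hb, c • T', (EL Ω₁).smul_mem hT' c, by ext1 x; simp [incl]⟩

theorem bddPart_zero : (0 : L2 Ω →L[ℂ] L2 Ω) ∈ bddPart Ω :=
  ⟨∅, Set.empty_subset _, MeasurableSet.empty, Bornology.isBounded_empty, 0, zero_mem _, by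
    ext1 x; simp [incl]⟩

end BddPart

/-- The algebra `EΛ(Ω)₀`: the closure, in `EΛ(Ω)` with its norm `|||·|||`, of the union of the
`i(Ω, Ω₁) EΛ(Ω₁)` over all bounded Borel sets `Ω₁ ⊆ Ω`. -/
def EL0 (Ω : Set ℂ) : NonUnitalStarSubalgebra ℂ (L2 Ω →L[ℂ] L2 Ω) where
  carrier := {T | T ∈ EL Ω ∧ ∀ ε : ℝ≥0∞, 0 < ε → ∃ S ∈ bddPart Ω, tripleNorm (T - S) < ε}
  zero_mem' := ⟨zero_mem _, fun ε hε => ⟨0, bddPart_zero, by simpa [tripleNorm_zero] using hε⟩⟩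
  add_mem' := by
    rintro T T' ⟨h, ha⟩ ⟨h', ha'⟩
    refine ⟨add_mem h h', fun ε hε => ?_⟩
    obtain ⟨S, hS, hSε⟩ := ha (ε / 2) (ENNReal.half_pos hε.ne')
    obtain ⟨S', hS', hSε'⟩ := ha' (ε / 2) (ENNReal.half_pos hε.ne')
    refine ⟨S + S', bddPart_add hS hS', ?_⟩
    rw [add_sub_add_comm]
    calc _ ≤ _ := tripleNorm_add_le _ _
      _ < ε / 2 + ε / 2 := ENNReal.add_lt_add hSε hSε'
      _ = ε := ENNReal.add_halves ε
  smul_mem' := by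
    rintro c T ⟨h, ha⟩
    refine ⟨(EL Ω).smul_mem h c, fun ε hε => ?_⟩
    obtain ⟨δ, hδ, hδε⟩ := ENNReal.exists_pos_mul_lt
      (tripleNorm_algebraMap_lt_top (Ω := Ω) c).ne hε.ne'
    obtain ⟨S, hS, hSε⟩ := ha δ hδ
    refine ⟨c • S, bddPart_smul c hS, ?_⟩
    rw [← smul_sub, Algebra.smul_def]
    refine (tripleNorm_mul_le _ _).trans_lt (lt_of_le_of_lt ?_ hδε)
    rw [mul_comm]
    gcongr
  mul_mem' := by
    rintro T T' ⟨h, ha⟩ ⟨h', ha'⟩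
    refine ⟨mul_mem h h', fun ε hε => ?_⟩
    have hε2 := ENNReal.half_pos hε.ne'
    obtain ⟨δ', hδ', hδε'⟩ := ENNReal.exists_pos_mul_lt
      ((tripleNorm_lt_top_iff T).2 h).ne hε2.ne'
    obtain ⟨S', hS', hSε'⟩ := ha' δ' hδ'
    obtain ⟨δ, hδ, hδε⟩ := ENNReal.exists_pos_mul_lt
      ((tripleNorm_lt_top_iff S').2 (bddPart_subset hS')).ne hε2.ne'
    obtain ⟨S, hS, hSε⟩ := ha δ hδ
    refine ⟨S * S', bddPart_mul hS hS', ?_⟩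
    have : T * T' - S * S' = T * (T' - S') + (T - S) * S' := by noncomm_ring
    rw [this]
    calc _ ≤ _ := tripleNorm_add_le _ _
      _ ≤ tripleNorm T * tripleNorm (T' - S') + tripleNorm (T - S) * tripleNorm S' :=
        add_le_add (tripleNorm_mul_le _ _) (tripleNorm_mul_le _ _)
      _ ≤ δ' * tripleNorm T + δ * tripleNorm S' := by
        rw [mul_comm (tripleNorm T)]
        gcongr
      _ < ε / 2 + ε / 2 := ENNReal.add_lt_add hδε' hδε
      _ = ε := ENNReal.add_halves ε
  star_mem' := by
    rintro T ⟨h, ha⟩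
    refine ⟨star_mem h, fun ε hε => ?_⟩
    obtain ⟨S, hS, hSε⟩ := ha ε hε
    exact ⟨star S, bddPart_star hS, by rwa [← star_sub, tripleNorm_star]⟩

/-! ## Operators on `L²(Ω) ⊗ ℂⁿ` -/

/-- The Hilbert space `ℂⁿ`. -/
abbrev Cn (n : ℕ) : Type := EuclideanSpace ℂ (Fin n)

/-- The algebra `M_n` of complex `n × n` matrices. -/
abbrev Mn (n : ℕ) : Type := Matrix (Fin n) (Fin n) ℂ

/-- The operator on `L²(Ω) ⊗ ℂⁿ` given by an element of `A ⊗ M_n`, where `A` is represented on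
`L²(Ω)` by `j`: the tensor `a ⊗ m` acts by `h ⊗ v ↦ j(a) h ⊗ m v`. -/
def tensorOp {Ω : Set ℂ} {A : Type*} [AddCommGroup A] [Module ℂ A]
    (j : A →ₗ[ℂ] (L2 Ω →L[ℂ] L2 Ω)) (n : ℕ) :
    A ⊗[ℂ] Mn n →ₗ[ℂ] Module.End ℂ (L2 Ω ⊗[ℂ] Cn n) :=
  TensorProduct.homTensorHomMap (RingHom.id ℂ) (L2 Ω) (Cn n) (L2 Ω) (Cn n) ∘ₗ
    TensorProduct.map (ContinuousLinearMap.coeLM ℂ ∘ₗ j) (Matrix.toEuclideanLin).toLinearMap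

/-- The representation of `EΛ(Ω) ⊗ M_n` on `L²(Ω) ⊗ ℂⁿ`. -/
def ELtensorOp (Ω : Set ℂ) (n : ℕ) :
    EL Ω ⊗[ℂ] Mn n →ₗ[ℂ] Module.End ℂ (L2 Ω ⊗[ℂ] Cn n) :=
  tensorOp (EL Ω).subtype.toAlgHom.toLinearMap n

/-- The representation of `EΛ(Ω)₀ ⊗ M_n` on `L²(Ω) ⊗ ℂⁿ`. -/
def EL0tensorOp (Ω : Set ℂ) (n : ℕ) :
    EL0 Ω ⊗[ℂ] Mn n →ₗ[ℂ] Module.End ℂ (L2 Ω ⊗[ℂ] Cn n) :=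
  tensorOp ((EL0 Ω).toNonUnitalSubalgebra.toSubmodule.subtype) n

/-- The operator `U T U*` on `L²(Ω) ⊗ ℂⁿ`. -/
def conjBy {Ω : Set ℂ} {n : ℕ} (U : L2 Ω ≃ₗᵢ[ℂ] L2 Ω ⊗[ℂ] Cn n) (T : L2 Ω →L[ℂ] L2 Ω) :
    Module.End ℂ (L2 Ω ⊗[ℂ] Cn n) :=
  U.toLinearEquiv.conj T

end ELam

end

/-!
`Λ(Ω)` consists of Lipschitz functions, so an operator that only moves mass over short distances
almost commutes with every multiplier `M_f`.

For each unit cell of the square grid, `L²` of the part of `Ω` in the cell has a Parseval frame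
`(vᵢ)` with points `xᵢ` for which `∑ᵢ ∫ |z - xᵢ|² |vᵢ|²` is as small as we like. Such frames arise
from the dyadic filtration: the increments of the projections are weighted by a square partition of
unity that varies slowly on a logarithmic scale, which makes the sum over scales small. Choose
disjoint sets of positive measure so close to the points `xᵢ` that their normalized indicators `eᵢ`
are equally well concentrated. Then `R = ∑ᵢ ⟨vᵢ, ·⟩ eᵢ` is an isometry, and since `M_f` almost acts
as `f(xᵢ)` on both `vᵢ` and `eᵢ`, the commutator `[M_f, R]` is Hilbert–Schmidt, uniformly in `f`.

Carrying this out with countably many frames at once, with sums of size `2⁻ˡ`, gives isometries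
`R₀, R₁, …` with orthogonal ranges. The shift `W` that maps `Rₗ h` to `Rₗ₊₁ h` and fixes the
orthogonal complement of all the ranges is an isometry with `R₀ R₀* + W W* = 1`, and it also lies in
`EΛ(Ω)`. Iterating the splitting gives `V₁, …, Vₙ` with `Vₖ Vₗ* = δₖₗ` and `∑ₖ Vₖ* Vₖ = 1`; then
`U h = ∑ₖ Vₖ h ⊗ eₖ` is unitary and `U T U* = ∑ₖₗ Vₖ T Vₗ* ⊗ Eₖₗ`. All the operators constructed
leave every unit cell invariant, so conjugation preserves bounded supports and hence `EΛ(Ω)₀`.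
-/

noncomputable section

namespace ELam

open scoped NNReal ComplexConjugate

section Enorm

theorem enorm_sq_eq_ofReal {E : Type*} [SeminormedAddGroup E] (x : E) :
    ‖x‖ₑ ^ 2 = ENNReal.ofReal (‖x‖ ^ 2) := by
  rw [ENNReal.ofReal_pow (norm_nonneg x), ofReal_norm]

theorem ennreal_add_sq_le (a b : ℝ≥0∞) : (a + b) ^ 2 ≤ 2 * (a ^ 2 + b ^ 2) := by
  have h := ENNReal.rpow_add_le_mul_rpow_add_rpow a b one_le_two
  norm_num at h
  exact h

variable {H : Type*} [SeminormedAddCommGroup H] [InnerProductSpace ℂ H]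

theorem enorm_inner_le (x y : H) : ‖inner ℂ x y‖ₑ ≤ ‖x‖ₑ * ‖y‖ₑ := by
  simp only [enorm_eq_nnnorm]
  exact_mod_cast nnnorm_inner_le_nnnorm x y

theorem enorm_inner_comm (x y : H) : ‖inner ℂ x y‖ₑ = ‖inner ℂ y x‖ₑ := by
  rw [← inner_conj_symm, RCLike.enorm_conj]

theorem enorm_sq_lp {ι : Type*} {G : ι → Type*} [∀ i, NormedAddCommGroup (G i)] (f : lp G 2) :
    ‖f‖ₑ ^ 2 = ∑' i, ‖f i‖ₑ ^ 2 := by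
  have h := lp.hasSum_norm (p := 2) (by norm_num) f
  simp only [ENNReal.toReal_ofNat, Real.rpow_two] at h
  simp only [enorm_sq_eq_ofReal]
  rw [← h.tsum_eq, ENNReal.ofReal_tsum_of_nonneg (fun i => by positivity) h.summable]

theorem memℓp_two_of_tsum_lt_top {ι : Type*} {G : ι → Type*} [∀ i, NormedAddCommGroup (G i)]
    {f : ∀ i, G i} (hf : ∑' i, ‖f i‖ₑ ^ 2 < ∞) : Memℓp f 2 := by
  refine memℓp_gen ?_
  simp only [ENNReal.toReal_ofNat, Real.rpow_two]
  simp only [enorm_eq_nnnorm, ← ENNReal.coe_pow] at hf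
  simpa only [NNReal.coe_pow, coe_nnnorm] using
    NNReal.summable_coe.2 (ENNReal.tsum_coe_ne_top_iff_summable.1 hf.ne)

end Enorm

/-! ## Hilbert–Schmidt operators and Parseval families -/

section HilbertSchmidt

open ContinuousLinearMap

variable {H K : Type*} [NormedAddCommGroup H] [InnerProductSpace ℂ H]
  [NormedAddCommGroup K] [InnerProductSpace ℂ K]

theorem enorm_linearIsometry_le (V : H →ₗᵢ[ℂ] K) : ‖V.toContinuousLinearMap‖ₑ ≤ 1 := by
  rw [← ofReal_norm]
  exact ENNReal.ofReal_le_one.2 V.norm_toContinuousLinearMap_le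

variable [CompleteSpace H]

theorem hsNorm_neg (T : H →L[ℂ] K) : hsNorm (-T) = hsNorm T := by
  simp [hsNorm]

variable [CompleteSpace K]

theorem enorm_adjoint (T : H →L[ℂ] K) : ‖adjoint T‖ₑ = ‖T‖ₑ := by
  simp only [← ofReal_norm, LinearIsometryEquiv.norm_map]

theorem hsNorm_sub_le (S T : H →L[ℂ] K) : hsNorm (S - T) ≤ hsNorm S + hsNorm T := by
  rw [sub_eq_add_neg, ← hsNorm_neg T]
  exact hsNorm_add_le S (-T)

theorem hsNorm_sq_eq {ι : Type*} (b : HilbertBasis ι ℂ H) (T : H →L[ℂ] K) :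
    hsNorm T ^ 2 = ∑' i, ‖T (b i)‖ₑ ^ 2 := by
  rw [hsNorm_eq b, ← ENNReal.rpow_two, ← ENNReal.rpow_mul]
  norm_num

end HilbertSchmidt

section Families

variable {H : Type*} [NormedAddCommGroup H] [InnerProductSpace ℂ H] {ι κ : Type*}

/-- The Bessel families with bound `B`, normalized so that the operator `h ↦ (⟨vᵢ, h⟩)ᵢ` into `ℓ²`
has norm at most `B`. -/
def IsBessel (B : ℝ≥0) (v : ι → H) : Prop :=
  ∀ h, ∑' i, ‖inner ℂ (v i) h‖ₑ ^ 2 ≤ (B : ℝ≥0∞) ^ 2 * ‖h‖ₑ ^ 2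

/-- The Parseval frames of a Hilbert space: like an orthonormal basis, such a family determines
the norm and the Hilbert–Schmidt norm, but it need not be orthogonal. -/
def IsParseval (v : ι → H) : Prop :=
  ∀ h, ∑' i, ‖inner ℂ (v i) h‖ₑ ^ 2 = ‖h‖ₑ ^ 2

theorem IsParseval.isBessel {v : ι → H} (hv : IsParseval v) : IsBessel 1 v :=
  fun h => by rw [hv h, ENNReal.coe_one, one_pow, one_mul]

theorem IsBessel.of_tsum_lt_top {w : ι → H} (hw : ∑' i, ‖w i‖ₑ ^ 2 < ∞) :
    ∃ B, IsBessel B w := by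
  refine ⟨((∑' i, ‖w i‖ₑ ^ 2) ^ (1 / 2 : ℝ)).toNNReal, fun h => ?_⟩
  rw [ENNReal.coe_toNNReal (ENNReal.rpow_ne_top_of_nonneg (by norm_num) hw.ne),
    ← ENNReal.rpow_two, ← ENNReal.rpow_mul, one_div, inv_mul_cancel₀ two_ne_zero,
    ENNReal.rpow_one, ← ENNReal.tsum_mul_right]
  refine ENNReal.tsum_le_tsum fun i => ?_
  rw [← mul_pow]
  gcongr
  exact enorm_inner_le _ _

theorem IsBessel.of_orthonormal {e : ι → H} (he : Orthonormal ℂ e) : IsBessel 1 e := fun h => by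
  simp only [ENNReal.coe_one, one_pow, one_mul, enorm_sq_eq_ofReal]
  rw [← ENNReal.ofReal_tsum_of_nonneg (fun i => by positivity) (he.inner_products_summable _)]
  exact ENNReal.ofReal_le_ofReal (he.tsum_inner_products_le _)

theorem IsParseval.lp_single [DecidableEq κ] {v : ι → H} (hv : IsParseval v) :
    IsParseval (fun p : κ × ι => lp.single (E := fun _ : κ => H) 2 p.1 (v p.2)) := fun f => by
  simp only [lp.inner_single_left, ENNReal.tsum_prod', enorm_sq_lp f, ← hv (f _)]

variable [CompleteSpace H]

theorem IsParseval.tsum_enorm_sq_apply {K : Type*} [NormedAddCommGroup K] [InnerProductSpace ℂ K]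
    [CompleteSpace K] {v : ι → H} (hv : IsParseval v) (A : H →L[ℂ] K) :
    ∑' i, ‖A (v i)‖ₑ ^ 2 = hsNorm A ^ 2 := by
  obtain ⟨w, b, -⟩ := exists_hilbertBasis ℂ K
  rw [← hsNorm_adjoint, hsNorm_sq_eq b, tsum_congr fun i => (parseval_enorm b (A (v i))).symm,
    tsum_congr fun j => (hv (A.adjoint (b j))).symm, ENNReal.tsum_comm]
  refine tsum_congr fun j => tsum_congr fun i => ?_
  rw [ContinuousLinearMap.adjoint_inner_right, enorm_inner_comm]

end Families

section FrameOperators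

open ContinuousLinearMap

variable {H : Type*} [NormedAddCommGroup H] [InnerProductSpace ℂ H] {ι : Type*} {B B' : ℝ≥0}
  {e v : ι → H}

theorem IsBessel.memℓp_inner (hv : IsBessel B v) (h : H) : Memℓp (fun i => inner ℂ (v i) h) 2 :=
  memℓp_two_of_tsum_lt_top ((hv h).trans_lt (by finiteness))

theorem IsBessel.norm_lp_inner_le (hv : IsBessel B v) (h : H) :
    ‖(⟨fun i => inner ℂ (v i) h, hv.memℓp_inner h⟩ : lp (fun _ : ι => ℂ) 2)‖ ≤ B * ‖h‖ := by
  have hsq := (enorm_sq_lp (⟨_, hv.memℓp_inner h⟩ : lp (fun _ : ι => ℂ) 2)).trans_le (hv h)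
  rw [← mul_pow, ENNReal.pow_le_pow_left_iff two_ne_zero] at hsq
  simpa using ENNReal.toReal_mono (by finiteness) hsq

/-- The analysis operator `h ↦ (⟨vᵢ, h⟩)ᵢ` of a Bessel family, with values in `ℓ²`. -/
def IsBessel.analysisOp (hv : IsBessel B v) : H →L[ℂ] lp (fun _ : ι => ℂ) 2 :=
  LinearMap.mkContinuous
    { toFun := fun h => ⟨fun i => inner ℂ (v i) h, hv.memℓp_inner h⟩
      map_add' := fun _ _ => by ext i; exact inner_add_right _ _ _
      map_smul' := fun _ _ => by ext i; exact inner_smul_right _ _ _ }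
    B hv.norm_lp_inner_le

theorem IsBessel.enorm_analysisOp_le (hv : IsBessel B v) : ‖hv.analysisOp‖ₑ ≤ B := by
  rw [enorm_eq_nnnorm]
  exact_mod_cast LinearMap.mkContinuous_norm_le _ B.2 _

theorem IsBessel.enorm_sq_analysisOp_apply (hv : IsBessel B v) (h : H) :
    ‖hv.analysisOp h‖ₑ ^ 2 = ∑' i, ‖inner ℂ (v i) h‖ₑ ^ 2 := enorm_sq_lp _

theorem IsParseval.norm_analysisOp_apply (hv : IsParseval v) (h : H) :
    ‖hv.isBessel.analysisOp h‖ = ‖h‖ := by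
  have hsq := (hv.isBessel.enorm_sq_analysisOp_apply h).trans (hv h)
  simpa using congrArg ENNReal.toReal hsq

variable [CompleteSpace H]

theorem IsBessel.hsNorm_analysisOp_sq (hv : IsBessel B v) :
    hsNorm hv.analysisOp ^ 2 = ∑' i, ‖v i‖ₑ ^ 2 := by
  obtain ⟨w, b, -⟩ := exists_hilbertBasis ℂ H
  simp only [hsNorm_sq_eq b, hv.enorm_sq_analysisOp_apply, ← parseval_enorm b (v _)]
  rw [ENNReal.tsum_comm]
  exact tsum_congr fun i => tsum_congr fun j => by rw [enorm_inner_comm]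

/-- The operator `h ↦ ∑ᵢ ⟨vᵢ, h⟩ eᵢ` of two Bessel families. -/
def frameOp (he : IsBessel B e) (hv : IsBessel B' v) : H →L[ℂ] H :=
  adjoint he.analysisOp ∘L hv.analysisOp

theorem hasSum_inner_frameOp (he : IsBessel B e) (hv : IsBessel B' v) (h g : H) :
    HasSum (fun i => inner ℂ (e i) g * conj (inner ℂ (v i) h)) (inner ℂ (frameOp he hv h) g) := by
  rw [frameOp, comp_apply, adjoint_inner_left]
  exact lp.hasSum_inner (hv.analysisOp h) (he.analysisOp g)

theorem hsNorm_frameOp_le_left (he : IsBessel B e) (hv : IsBessel B' v) :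
    hsNorm (frameOp he hv) ≤ hsNorm he.analysisOp * B' := by
  refine (hsNorm_comp_le' _ _).trans ?_
  rw [hsNorm_adjoint]
  gcongr
  exact hv.enorm_analysisOp_le

theorem adjoint_frameOp (he : IsBessel B e) (hv : IsBessel B' v) :
    adjoint (frameOp he hv) = frameOp hv he := by
  simp only [frameOp, adjoint_comp, adjoint_adjoint]

theorem hsNorm_frameOp_le_right (he : IsBessel B e) (hv : IsBessel B' v) :
    hsNorm (frameOp he hv) ≤ hsNorm hv.analysisOp * B := by
  rw [← hsNorm_adjoint, adjoint_frameOp]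
  exact hsNorm_frameOp_le_left hv he

theorem inner_frameOp_of_orthonormal (he : Orthonormal ℂ e) (hv : IsBessel B' v) (i : ι) (h : H) :
    inner ℂ (e i) (frameOp (.of_orthonormal he) hv h) = inner ℂ (v i) h := by
  rw [← inner_conj_symm, ← (hasSum_inner_frameOp _ hv h (e i)).tsum_eq, tsum_eq_single i]
  · simp [he.1]
  · intro j hj
    rw [he.2 hj, zero_mul]

theorem inner_frameOp_frameOp_of_inner_eq_zero {κ : Type*} {e' v' : κ → H} {C C' : ℝ≥0}
    (hee' : ∀ i j, inner ℂ (e i) (e' j) = 0) (he : IsBessel B e) (hv : IsBessel B' v)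
    (he' : IsBessel C e') (hv' : IsBessel C' v') (h g : H) :
    inner ℂ (frameOp he hv h) (frameOp he' hv' g) = 0 := by
  have he_range : ∀ i, inner ℂ (e i) (frameOp he' hv' g) = 0 := fun i => by
    rw [← inner_conj_symm, ← (hasSum_inner_frameOp he' hv' g (e i)).tsum_eq]
    simp [fun j => inner_eq_zero_symm.1 (hee' i j)]
  rw [← (hasSum_inner_frameOp he hv h _).tsum_eq]
  simp only [he_range, zero_mul, tsum_zero]

theorem norm_frameOp_apply (he : Orthonormal ℂ e) (hv : IsParseval v) (h : H) :
    ‖frameOp (.of_orthonormal he) hv.isBessel h‖ = ‖h‖ := by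
  set R := frameOp (.of_orthonormal he) hv.isBessel
  have hinner : HasSum (fun i => inner ℂ (v i) h * conj (inner ℂ (v i) h)) (inner ℂ (R h) (R h)) :=
    by simpa only [R, inner_frameOp_of_orthonormal he] using
      hasSum_inner_frameOp (.of_orthonormal he) hv.isBessel h (R h)
  have hnorm := lp.hasSum_inner (𝕜 := ℂ) (hv.isBessel.analysisOp h) (hv.isBessel.analysisOp h)
  have hsq : inner ℂ (R h) (R h) = inner ℂ (hv.isBessel.analysisOp h) (hv.isBessel.analysisOp h) :=
    hinner.unique hnorm
  rw [← hv.norm_analysisOp_apply h, norm_eq_sqrt_re_inner (𝕜 := ℂ), hsq,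
    ← norm_eq_sqrt_re_inner (𝕜 := ℂ)]

theorem commutator_frameOp_eq {C C' : ℝ≥0} {A : H →L[ℂ] H} {c : ι → ℂ} (he : IsBessel B e)
    (hv : IsBessel B' v) (hAe : IsBessel C fun i => A (e i) - c i • e i)
    (hAv : IsBessel C' fun i => star A (v i) - conj (c i) • v i) :
    A * frameOp he hv - frameOp he hv * A = frameOp hAe hv - frameOp he hAv := by
  ext1 h
  refine ext_inner_right ℂ fun g => ?_
  change inner ℂ (A (frameOp he hv h) - frameOp he hv (A h)) g =
    inner ℂ (frameOp hAe hv h - frameOp he hAv h) g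
  rw [inner_sub_left, inner_sub_left, ← adjoint_inner_right A]
  refine ((hasSum_inner_frameOp he hv h _).sub (hasSum_inner_frameOp he hv (A h) g)).unique ?_
  convert (hasSum_inner_frameOp hAe hv h g).sub (hasSum_inner_frameOp he hAv h g) using 2 with i
  rw [star_eq_adjoint, adjoint_inner_right, inner_sub_left, inner_sub_left, adjoint_inner_left,
    inner_smul_left, inner_smul_left, map_sub, map_mul, Complex.conj_conj]
  ring

/-- The total squared error with which the vectors `vᵢ` fail to be eigenvectors of `A` and of `A*`,
for the eigenvalues `cᵢ` and `c̄ᵢ`. -/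
def eigenDefect (A : H →L[ℂ] H) (c : ι → ℂ) (v : ι → H) : ℝ≥0∞ :=
  ∑' i, ‖A (v i) - c i • v i‖ₑ ^ 2 + ∑' i, ‖star A (v i) - conj (c i) • v i‖ₑ ^ 2

theorem eigenDefect_star (A : H →L[ℂ] H) (c : ι → ℂ) (v : ι → H) :
    eigenDefect (star A) (fun i => conj (c i)) v = eigenDefect A c v := by
  simp only [eigenDefect, star_star, Complex.conj_conj, add_comm]

theorem tsum_eigenDefect {κ : Type*} (A : H →L[ℂ] H) (c : κ × ι → ℂ) (v : κ × ι → H) :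
    ∑' k, eigenDefect A (fun i => c (k, i)) (fun i => v (k, i)) = eigenDefect A c v := by
  simp only [eigenDefect, ENNReal.tsum_add, ENNReal.tsum_prod']

-- If `A e ≈ c e` and `A* v ≈ c̄ v`, then the rank one operator `⟨v, ·⟩ e` almost commutes with `A`.
theorem hsNorm_commutator_frameOp_sq_le (he : IsBessel 1 e) (hv : IsBessel 1 v) (A : H →L[ℂ] H)
    (c : ι → ℂ) :
    hsNorm (A * frameOp he hv - frameOp he hv * A) ^ 2 ≤
      2 * (eigenDefect A c e + eigenDefect A c v) := by
  refine le_trans ?_ (mul_le_mul_right (add_le_add le_self_add le_add_self) 2)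
  rcases eq_or_ne (∑' i, ‖A (e i) - c i • e i‖ₑ ^ 2) ∞ with hAe | hAe
  · simp [hAe]
  rcases eq_or_ne (∑' i, ‖star A (v i) - conj (c i) • v i‖ₑ ^ 2) ∞ with hAv | hAv
  · simp [hAv]
  obtain ⟨C, hAe'⟩ := IsBessel.of_tsum_lt_top hAe.lt_top
  obtain ⟨C', hAv'⟩ := IsBessel.of_tsum_lt_top hAv.lt_top
  rw [commutator_frameOp_eq he hv hAe' hAv', ← hAe'.hsNorm_analysisOp_sq,
    ← hAv'.hsNorm_analysisOp_sq]
  refine (pow_le_pow_left' (hsNorm_sub_le _ _) 2).trans ((ennreal_add_sq_le _ _).trans ?_)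
  gcongr
  · simpa using hsNorm_frameOp_le_left hAe' hv
  · simpa using hsNorm_frameOp_le_right he hAv'

end FrameOperators

/-! ## Two isometries with complementary ranges -/

section Diagonal

open ContinuousLinearMap

variable {H : Type*} [NormedAddCommGroup H] [InnerProductSpace ℂ H] {κ : Type*}

theorem memℓp_two_comp (A : H →L[ℂ] H) (f : lp (fun _ : κ => H) 2) :
    Memℓp (fun k => A (f k)) 2 :=
  ((lp.memℓp f).const_smul (‖A‖ : ℂ)).mono' fun k => (A.le_opNorm (f k)).trans_eq <| by
    change ‖A‖ * ‖f k‖ = ‖(‖A‖ : ℂ) • f k‖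
    rw [norm_smul, Complex.norm_real, norm_norm]

theorem norm_lp_comp_le (A : H →L[ℂ] H) (f : lp (fun _ : κ => H) 2) :
    ‖(⟨fun k => A (f k), memℓp_two_comp A f⟩ : lp (fun _ : κ => H) 2)‖ ≤ ‖A‖ * ‖f‖ := by
  rw [← norm_norm A, ← norm_smul]
  refine lp.norm_mono two_ne_zero fun k => (A.le_opNorm (f k)).trans_eq ?_
  rw [lp.coeFn_smul, Pi.smul_apply, norm_smul, norm_norm]

/-- The operator `A ⊕ A ⊕ ⋯` on the `ℓ²`-direct sum of copies of `H` indexed by `κ`. -/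
def lpDiag (κ : Type*) (A : H →L[ℂ] H) : lp (fun _ : κ => H) 2 →L[ℂ] lp (fun _ : κ => H) 2 :=
  LinearMap.mkContinuous
    { toFun := fun f => ⟨fun k => A (f k), memℓp_two_comp A f⟩
      map_add' := fun f g => by ext k; exact map_add A (f k) (g k)
      map_smul' := fun c f => by ext k; exact map_smul A c (f k) }
    ‖A‖ (norm_lp_comp_le A)

theorem lpDiag_apply (A : H →L[ℂ] H) (f : lp (fun _ : κ => H) 2) (k : κ) :
    lpDiag κ A f k = A (f k) := rfl

theorem lpDiag_single [DecidableEq κ] (A : H →L[ℂ] H) (k : κ) (h : H) :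
    lpDiag κ A (lp.single 2 k h) = lp.single 2 k (A h) := by
  ext j
  rcases eq_or_ne j k with rfl | hj
  · simp [lpDiag_apply]
  · simp [lpDiag_apply, hj]

variable [CompleteSpace H]

theorem adjoint_lpDiag (A : H →L[ℂ] H) : adjoint (lpDiag κ A) = lpDiag κ (adjoint A) := by
  symm
  rw [eq_adjoint_iff]
  intro f g
  simp only [lp.inner_eq_tsum, lpDiag_apply, adjoint_inner_left]

variable {V : κ → H →ₗᵢ[ℂ] H}

theorem hsNorm_linearIsometry_intertwiner_sq (hV : OrthogonalFamily ℂ (fun _ => H) V)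
    (A : H →L[ℂ] H) :
    hsNorm (A ∘L hV.linearIsometry.toContinuousLinearMap -
        hV.linearIsometry.toContinuousLinearMap ∘L lpDiag κ A) ^ 2 =
      ∑' k, hsNorm (A * (V k).toContinuousLinearMap - (V k).toContinuousLinearMap * A) ^ 2 := by
  classical
  obtain ⟨w, b, -⟩ := exists_hilbertBasis ℂ H
  have hb : IsParseval b := parseval_enorm b
  simp only [← (hb.lp_single (κ := κ)).tsum_enorm_sq_apply, ENNReal.tsum_prod',
    ← hb.tsum_enorm_sq_apply]
  refine tsum_congr fun k => tsum_congr fun i => ?_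
  simp [lpDiag_single, hV.linearIsometry_apply_single]

end Diagonal

section Shift

open ContinuousLinearMap

variable {G H : Type*} [NormedAddCommGroup G] [InnerProductSpace ℂ G] [CompleteSpace G]
  [NormedAddCommGroup H] [InnerProductSpace ℂ H] [CompleteSpace H]

theorem adjoint_linearIsometry_apply_self (J : G →ₗᵢ[ℂ] H) (x : G) :
    adjoint J.toContinuousLinearMap (J x) = x :=
  congr($((norm_map_iff_adjoint_comp_self J.toContinuousLinearMap).1 J.norm_map) x)

theorem star_linearIsometry_mul_self (V : H →ₗᵢ[ℂ] H) :
    star V.toContinuousLinearMap * V.toContinuousLinearMap = 1 :=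
  (norm_map_iff_adjoint_comp_self V.toContinuousLinearMap).1 V.norm_map

theorem isStarProjection_comp_adjoint (J : G →ₗᵢ[ℂ] H) :
    IsStarProjection (J.toContinuousLinearMap ∘L adjoint J.toContinuousLinearMap) := by
  refine ⟨?_, ?_⟩
  · ext1 h
    simp [adjoint_linearIsometry_apply_self]
  · rw [isSelfAdjoint_iff', adjoint_comp, adjoint_adjoint]

theorem hsNorm_commutator_comp_adjoint_le (J J' : G →ₗᵢ[ℂ] H) (A : H →L[ℂ] H) (D : G →L[ℂ] G) :
    hsNorm (A * (J'.toContinuousLinearMap ∘L adjoint J.toContinuousLinearMap) -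
        (J'.toContinuousLinearMap ∘L adjoint J.toContinuousLinearMap) * A) ≤
      hsNorm (A ∘L J'.toContinuousLinearMap - J'.toContinuousLinearMap ∘L D) +
      hsNorm (star A ∘L J.toContinuousLinearMap - J.toContinuousLinearMap ∘L adjoint D) := by
  set j := J.toContinuousLinearMap
  set j' := J'.toContinuousLinearMap
  have hsplit : A * (j' ∘L adjoint j) - (j' ∘L adjoint j) * A =
      (A ∘L j' - j' ∘L D) ∘L adjoint j - j' ∘L adjoint (star A ∘L j - j ∘L adjoint D) := by
    ext1 h
    simp [star_eq_adjoint, adjoint_comp]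
  rw [hsplit]
  refine (hsNorm_sub_le _ _).trans (add_le_add ?_ ?_)
  · refine (hsNorm_comp_le' _ _).trans (mul_le_of_le_one_right' ?_)
    rw [enorm_adjoint]
    exact enorm_linearIsometry_le J
  · refine (hsNorm_comp_le _ _).trans ?_
    rw [hsNorm_adjoint]
    exact mul_le_of_le_one_left' (enorm_linearIsometry_le J')

theorem star_mul_self_add_one_sub {A : Type*} [Ring A] [StarRing A] {s p : A}
    (hp : IsStarProjection p) (hps : p * s = s) (hs : star s * s = p) :
    star (s + (1 - p)) * (s + (1 - p)) = 1 := by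
  have hsp : star s * p = star s := by
    rw [← congr(star $hps), star_mul, hp.isSelfAdjoint, mul_assoc, hp.isIdempotentElem]
  rw [star_add, star_sub, star_one, hp.isSelfAdjoint.star_eq]
  simp only [add_mul, mul_add, sub_mul, mul_sub, hs, hsp, hps, hp.isIdempotentElem.eq, one_mul,
    mul_one]
  abel

theorem add_one_sub_mul_star_self {A : Type*} [Ring A] [StarRing A] {s p : A}
    (hp : IsStarProjection p) (hsp : s * p = s) :
    (s + (1 - p)) * star (s + (1 - p)) = s * star s + (1 - p) := by
  have hps : p * star s = star s := by
    rw [← congr(star $hsp), star_mul, hp.isSelfAdjoint, ← mul_assoc, hp.isIdempotentElem]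
  rw [star_add, star_sub, star_one, hp.isSelfAdjoint.star_eq]
  simp only [add_mul, mul_add, sub_mul, mul_sub, hsp, hps, hp.isIdempotentElem.eq, one_mul,
    mul_one]
  abel

theorem hasSum_comp_adjoint_linearIsometry {κ : Type*} {V : κ → H →ₗᵢ[ℂ] H}
    (hV : OrthogonalFamily ℂ (fun _ => H) V) (h : H) :
    HasSum (fun k => V k (adjoint (V k).toContinuousLinearMap h))
      (hV.linearIsometry (adjoint hV.linearIsometry.toContinuousLinearMap h)) := by
  classical
  have hcoord (k : κ) : adjoint hV.linearIsometry.toContinuousLinearMap h k =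
      adjoint (V k).toContinuousLinearMap h := by
    refine ext_inner_left ℂ fun x => ?_
    have hsingle := lp.inner_single_left (𝕜 := ℂ) (G := fun _ : κ => H) k x
      (adjoint hV.linearIsometry.toContinuousLinearMap h)
    rw [adjoint_inner_right] at hsingle ⊢
    simpa [hV.linearIsometry_apply_single] using hsingle.symm
  simpa only [hcoord] using
    hV.hasSum_linearIsometry (adjoint hV.linearIsometry.toContinuousLinearMap h)

variable {V : ℕ → H →ₗᵢ[ℂ] H} (hV : OrthogonalFamily ℂ (fun _ => H) V)
  (hV' : OrthogonalFamily ℂ (fun _ => H) fun k => V (k + 1))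

include hV hV' in
theorem linearIsometry_comp_adjoint_eq :
    hV.linearIsometry.toContinuousLinearMap ∘L adjoint hV.linearIsometry.toContinuousLinearMap =
      (V 0).toContinuousLinearMap ∘L adjoint (V 0).toContinuousLinearMap +
      hV'.linearIsometry.toContinuousLinearMap ∘L
        adjoint hV'.linearIsometry.toContinuousLinearMap := by
  ext1 h
  have hsum := hasSum_comp_adjoint_linearIsometry hV h
  rw [← hasSum_nat_add_iff' 1, Finset.sum_range_one] at hsum
  exact eq_add_of_sub_eq' <| hsum.unique (hasSum_comp_adjoint_linearIsometry hV' h)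

theorem comp_adjoint_linearIsometry_succ_apply (f : lp (fun _ : ℕ => H) 2) :
    hV.linearIsometry (adjoint hV.linearIsometry.toContinuousLinearMap (hV'.linearIsometry f)) =
      hV'.linearIsometry f := by
  refine (hV'.hasSum_linearIsometry f).mapL
    (hV.linearIsometry.toContinuousLinearMap ∘L adjoint hV.linearIsometry.toContinuousLinearMap)
    |>.unique ?_
  convert hV'.hasSum_linearIsometry f using 2 with k
  classical
  rw [← hV.linearIsometry_apply_single (f k)]
  exact congr(hV.linearIsometry $(adjoint_linearIsometry_apply_self hV.linearIsometry _))

/-- The unilateral shift `V k h ↦ V (k + 1) h` along an orthogonal sequence of isometries, extended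
by the identity on the orthogonal complement of their ranges. -/
def shift : H →L[ℂ] H :=
  hV'.linearIsometry.toContinuousLinearMap ∘L adjoint hV.linearIsometry.toContinuousLinearMap +
    (1 - hV.linearIsometry.toContinuousLinearMap ∘L
      adjoint hV.linearIsometry.toContinuousLinearMap)

theorem star_shift_mul_shift : star (shift hV hV') * shift hV hV' = 1 := by
  refine star_mul_self_add_one_sub (isStarProjection_comp_adjoint _) ?_ ?_
  · ext1 h
    exact comp_adjoint_linearIsometry_succ_apply hV hV' _
  · ext1 h
    simp [star_eq_adjoint, adjoint_comp, adjoint_linearIsometry_apply_self]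

theorem shift_mul_star_shift :
    (V 0).toContinuousLinearMap * star (V 0).toContinuousLinearMap +
      shift hV hV' * star (shift hV hV') = 1 := by
  rw [shift, add_one_sub_mul_star_self (isStarProjection_comp_adjoint _),
    linearIsometry_comp_adjoint_eq hV hV']
  · ext1 h
    simp [star_eq_adjoint, adjoint_comp, adjoint_linearIsometry_apply_self, ← add_assoc]
  · ext1 h
    simp [adjoint_linearIsometry_apply_self]

theorem hsNorm_commutator_shift_le {A : H →L[ℂ] H} {σ : ℝ≥0∞}
    (hA : ∑' k, hsNorm (A * (V k).toContinuousLinearMap - (V k).toContinuousLinearMap * A) ^ 2 ≤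
      σ ^ 2)
    (hA' : ∑' k, hsNorm (star A * (V k).toContinuousLinearMap -
      (V k).toContinuousLinearMap * star A) ^ 2 ≤ σ ^ 2) :
    hsNorm (A * shift hV hV' - shift hV hV' * A) ≤ 4 * σ := by
  set J := hV.linearIsometry
  set J' := hV'.linearIsometry
  have hJ : hsNorm (A ∘L J.toContinuousLinearMap - J.toContinuousLinearMap ∘L lpDiag ℕ A) ≤ σ := by
    rwa [← ENNReal.pow_le_pow_left_iff two_ne_zero, hsNorm_linearIsometry_intertwiner_sq]
  have hJ_star : hsNorm (star A ∘L J.toContinuousLinearMap -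
      J.toContinuousLinearMap ∘L adjoint (lpDiag ℕ A)) ≤ σ := by
    rwa [← ENNReal.pow_le_pow_left_iff two_ne_zero, adjoint_lpDiag, ← star_eq_adjoint,
      hsNorm_linearIsometry_intertwiner_sq]
  have hJ' : hsNorm (A ∘L J'.toContinuousLinearMap - J'.toContinuousLinearMap ∘L lpDiag ℕ A) ≤
      σ := by
    rw [← ENNReal.pow_le_pow_left_iff two_ne_zero, hsNorm_linearIsometry_intertwiner_sq]
    exact (ENNReal.tsum_comp_le_tsum_of_injective Nat.succ_injective _).trans hA
  have hsplit : A * shift hV hV' - shift hV hV' * A =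
      (A * (J'.toContinuousLinearMap ∘L adjoint J.toContinuousLinearMap) -
        (J'.toContinuousLinearMap ∘L adjoint J.toContinuousLinearMap) * A) -
      (A * (J.toContinuousLinearMap ∘L adjoint J.toContinuousLinearMap) -
        (J.toContinuousLinearMap ∘L adjoint J.toContinuousLinearMap) * A) := by
    rw [shift]
    noncomm_ring
  calc hsNorm (A * shift hV hV' - shift hV hV' * A)
      ≤ (σ + σ) + (σ + σ) := by
        rw [hsplit]
        exact (hsNorm_sub_le _ _).trans <| add_le_add
          ((hsNorm_commutator_comp_adjoint_le J J' A (lpDiag ℕ A)).trans (add_le_add hJ' hJ_star))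
          ((hsNorm_commutator_comp_adjoint_le J J A (lpDiag ℕ A)).trans (add_le_add hJ hJ_star))
    _ = 4 * σ := by ring

end Shift

section FrameShift

variable {H : Type*} [NormedAddCommGroup H] [InnerProductSpace ℂ H] {ι κ : Type*}

theorem orthonormal_fiber {e : κ × ι → H} (he : Orthonormal ℂ e) (k : κ) :
    Orthonormal ℂ fun i => e (k, i) :=
  he.comp _ (Prod.mk_right_injective k)

variable [CompleteSpace H]

/-- The isometry `h ↦ ∑ᵢ ⟨vᵢ, h⟩ eᵢ` from a Parseval frame to an orthonormal family. -/
def frameIsometry {e v : ι → H} (he : Orthonormal ℂ e) (hv : IsParseval v) : H →ₗᵢ[ℂ] H :=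
  ⟨(frameOp (.of_orthonormal he) hv.isBessel : H →ₗ[ℂ] H), norm_frameOp_apply he hv⟩

theorem orthogonalFamily_frameIsometry {e : κ × ι → H} {v : κ → ι → H}
    (he : Orthonormal ℂ e) (hv : ∀ k, IsParseval (v k)) :
    OrthogonalFamily ℂ (fun _ => H) fun k => frameIsometry (orthonormal_fiber he k) (hv k) :=
  fun _ _ hkl => inner_frameOp_frameOp_of_inner_eq_zero (fun _ _ =>
    he.2 fun h => hkl (Prod.ext_iff.1 h).1) _ _ _ _

theorem tsum_hsNorm_commutator_frameIsometry_sq_le {e : κ × ι → H} {v : κ → ι → H}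
    (he : Orthonormal ℂ e) (hv : ∀ k, IsParseval (v k)) {A : H →L[ℂ] H} {c : κ × ι → ℂ}
    {σ : ℝ≥0∞} (hAe : eigenDefect A c e ≤ σ ^ 2)
    (hAv : eigenDefect A c (fun p => v p.1 p.2) ≤ σ ^ 2) :
    ∑' k, hsNorm (A * (frameIsometry (orthonormal_fiber he k) (hv k)).toContinuousLinearMap -
      (frameIsometry (orthonormal_fiber he k) (hv k)).toContinuousLinearMap * A) ^ 2 ≤
      (2 * σ) ^ 2 :=
  calc _ ≤ ∑' k, 2 * (eigenDefect A (fun i => c (k, i)) (fun i => e (k, i)) +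
        eigenDefect A (fun i => c (k, i)) (v k)) :=
        ENNReal.tsum_le_tsum fun k => hsNorm_commutator_frameOp_sq_le _ _ _ _
    _ = 2 * (eigenDefect A c e + eigenDefect A c (fun p => v p.1 p.2)) := by
        rw [ENNReal.tsum_mul_left, ENNReal.tsum_add, tsum_eigenDefect,
          tsum_eigenDefect A c fun p => v p.1 p.2]
    _ ≤ 2 * (σ ^ 2 + σ ^ 2) := by gcongr
    _ = (2 * σ) ^ 2 := by ring

theorem exists_complementary_isometries_of_frames {e : ℕ × ι → H} {v : ℕ → ι → H}
    (he : Orthonormal ℂ e) (hv : ∀ k, IsParseval (v k)) :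
    ∃ R W : H →L[ℂ] H, star R * R = 1 ∧ star W * W = 1 ∧ R * star R + W * star W = 1 ∧
      ∀ (A : H →L[ℂ] H) (c : ℕ × ι → ℂ) (σ : ℝ≥0∞), eigenDefect A c e ≤ σ ^ 2 →
        eigenDefect A c (fun p => v p.1 p.2) ≤ σ ^ 2 →
        hsNorm (A * R - R * A) ≤ 2 * σ ∧ hsNorm (A * W - W * A) ≤ 8 * σ := by
  have hV := orthogonalFamily_frameIsometry he hv
  have hV' : OrthogonalFamily ℂ (fun _ => H) fun k =>
      frameIsometry (orthonormal_fiber he (k + 1)) (hv (k + 1)) :=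
    fun _ _ hkl => hV (Nat.succ_injective.ne hkl)
  refine ⟨(frameIsometry (orthonormal_fiber he 0) (hv 0)).toContinuousLinearMap, shift hV hV',
    star_linearIsometry_mul_self _, star_shift_mul_shift hV hV', shift_mul_star_shift hV hV',
    fun A c σ hAe hAv => ?_⟩
  have hA := tsum_hsNorm_commutator_frameIsometry_sq_le he hv hAe hAv
  have hA_star : ∑' k, hsNorm (star A *
      (frameIsometry (orthonormal_fiber he k) (hv k)).toContinuousLinearMap -
      (frameIsometry (orthonormal_fiber he k) (hv k)).toContinuousLinearMap * star A) ^ 2 ≤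
      (2 * σ) ^ 2 :=
    tsum_hsNorm_commutator_frameIsometry_sq_le he hv ((eigenDefect_star A c e).trans_le hAe)
      ((eigenDefect_star A c fun p => v p.1 p.2).trans_le hAv)
  refine ⟨?_, ?_⟩
  · rw [← ENNReal.pow_le_pow_left_iff two_ne_zero]
    exact (ENNReal.le_tsum 0).trans hA
  · refine (hsNorm_commutator_shift_le hV hV' hA hA_star).trans_eq ?_
    ring

end FrameShift

/-! ## Parseval frames from filtrations -/

section SlowPartition

open Filter Topology Real

/-- The bump functions `b k` on `ℕ`, with `b k m = 0` for `m ≥ M k`, whose squares sum to one. -/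
structure IsSquarePartition (b : ℕ → ℕ → ℝ) (M : ℕ → ℕ) : Prop where
  tsum_enorm_sq : ∀ m, ∑' k, ‖b k m‖ₑ ^ 2 = 1
  eq_zero : ∀ k m, M k ≤ m → b k m = 0

/-- A Lipschitz function supported in `[-1, 1]`, the squares of whose integer translates sum to
one. -/
def bump (s : ℝ) : ℝ := cos (π / 2 * min |s| 1)

theorem bump_eq_zero {s : ℝ} (hs : 1 ≤ |s|) : bump s = 0 := by
  rw [bump, min_eq_right hs, mul_one, cos_pi_div_two]

theorem abs_bump_sub_le (s t : ℝ) : |bump s - bump t| ≤ 2 * |s - t| := by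
  have hcos : |bump s - bump t| ≤ |π / 2 * min |s| 1 - π / 2 * min |t| 1| := by
    simpa [bump, Real.dist_eq] using
      Real.lipschitzWith_cos.dist_le_mul (π / 2 * min |s| 1) (π / 2 * min |t| 1)
  have hmin : |min |s| 1 - min |t| 1| ≤ |s - t| :=
    (abs_min_sub_min_le_max _ _ _ _).trans (by simpa using abs_abs_sub_abs_le_abs_sub s t)
  calc |bump s - bump t| ≤ π / 2 * |min |s| 1 - min |t| 1| := by
        rwa [← mul_sub, abs_mul, abs_of_pos (half_pos pi_pos)] at hcos
    _ ≤ 2 * |s - t| :=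
        mul_le_mul (by linarith [pi_le_four]) hmin (abs_nonneg _) (by norm_num)

theorem tsum_bump_sq {t : ℝ} (ht : 0 ≤ t) : ∑' k : ℕ, ‖bump (t - k)‖ₑ ^ 2 = 1 := by
  set j := ⌊t⌋₊
  have hjt : (j : ℝ) ≤ t := Nat.floor_le ht
  have htj : t < j + 1 := Nat.lt_floor_add_one t
  have hcos : bump (t - j) = cos (π / 2 * (t - j)) := by
    rw [bump, abs_of_nonneg (by linarith), min_eq_left (by linarith)]
  have hsin : bump (t - (j + 1 : ℕ)) = sin (π / 2 * (t - j)) := by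
    push_cast
    rw [bump, abs_of_nonpos (by linarith), min_eq_left (by linarith), ← cos_pi_div_two_sub]
    ring_nf
  rw [tsum_eq_sum (s := {j, j + 1})]
  · rw [Finset.sum_pair (by omega), hcos, hsin, enorm_sq_eq_ofReal, enorm_sq_eq_ofReal,
      ← ENNReal.ofReal_add (by positivity) (by positivity), norm_eq_abs, norm_eq_abs, sq_abs,
      sq_abs, cos_sq_add_sin_sq, ENNReal.ofReal_one]
  · intro k hk
    simp only [Finset.mem_insert, Finset.mem_singleton, not_or] at hk
    have hfar : 1 ≤ |t - k| := by
      rcases lt_or_ge k j with hkj | hkj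
      · have : (k : ℝ) + 1 ≤ j := by exact_mod_cast hkj
        exact le_abs.2 (Or.inl (by linarith))
      · have : (j : ℝ) + 2 ≤ k := by exact_mod_cast (by omega : j + 2 ≤ k)
        exact le_abs.2 (Or.inr (by linarith))
    simp [bump_eq_zero hfar]

theorem tsum_bump_sub_bump_sq_le {t t' : ℝ} (ht : 0 ≤ t) (h : t ≤ t') (h' : t' ≤ t + 1) :
    ∑' k : ℕ, ‖bump (t - k) - bump (t' - k)‖ₑ ^ 2 ≤ ENNReal.ofReal (12 * (t' - t) ^ 2) := by
  set j := ⌊t⌋₊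
  have hjt : (j : ℝ) ≤ t := Nat.floor_le ht
  have htj : t < j + 1 := Nat.lt_floor_add_one t
  have hterm (k : ℕ) : ‖bump (t - k) - bump (t' - k)‖ₑ ^ 2 ≤
      ENNReal.ofReal (4 * (t' - t) ^ 2) := by
    rw [enorm_sq_eq_ofReal]
    refine ENNReal.ofReal_le_ofReal ?_
    calc |bump (t - k) - bump (t' - k)| ^ 2 ≤ (2 * |t - k - (t' - k)|) ^ 2 := by
          gcongr
          exact abs_bump_sub_le _ _
      _ = 4 * (t' - t) ^ 2 := by rw [mul_pow, sq_abs]; ring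
  rw [tsum_eq_sum (s := {j, j + 1, j + 2})]
  · have hcard : ({j, j + 1, j + 2} : Finset ℕ).card = 3 := by
      rw [Finset.card_eq_three]
      exact ⟨j, j + 1, j + 2, by omega, by omega, by omega, rfl⟩
    refine (Finset.sum_le_card_nsmul _ _ _ fun k _ => hterm k).trans_eq ?_
    rw [hcard, ← ENNReal.ofReal_nsmul, nsmul_eq_mul]
    ring_nf
  · intro k hk
    simp only [Finset.mem_insert, Finset.mem_singleton, not_or] at hk
    rcases lt_or_ge k j with hkj | hkj
    · have : (k : ℝ) + 1 ≤ j := by exact_mod_cast hkj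
      simp [bump_eq_zero (s := t - k) (le_abs.2 (Or.inl (by linarith))),
        bump_eq_zero (s := t' - k) (le_abs.2 (Or.inl (by linarith)))]
    · have : (j : ℝ) + 3 ≤ k := by exact_mod_cast (by omega : j + 3 ≤ k)
      simp [bump_eq_zero (s := t - k) (le_abs.2 (Or.inr (by linarith))),
        bump_eq_zero (s := t' - k) (le_abs.2 (Or.inr (by linarith)))]

theorem log_succ_sub_log_le {x : ℝ} (hx : 0 < x) : log (x + 1) - log x ≤ 1 / x := by
  rw [← log_div (by positivity) hx.ne']
  refine (log_le_sub_one_of_pos (by positivity)).trans_eq ?_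
  field_simp
  ring

-- On the logarithmic scale the increments of `b k m = bump (log (m + s) - k)` are `O(1 / (m + s))`,
-- which is square summable, with small sum for large `s`.
theorem exists_slow_squarePartition {ε : ℝ≥0∞} (hε : 0 < ε) : ∃ b M, IsSquarePartition b M ∧
    ∑' k, ∑' m, ‖b k m - b k (m + 1)‖ₑ ^ 2 ≤ ε := by
  set f : ℕ → ℝ≥0∞ := fun i => ENNReal.ofReal (12 * (1 / (i : ℝ) ^ 2)) with hf
  have hf_sum : ∑' i, f i ≠ ∞ := by
    rw [hf, ← ENNReal.ofReal_tsum_of_nonneg (fun i => by positivity)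
      ((Real.summable_one_div_nat_pow.2 (by norm_num)).mul_left 12)]
    exact ENNReal.ofReal_ne_top
  obtain ⟨s, hs, hs1⟩ := (((ENNReal.tendsto_sum_nat_add f hf_sum).eventually
    (gt_mem_nhds hε)).and (eventually_ge_atTop 1)).exists
  have hms (m : ℕ) : (1 : ℝ) ≤ m + s := by exact_mod_cast (by omega : 1 ≤ m + s)
  have hlog : Tendsto (fun m : ℕ => log ((m : ℝ) + s)) atTop atTop :=
    tendsto_log_atTop.comp (tendsto_atTop_add_const_right _ _ tendsto_natCast_atTop_atTop)
  choose M hM using fun k : ℕ => eventually_atTop.1 (hlog.eventually_ge_atTop ((k : ℝ) + 1))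
  refine ⟨fun k m => bump (log (m + s) - k), M, ⟨fun m => tsum_bump_sq (log_nonneg (hms m)),
    fun k m hm => bump_eq_zero (le_abs.2 (Or.inl (by linarith [hM k m hm])))⟩, ?_⟩
  rw [ENNReal.tsum_comm]
  refine (ENNReal.tsum_le_tsum fun m => ?_).trans hs.le
  have hpos : (0 : ℝ) < m + s := one_pos.trans_le (hms m)
  have hmono : log ((m : ℝ) + s) ≤ log (m + s + 1) := log_le_log hpos (by linarith)
  have hdiff := log_succ_sub_log_le hpos
  have hone : 1 / ((m : ℝ) + s) ≤ 1 := (div_le_one hpos).2 (hms m)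
  have hsq := tsum_bump_sub_bump_sq_le (log_nonneg (hms m)) hmono (by linarith)
  simp only [hf, Nat.cast_add, Nat.cast_one, add_right_comm (m : ℝ) 1, ← one_div_pow]
  exact hsq.trans (ENNReal.ofReal_le_ofReal (by gcongr))

end SlowPartition

section Filtration

open Filter Topology

variable {H : Type*} [NormedAddCommGroup H] [InnerProductSpace ℂ H]

theorem enorm_add_sq_of_inner_eq_zero {x y : H} (h : inner ℂ x y = 0) :
    ‖x + y‖ₑ ^ 2 = ‖x‖ₑ ^ 2 + ‖y‖ₑ ^ 2 := by
  have hpyth := norm_add_sq_eq_norm_sq_add_norm_sq_of_inner_eq_zero x y h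
  simp only [← sq] at hpyth
  rw [enorm_sq_eq_ofReal, enorm_sq_eq_ofReal, enorm_sq_eq_ofReal,
    ← ENNReal.ofReal_add (by positivity) (by positivity), hpyth]

theorem enorm_sq_sum_smul_increment {F : ℕ → H}
    (hF : ∀ m n, m ≤ n → inner ℂ (F m) (F (n + 1) - F n) = 0) (β : ℕ → ℂ) (N : ℕ) :
    ‖∑ m ∈ Finset.range N, β m • (F (m + 1) - F m)‖ₑ ^ 2 =
      ∑ m ∈ Finset.range N, ‖β m‖ₑ ^ 2 * ‖F (m + 1) - F m‖ₑ ^ 2 := by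
  induction N with
  | zero => simp
  | succ N ih =>
    rw [Finset.sum_range_succ, Finset.sum_range_succ, enorm_add_sq_of_inner_eq_zero, ih,
      enorm_smul, mul_pow]
    rw [sum_inner]
    refine Finset.sum_eq_zero fun m hm => ?_
    have hmN := Finset.mem_range.1 hm
    simp [inner_smul_left, inner_smul_right, inner_sub_left, hF _ _ hmN, hF _ _ hmN.le]

theorem sum_range_sub_smul_add (F : ℕ → H) (h0 : F 0 = 0) (b : ℕ → ℂ) (N : ℕ) :
    ∑ m ∈ Finset.range N, (b m - b (m + 1)) • F (m + 1) + b N • F N =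
      ∑ m ∈ Finset.range N, b m • (F (m + 1) - F m) := by
  induction N with
  | zero => simp [h0]
  | succ N ih =>
    rw [Finset.sum_range_succ, Finset.sum_range_succ, ← ih, sub_smul, smul_sub]
    abel

variable (K : ℕ → Submodule ℂ H) [∀ m, (K m).HasOrthogonalProjection]

/-- The martingale of the projections of `h` to a filtration `K`, started at `0`: its value at
`m + 1` is the projection to `K m`. -/
def projMartingale (h : H) : ℕ → H
  | 0 => 0
  | m + 1 => (K m).starProjection h

/-- The vectors `∑ₘ (b k m - b k (m + 1)) Pₘ (u (M k) c)`, with `Pₘ` the projection to `K m`. If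
each `u m` is a Parseval frame of `K m` and `b` is a square partition, they form a Parseval frame:
by partial summation, the `k`-th of them measure `∑ₘ b k m (Pₘ - Pₘ₋₁) h`. -/
def filtrationFrame {γ : Type*} (u : ℕ → γ → H) (b : ℕ → ℕ → ℝ) (M : ℕ → ℕ) (p : ℕ × γ) : H :=
  ∑ m ∈ Finset.range (M p.1 + 1),
    ((b p.1 m - b p.1 (m + 1) : ℝ) : ℂ) • (K m).starProjection (u (M p.1) p.2)

variable {K}

theorem projMartingale_succ_mem (hK : Monotone K) (h : H) {m n : ℕ} (hmn : m ≤ n) :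
    projMartingale K h (m + 1) ∈ K n :=
  hK hmn (Submodule.starProjection_apply_mem _ _)

theorem inner_projMartingale_increment (hK : Monotone K) (h : H) {m n : ℕ} (hmn : m ≤ n) :
    inner ℂ (projMartingale K h m) (projMartingale K h (n + 1) - projMartingale K h n) = 0 := by
  have hproj {l : ℕ} {w : H} (hw : w ∈ K l) :
      inner ℂ w (projMartingale K h (l + 1)) = inner ℂ w h := by
    rw [projMartingale, ← Submodule.inner_starProjection_left_eq_right,
      Submodule.starProjection_eq_self_iff.2 hw]
  rcases m with - | m
  · exact inner_zero_left _
  obtain ⟨n, rfl⟩ : ∃ n', n = n' + 1 := ⟨n - 1, by omega⟩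
  rw [inner_sub_right, hproj (projMartingale_succ_mem hK h (by omega)),
    hproj (projMartingale_succ_mem hK h (by omega)), sub_self]

theorem tsum_enorm_sq_projMartingale_increment [CompleteSpace H] (hK : Monotone K)
    (hdense : ⊤ ≤ (⨆ m, K m).topologicalClosure) (h : H) :
    ∑' m, ‖projMartingale K h (m + 1) - projMartingale K h m‖ₑ ^ 2 = ‖h‖ₑ ^ 2 := by
  have hpartial (N : ℕ) : ∑ m ∈ Finset.range N,
      ‖projMartingale K h (m + 1) - projMartingale K h m‖ₑ ^ 2 = ‖projMartingale K h N‖ₑ ^ 2 := by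
    have hsum := enorm_sq_sum_smul_increment
      (fun _ _ => inner_projMartingale_increment hK h) (fun _ => 1) N
    simp only [one_smul, enorm_one, one_pow, one_mul, Finset.sum_range_sub] at hsum
    rw [← hsum, projMartingale, sub_zero]
  have htsum := ENNReal.tendsto_nat_tsum
    fun m => ‖projMartingale K h (m + 1) - projMartingale K h m‖ₑ ^ 2
  simp only [hpartial] at htsum
  refine tendsto_nhds_unique ((tendsto_add_atTop_iff_nat 1).2 htsum) ?_
  exact ((ENNReal.continuous_pow 2).comp continuous_enorm).continuousAt.tendsto.comp
    (Submodule.starProjection_tendsto_self K hK h hdense)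

variable {γ : Type*} {u : ℕ → γ → H} {b : ℕ → ℕ → ℝ} {M : ℕ → ℕ}

theorem tsum_enorm_sq_inner_filtrationFrame (hK : Monotone K)
    (hu : ∀ m, ∀ g ∈ K m, ∑' c, ‖inner ℂ (u m c) g‖ₑ ^ 2 = ‖g‖ₑ ^ 2)
    (hb : IsSquarePartition b M) (h : H) (k : ℕ) :
    ∑' c, ‖inner ℂ (filtrationFrame K u b M (k, c)) h‖ₑ ^ 2 =
      ∑' m, ‖b k m‖ₑ ^ 2 * ‖projMartingale K h (m + 1) - projMartingale K h m‖ₑ ^ 2 := by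
  set F := projMartingale K h
  set g := ∑ m ∈ Finset.range (M k + 1), ((b k m - b k (m + 1) : ℝ) : ℂ) • F (m + 1) with hg
  have hinner (c : γ) : inner ℂ (filtrationFrame K u b M (k, c)) h = inner ℂ (u (M k) c) g := by
    rw [hg, filtrationFrame, sum_inner, inner_sum]
    refine Finset.sum_congr rfl fun m _ => ?_
    rw [inner_smul_left, inner_smul_right, Complex.conj_ofReal,
      Submodule.inner_starProjection_left_eq_right]
    rfl
  have hmem : g ∈ K (M k) := Submodule.sum_mem _ fun m hm => Submodule.smul_mem _ _
    (projMartingale_succ_mem hK h (Nat.lt_succ_iff.1 (Finset.mem_range.1 hm)))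
  have hparts := sum_range_sub_smul_add F rfl (fun m => (b k m : ℂ)) (M k + 1)
  simp only [hb.eq_zero k (M k + 1) (by omega), Complex.ofReal_zero, zero_smul, add_zero,
    ← Complex.ofReal_sub] at hparts
  simp only [hinner]
  rw [hu _ _ hmem, hg, hparts, enorm_sq_sum_smul_increment
    fun _ _ => inner_projMartingale_increment hK h, tsum_eq_sum (s := Finset.range (M k + 1))]
  · refine Finset.sum_congr rfl fun m _ => ?_
    rw [← ofReal_norm, Complex.norm_real, ofReal_norm]
  · intro m hm
    simp [hb.eq_zero k m (by rw [Finset.mem_range] at hm; omega)]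

theorem isParseval_filtrationFrame [CompleteSpace H] (hK : Monotone K)
    (hdense : ⊤ ≤ (⨆ m, K m).topologicalClosure)
    (hu : ∀ m, ∀ g ∈ K m, ∑' c, ‖inner ℂ (u m c) g‖ₑ ^ 2 = ‖g‖ₑ ^ 2)
    (hb : IsSquarePartition b M) : IsParseval (filtrationFrame K u b M) := fun h => by
  simp only [ENNReal.tsum_prod', tsum_enorm_sq_inner_filtrationFrame hK hu hb]
  rw [ENNReal.tsum_comm]
  simp only [ENNReal.tsum_mul_right, hb.tsum_enorm_sq, one_mul]
  exact tsum_enorm_sq_projMartingale_increment hK hdense h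

end Filtration

/-! ## Dyadic squares -/

section DyadicCells

open Filter Topology

/-- The index of the dyadic square of side `2⁻ᵐ` that contains `z`. -/
def cellIdx (m : ℕ) (z : ℂ) : ℤ × ℤ := (⌊2 ^ m * z.re⌋, ⌊2 ^ m * z.im⌋)

/-- The dyadic squares of side `2⁻ᵐ`. -/
def cell (m : ℕ) (c : ℤ × ℤ) : Set ℂ := cellIdx m ⁻¹' {c}

theorem mem_cell {m : ℕ} {c : ℤ × ℤ} {z : ℂ} : z ∈ cell m c ↔ cellIdx m z = c := Iff.rfl

theorem measurable_cellIdx (m : ℕ) : Measurable (cellIdx m) :=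
  (Int.measurable_floor.comp (Complex.measurable_re.const_mul _)).prodMk
    (Int.measurable_floor.comp (Complex.measurable_im.const_mul _))

theorem measurableSet_preimage_cellIdx (m : ℕ) (s : Set (ℤ × ℤ)) :
    MeasurableSet (cellIdx m ⁻¹' s) := measurable_cellIdx m .of_discrete

theorem measurableSet_cell (m : ℕ) (c : ℤ × ℤ) : MeasurableSet (cell m c) :=
  measurableSet_preimage_cellIdx m _

theorem disjoint_cell (m : ℕ) {c c' : ℤ × ℤ} (h : c ≠ c') : Disjoint (cell m c) (cell m c') :=
  Disjoint.preimage _ (by simpa using h)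

theorem iUnion_cell (m : ℕ) : ⋃ c, cell m c = Set.univ := by
  ext z
  simp [mem_cell]

theorem floor_two_pow_mul (m : ℕ) (x : ℝ) : ⌊2 ^ m * x⌋ = ⌊2 ^ (m + 1) * x⌋ / 2 := by
  rw [← Nat.cast_ofNat (R := ℤ), ← Int.floor_div_natCast]
  congr 1
  push_cast
  rw [pow_succ]
  ring

theorem cellIdx_eq_half (m : ℕ) (z : ℂ) :
    cellIdx m z = ((cellIdx (m + 1) z).1 / 2, (cellIdx (m + 1) z).2 / 2) := by
  simp only [cellIdx, floor_two_pow_mul m]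

theorem cellIdx_eq_of_le {m M : ℕ} (h : m ≤ M) {z w : ℂ} (hzw : cellIdx M z = cellIdx M w) :
    cellIdx m z = cellIdx m w := by
  induction M, h using Nat.le_induction with
  | base => exact hzw
  | succ n _ ih => exact ih (by rw [cellIdx_eq_half, cellIdx_eq_half n w, hzw])

theorem cell_subset_of_le {m M : ℕ} (h : m ≤ M) (z : ℂ) :
    cell M (cellIdx M z) ⊆ cell m (cellIdx m z) := fun _ hw => cellIdx_eq_of_le h hw

theorem abs_sub_le_of_floor_two_pow_mul_eq {m : ℕ} {x y : ℝ} (h : ⌊2 ^ m * x⌋ = ⌊2 ^ m * y⌋) :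
    |x - y| ≤ (1 / 2) ^ m := by
  have hlt := Int.abs_sub_lt_one_of_floor_eq_floor h
  rw [← mul_sub, abs_mul, abs_of_pos (by positivity : (0 : ℝ) < 2 ^ m)] at hlt
  rw [one_div, inv_pow, ← one_div, le_div_iff₀ (by positivity)]
  linarith

theorem norm_sub_le_of_cellIdx_eq {m : ℕ} {z w : ℂ} (h : cellIdx m z = cellIdx m w) :
    ‖z - w‖ ≤ √2 * (1 / 2) ^ m := by
  have hre := abs_sub_le_of_floor_two_pow_mul_eq (congrArg Prod.fst h)
  have him := abs_sub_le_of_floor_two_pow_mul_eq (congrArg Prod.snd h)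
  refine (Complex.norm_le_sqrt_two_mul_max _).trans ?_
  gcongr
  exact max_le (by simpa using hre) (by simpa using him)

theorem floor_two_pow_mul_mem_Ico (m : ℕ) (x : ℝ) :
    ⌊2 ^ m * x⌋ ∈ Finset.Ico (2 ^ m * ⌊x⌋) (2 ^ m * ⌊x⌋ + 2 ^ m) := by
  rw [Finset.mem_Ico, Int.le_floor, Int.floor_lt]
  push_cast
  have hle := Int.floor_le x
  have hlt := Int.lt_floor_add_one x
  have hpos : (0 : ℝ) < 2 ^ m := by positivity
  constructor <;> nlinarith

theorem cellIdx_mem_of_cellIdx_zero {q : ℤ × ℤ} {z : ℂ} (m : ℕ) (h : cellIdx 0 z = q) :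
    cellIdx m z ∈ Finset.Ico (2 ^ m * q.1) (2 ^ m * q.1 + 2 ^ m) ×ˢ
      Finset.Ico (2 ^ m * q.2) (2 ^ m * q.2 + 2 ^ m) := by
  subst h
  rw [Finset.mem_product]
  exact ⟨by simpa [cellIdx] using floor_two_pow_mul_mem_Ico m z.re,
    by simpa [cellIdx] using floor_two_pow_mul_mem_Ico m z.im⟩

theorem exists_cell_subset_of_isOpen {U : Set ℂ} (hU : IsOpen U) {z : ℂ} (hz : z ∈ U) :
    ∃ m, cell m (cellIdx m z) ⊆ U := by
  obtain ⟨ε, hε, hεU⟩ := Metric.isOpen_iff.1 hU z hz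
  have hlim : Tendsto (fun m : ℕ => √2 * (1 / 2 : ℝ) ^ m) atTop (𝓝 0) := by
    simpa using (tendsto_pow_atTop_nhds_zero_of_lt_one (r := (1 / 2 : ℝ)) (by norm_num)
      (by norm_num)).const_mul √2
  obtain ⟨m, hm⟩ := (hlim.eventually (gt_mem_nhds hε)).exists
  refine ⟨m, fun w hw => hεU ?_⟩
  rw [Metric.mem_ball, dist_eq_norm]
  exact (norm_sub_le_of_cellIdx_eq hw).trans_lt hm

theorem borel_eq_generateFrom_cells : (inferInstance : MeasurableSpace ℂ) =
    MeasurableSpace.generateFrom (Set.range fun p : ℕ × ℤ × ℤ => cell p.1 p.2) := by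
  refine le_antisymm ?_ (MeasurableSpace.generateFrom_le ?_)
  · rw [BorelSpace.measurable_eq (α := ℂ), borel]
    refine MeasurableSpace.generateFrom_le fun U (hU : IsOpen U) => ?_
    have hUnion : U = ⋃ p : {p : ℕ × ℤ × ℤ // cell p.1 p.2 ⊆ U}, cell p.1.1 p.1.2 := by
      refine Set.Subset.antisymm (fun z hz => ?_) (Set.iUnion_subset fun p => p.2)
      obtain ⟨m, hm⟩ := exists_cell_subset_of_isOpen hU hz
      exact Set.mem_iUnion.2 ⟨⟨(m, cellIdx m z), hm⟩, rfl⟩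
    rw [hUnion]
    exact MeasurableSet.iUnion fun p => MeasurableSpace.measurableSet_generateFrom ⟨p.1, rfl⟩
  · rintro _ ⟨p, rfl⟩
    exact measurableSet_cell p.1 p.2

theorem isPiSystem_cells : IsPiSystem (Set.range fun p : ℕ × ℤ × ℤ => cell p.1 p.2) := by
  have inter_eq : ∀ m M c C, m ≤ M → (cell m c ∩ cell M C).Nonempty →
      cell M C = cell m c ∩ cell M C := by
    rintro m M c C h ⟨z, rfl, rfl⟩
    exact (Set.inter_eq_right.2 (cell_subset_of_le h z)).symm
  rintro _ ⟨⟨m, c⟩, rfl⟩ _ ⟨⟨M, C⟩, rfl⟩ hne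
  rcases le_total m M with h | h
  · exact ⟨(M, C), inter_eq _ _ _ _ h hne⟩
  · rw [Set.inter_comm] at hne ⊢
    exact ⟨(m, c), inter_eq _ _ _ _ h hne⟩

theorem ae_eq_zero_of_setIntegral_cell_eq_zero {μ : Measure ℂ} {f : ℂ → ℂ} (hf : Integrable f μ)
    (h : ∀ m c, ∫ z in cell m c, f z ∂μ = 0) : f =ᵐ[μ] 0 := by
  have huniv : ∫ z, f z ∂μ = 0 := by
    rw [← setIntegral_univ, ← iUnion_cell 0, integral_iUnion (measurableSet_cell 0)
      (fun c c' hcc => disjoint_cell 0 hcc) hf.integrableOn]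
    simp [h]
  have hset : ∀ s, MeasurableSet s → ∫ z in s, f z ∂μ = 0 := by
    intro s hs
    induction s, hs using MeasurableSpace.induction_on_inter borel_eq_generateFrom_cells
      isPiSystem_cells with
    | empty => simp
    | basic t ht =>
      obtain ⟨p, rfl⟩ := ht
      exact h p.1 p.2
    | compl t ht ih => simpa [ih, huniv] using integral_add_compl ht hf
    | iUnion g hd hm ih =>
      rw [integral_iUnion hm hd hf.integrableOn]
      simp [ih]
  exact hf.ae_eq_zero_of_forall_setIntegral_eq_zero fun s hs _ => hset s hs

end DyadicCells

section CellSpace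

theorem tsum_inner_sq_of_mem_closure_span {H ι : Type*} [NormedAddCommGroup H]
    [InnerProductSpace ℂ H] [CompleteSpace H] {e : ι → H} (he : Orthonormal ℂ e) {g : H}
    (hg : g ∈ (Submodule.span ℂ (Set.range e)).topologicalClosure) :
    ∑' i, ‖inner ℂ (e i) g‖ₑ ^ 2 = ‖g‖ₑ ^ 2 := by
  have heB := IsBessel.of_orthonormal he
  have hfix : frameOp heB heB g = g := by
    refine ContinuousLinearMap.eqOn_closure_span (f := frameOp heB heB)
      (g := ContinuousLinearMap.id ℂ H) (s := Set.range e) ?_ hg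
    rintro _ ⟨i, rfl⟩
    refine ext_inner_right ℂ fun f => (hasSum_inner_frameOp heB heB (e i) f).unique ?_
    convert hasSum_single i fun j hj => ?_ using 1
    · simp [he.1 i]
    · simp [he.2 hj]
  have hnorm : ‖heB.analysisOp g‖ = ‖g‖ := by
    have hinner : inner ℂ (heB.analysisOp g) (heB.analysisOp g) = inner ℂ g g := by
      rw [← ContinuousLinearMap.adjoint_inner_left]
      exact congrArg (inner ℂ · g) hfix
    rw [norm_eq_sqrt_re_inner (𝕜 := ℂ), norm_eq_sqrt_re_inner (𝕜 := ℂ) g, hinner]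
  rw [← heB.enorm_sq_analysisOp_apply, ← ofReal_norm, hnorm, ofReal_norm]

/-- The indicator function of `N`, normalized to be a unit vector of `L²(μ)`; it is zero if `N` is
null. -/
def unitInd {α : Type*} [MeasurableSpace α] {μ : Measure α} {N : Set α} (hN : MeasurableSet N)
    (h : μ N ≠ ∞) : Lp ℂ 2 μ :=
  (((√(μ.real N))⁻¹ : ℝ) : ℂ) • indicatorConstLp 2 hN h (1 : ℂ)

theorem orthonormal_unitInd {α κ : Type*} [MeasurableSpace α] {μ : Measure α} {N : κ → Set α}
    (hN : ∀ k, MeasurableSet (N k)) (h : ∀ k, μ (N k) ≠ ∞) (h0 : ∀ k, μ (N k) ≠ 0)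
    (hd : Pairwise (Function.onFun Disjoint N)) :
    Orthonormal ℂ fun k => unitInd (hN k) (h k) := by
  classical
  rw [orthonormal_iff_ite]
  intro k k'
  rw [unitInd, unitInd, inner_smul_left, inner_smul_right,
    L2.inner_indicatorConstLp_one_indicatorConstLp_one (hN k) (hN k') (h k) (h k'),
    Complex.conj_ofReal]
  split_ifs with hk
  · subst hk
    have hpos : 0 < μ.real (N k) := ENNReal.toReal_pos (h0 k) (h k)
    rw [Set.inter_self, ← RCLike.ofReal_eq_complex_ofReal, ← RCLike.ofReal_mul,
      ← RCLike.ofReal_mul, ← mul_assoc, ← mul_inv, Real.mul_self_sqrt hpos.le,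
      inv_mul_cancel₀ hpos.ne', RCLike.ofReal_one]
  · rw [(hd hk).inter_eq]
    simp

variable (μ : Measure ℂ) [IsFiniteMeasure μ]

/-- The indicator of a dyadic square in `L²(μ)`. -/
def ind (m : ℕ) (c : ℤ × ℤ) : Lp ℂ 2 μ :=
  indicatorConstLp 2 (measurableSet_cell m c) (measure_ne_top μ _) (1 : ℂ)

/-- The closed span of the indicators of the dyadic squares of side `2⁻ᵐ`: the functions in
`L²(μ)` that are constant on each of these squares. -/
def cellSpace (m : ℕ) : Submodule ℂ (Lp ℂ 2 μ) :=
  (Submodule.span ℂ (Set.range (ind μ m))).topologicalClosure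

instance (m : ℕ) : (cellSpace μ m).HasOrthogonalProjection := by
  unfold cellSpace; infer_instance

theorem ind_mem_cellSpace (m : ℕ) (c : ℤ × ℤ) : ind μ m c ∈ cellSpace μ m :=
  Submodule.le_topologicalClosure _ (Submodule.subset_span ⟨c, rfl⟩)

theorem inner_ind_ind (m M : ℕ) (c C : ℤ × ℤ) :
    inner ℂ (ind μ m c) (ind μ M C) = μ.real (cell m c ∩ cell M C) :=
  L2.inner_indicatorConstLp_one_indicatorConstLp_one _ _

theorem inner_ind (m : ℕ) (c : ℤ × ℤ) (f : Lp ℂ 2 μ) :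
    inner ℂ (ind μ m c) f = ∫ z in cell m c, f z ∂μ :=
  L2.inner_indicatorConstLp_one _ _ _

theorem indicatorConstLp_preimage_mem_cellSpace (m : ℕ) (s : Finset (ℤ × ℤ)) :
    indicatorConstLp 2 (measurableSet_preimage_cellIdx m s) (measure_ne_top μ _) (1 : ℂ) ∈
      cellSpace μ m := by
  induction s using Finset.induction_on with
  | empty =>
    convert zero_mem (cellSpace μ m)
    simp
  | insert c s hc ih =>
    have hd : Disjoint (cell m c) (cellIdx m ⁻¹' s) := Disjoint.preimage _ (by simpa using hc)
    convert add_mem (ind_mem_cellSpace μ m c) ih using 1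
    rw [ind, ← indicatorConstLp_disjoint_union (p := 2) (μ := μ) (measurableSet_cell m c)
      (measurableSet_preimage_cellIdx m s) (measure_ne_top μ _) (measure_ne_top μ _) hd (1 : ℂ)]
    congr 1
    rw [Finset.coe_insert, Set.insert_eq, Set.preimage_union]
    rfl

theorem cell_eq_preimage_succ (m : ℕ) (c : ℤ × ℤ) :
    cell m c = cellIdx (m + 1) ⁻¹'
      (({2 * c.1, 2 * c.1 + 1} : Finset ℤ) ×ˢ ({2 * c.2, 2 * c.2 + 1} : Finset ℤ) :
        Finset (ℤ × ℤ)) := by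
  ext z
  rw [mem_cell, cellIdx_eq_half]
  simp only [Set.mem_preimage, Finset.mem_coe, Finset.mem_product, Finset.mem_insert,
    Finset.mem_singleton, Prod.ext_iff]
  omega

theorem monotone_cellSpace : Monotone (cellSpace μ) := by
  refine monotone_nat_of_le_succ fun m => ?_
  refine Submodule.topologicalClosure_minimal _ ?_ (Submodule.isClosed_topologicalClosure _)
  rw [Submodule.span_le]
  rintro _ ⟨c, rfl⟩
  rw [SetLike.mem_coe, ind]
  simp only [cell_eq_preimage_succ]
  exact indicatorConstLp_preimage_mem_cellSpace μ (m + 1) _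

theorem iSup_cellSpace_dense : ⊤ ≤ (⨆ m, cellSpace μ m).topologicalClosure := by
  refine top_le_iff.2 (Submodule.topologicalClosure_eq_top_iff.2 ?_)
  rw [Submodule.eq_bot_iff]
  intro f hf
  refine Lp.eq_zero_iff_ae_eq_zero.2 (ae_eq_zero_of_setIntegral_cell_eq_zero
    ((Lp.memLp f).integrable (by norm_num)) fun m c => ?_)
  rw [← inner_ind μ m c f]
  exact (Submodule.mem_orthogonal _ _).1 hf _
    (Submodule.mem_iSup_of_mem m (ind_mem_cellSpace μ m c))

/-- The normalized indicator of a dyadic square. -/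
def nind (m : ℕ) (c : ℤ × ℤ) : Lp ℂ 2 μ := unitInd (measurableSet_cell m c) (measure_ne_top μ _)

theorem nind_eq_smul_ind (m : ℕ) (c : ℤ × ℤ) :
    nind μ m c = (((√(μ.real (cell m c)))⁻¹ : ℝ) : ℂ) • ind μ m c :=
  rfl

theorem nind_eq_zero {m : ℕ} {c : ℤ × ℤ} (h : μ (cell m c) = 0) : nind μ m c = 0 := by
  simp [nind_eq_smul_ind, Measure.real, h]

theorem ind_eq_smul_nind (m : ℕ) (c : ℤ × ℤ) :
    ind μ m c = ((√(μ.real (cell m c)) : ℝ) : ℂ) • nind μ m c := by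
  by_cases hc : μ (cell m c) = 0
  · rw [nind_eq_zero μ hc, smul_zero, ← inner_self_eq_zero (𝕜 := ℂ), inner_ind_ind,
      Set.inter_self, Measure.real, hc]
    simp
  · have hpos : 0 < √(μ.real (cell m c)) := Real.sqrt_pos.2 (ENNReal.toReal_pos hc (by finiteness))
    rw [nind_eq_smul_ind, smul_smul, ← Complex.ofReal_mul, mul_inv_cancel₀ hpos.ne',
      Complex.ofReal_one, one_smul]

theorem orthonormal_nind (m : ℕ) :
    Orthonormal ℂ (fun c : {c : ℤ × ℤ // μ (cell m c) ≠ 0} => nind μ m c) :=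
  orthonormal_unitInd _ _ (fun c => c.2)
    fun _ _ h => disjoint_cell m fun h' => h (Subtype.ext h')

theorem tsum_inner_nind_sq (m : ℕ) (g : Lp ℂ 2 μ) (hg : g ∈ cellSpace μ m) :
    ∑' c, ‖inner ℂ (nind μ m c) g‖ₑ ^ 2 = ‖g‖ₑ ^ 2 := by
  rw [← tsum_inner_sq_of_mem_closure_span (orthonormal_nind μ m) (g := g)]
  · refine (tsum_subtype_eq_of_support_subset (s := {c | μ (cell m c) ≠ 0})
      (f := fun c => ‖inner ℂ (nind μ m c) g‖ₑ ^ 2) fun c hc hc' => hc ?_).symm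
    simp [nind_eq_zero μ hc']
  · refine Submodule.topologicalClosure_mono ?_ hg
    rw [Submodule.span_le]
    rintro _ ⟨c, rfl⟩
    rw [SetLike.mem_coe, ind_eq_smul_nind]
    refine Submodule.smul_mem _ _ ?_
    by_cases hc : μ (cell m c) = 0
    · simp [nind_eq_zero μ hc]
    · exact Submodule.subset_span ⟨⟨c, hc⟩, rfl⟩

theorem starProjection_ind {m M : ℕ} (h : m ≤ M) (z : ℂ) :
    (cellSpace μ m).starProjection (ind μ M (cellIdx M z)) =
      ((μ.real (cell M (cellIdx M z)) / μ.real (cell m (cellIdx m z)) : ℝ) : ℂ) •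
        ind μ m (cellIdx m z) := by
  have hsub := cell_subset_of_le h z
  refine Submodule.eq_starProjection_of_mem_orthogonal
    (Submodule.smul_mem _ _ (ind_mem_cellSpace μ m _)) ?_
  rw [cellSpace, Submodule.orthogonal_closure, Submodule.mem_orthogonal]
  intro g hg
  induction hg using Submodule.span_induction with
  | zero => exact inner_zero_left _
  | add x y _ _ hx hy => rw [inner_add_left, hx, hy, add_zero]
  | smul a x _ hx => rw [inner_smul_left, hx, mul_zero]
  | mem x hx =>
    obtain ⟨c, rfl⟩ := hx
    rw [inner_sub_right, inner_smul_right, inner_ind_ind, inner_ind_ind, ← Complex.ofReal_mul,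
      ← Complex.ofReal_sub, Complex.ofReal_eq_zero, sub_eq_zero]
    by_cases hc : c = cellIdx m z
    · subst hc
      rw [Set.inter_self, Set.inter_eq_right.2 hsub, div_mul_cancel_of_imp]
      exact fun h0 => measureReal_mono_null hsub h0
    · have hd := disjoint_cell m hc
      rw [hd.inter_eq, (hd.mono_right hsub).inter_eq]
      simp

end CellSpace

/-! ## Parseval frames of well-concentrated functions -/

section ConcentratedFrames

theorem mul_sum_two_pow_le {D : ℝ} {S : Finset ℕ}
    (hS : ∀ m ∈ S, D ≤ √2 * (1 / 2) ^ m) : D * ∑ m ∈ S, (2 : ℝ) ^ m ≤ 2 * √2 := by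
  rcases S.eq_empty_or_nonempty with rfl | hne
  · simp
  have hgeom : ∑ m ∈ S, (2 : ℝ) ^ m ≤ 2 ^ (S.max' hne + 1) := by
    exact_mod_cast (Nat.geomSum_lt le_rfl fun k hk => Nat.lt_succ_of_le (S.le_max' k hk)).le
  calc D * ∑ m ∈ S, (2 : ℝ) ^ m
      ≤ √2 * (1 / 2) ^ S.max' hne * 2 ^ (S.max' hne + 1) :=
        mul_le_mul (hS _ (S.max'_mem hne)) hgeom (by positivity) (by positivity)
    _ = 2 * √2 := by
        rw [pow_succ, one_div, inv_pow]
        field_simp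

-- Cauchy–Schwarz with the weights `2⁻ᵐ`, whose inverses form a geometric sum.
theorem sq_mul_sum_sq_le {D : ℝ} (hD : 0 ≤ D) {S : Finset ℕ}
    (hS : ∀ m ∈ S, D ≤ √2 * (1 / 2) ^ m) (α : ℕ → ℝ) :
    D ^ 2 * (∑ m ∈ S, α m) ^ 2 ≤ 4 * ∑ m ∈ S, α m ^ 2 * (1 / 4) ^ m := by
  have hCS : (∑ m ∈ S, α m) ^ 2 ≤ (∑ m ∈ S, α m ^ 2 * (1 / 2) ^ m) * ∑ m ∈ S, 2 ^ m := by
    refine Finset.sum_sq_le_sum_mul_sum_of_sq_le_mul _ (fun m _ => by positivity)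
      (fun m _ => by positivity) fun m _ => ?_
    rw [mul_assoc, ← mul_pow]
    norm_num
  have hweight : D * ∑ m ∈ S, α m ^ 2 * (1 / 2) ^ m ≤ √2 * ∑ m ∈ S, α m ^ 2 * (1 / 4) ^ m := by
    rw [Finset.mul_sum, Finset.mul_sum]
    refine Finset.sum_le_sum fun m hm => ?_
    calc D * (α m ^ 2 * (1 / 2) ^ m) ≤ √2 * (1 / 2) ^ m * (α m ^ 2 * (1 / 2) ^ m) := by
          gcongr
          exact hS m hm
      _ = √2 * (α m ^ 2 * ((1 / 2) * (1 / 2)) ^ m) := by rw [mul_pow]; ring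
      _ = √2 * (α m ^ 2 * (1 / 4) ^ m) := by norm_num
  calc D ^ 2 * (∑ m ∈ S, α m) ^ 2
      ≤ D ^ 2 * ((∑ m ∈ S, α m ^ 2 * (1 / 2) ^ m) * ∑ m ∈ S, 2 ^ m) := by gcongr
    _ = (D * ∑ m ∈ S, α m ^ 2 * (1 / 2) ^ m) * (D * ∑ m ∈ S, 2 ^ m) := by ring
    _ ≤ (√2 * ∑ m ∈ S, α m ^ 2 * (1 / 4) ^ m) * (2 * √2) :=
        mul_le_mul hweight (mul_sum_two_pow_le hS) (by positivity) (by positivity)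
    _ = 4 * ∑ m ∈ S, α m ^ 2 * (1 / 4) ^ m := by
        linear_combination (2 * (∑ m ∈ S, α m ^ 2 * (1 / 4) ^ m)) *
          Real.mul_self_sqrt (show (0 : ℝ) ≤ 2 by norm_num)

/-- The second moment of `|v|²` about the point `x`. -/
def spread {μ : Measure ℂ} (x : ℂ) (v : Lp ℂ 2 μ) : ℝ≥0∞ :=
  ∫⁻ z, ‖z - x‖ₑ ^ 2 * ‖v z‖ₑ ^ 2 ∂μ

theorem spread_zero {μ : Measure ℂ} (x : ℂ) : spread x (0 : Lp ℂ 2 μ) = 0 := by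
  rw [spread, ← lintegral_zero (μ := μ)]
  refine lintegral_congr_ae ?_
  filter_upwards [Lp.coeFn_zero ℂ 2 μ] with z hz
  rw [hz]
  simp

theorem enorm_sub_sq_mul_enorm_sum_indicator_sq_le (x z : ℂ) (S : Finset ℕ) (α : ℕ → ℂ) :
    ‖z - x‖ₑ ^ 2 * ‖∑ m ∈ S, (cell m (cellIdx m x)).indicator (fun _ => α m) z‖ₑ ^ 2 ≤
      ∑ m ∈ S, 4 * (‖α m‖ₑ ^ 2 * 4⁻¹ ^ m) * (cell m (cellIdx m x)).indicator 1 z := by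
  classical
  have hle := sq_mul_sum_sq_le (norm_nonneg (z - x))
    (S := S.filter fun m => z ∈ cell m (cellIdx m x))
    (fun m hm => norm_sub_le_of_cellIdx_eq (Finset.mem_filter.1 hm).2) fun m => ‖α m‖
  have hterm : ∀ m, ENNReal.ofReal (‖α m‖ ^ 2 * (1 / 4) ^ m) = ‖α m‖ₑ ^ 2 * 4⁻¹ ^ m := fun m => by
    rw [ENNReal.ofReal_mul (by positivity), ← enorm_sq_eq_ofReal,
      ENNReal.ofReal_pow (by positivity), one_div, ENNReal.ofReal_inv_of_pos (by norm_num),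
      ENNReal.ofReal_ofNat]
  calc _ = ENNReal.ofReal (‖z - x‖ ^ 2 *
        ‖∑ m ∈ S with z ∈ cell m (cellIdx m x), α m‖ ^ 2) := by
        rw [Finset.sum_indicator_eq_sum_filter, ENNReal.ofReal_mul (by positivity),
          enorm_sq_eq_ofReal, enorm_sq_eq_ofReal]
    _ ≤ ENNReal.ofReal (4 * ∑ m ∈ S with z ∈ cell m (cellIdx m x), ‖α m‖ ^ 2 * (1 / 4) ^ m) := by
        refine ENNReal.ofReal_le_ofReal (le_trans ?_ hle)
        gcongr
        exact norm_sum_le _ _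
    _ = _ := by
        rw [ENNReal.ofReal_mul (by norm_num), ENNReal.ofReal_ofNat,
          ENNReal.ofReal_sum_of_nonneg fun _ _ => by positivity, Finset.mul_sum, Finset.sum_filter]
        refine Finset.sum_congr rfl fun m _ => ?_
        by_cases hm : z ∈ cell m (cellIdx m x) <;> simp only [hm, hterm, if_true, if_false,
          Set.indicator_of_mem, Set.indicator_of_notMem, not_false_eq_true, Pi.one_apply, mul_one,
          mul_zero]

variable (μ : Measure ℂ) [IsFiniteMeasure μ]

theorem coeFn_sum_smul_ind (α : ℕ → ℂ) (c : ℕ → ℤ × ℤ) (S : Finset ℕ) :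
    ⇑(∑ m ∈ S, α m • ind μ m (c m)) =ᵐ[μ]
      fun z => ∑ m ∈ S, (cell m (c m)).indicator (fun _ => α m) z := by
  have hall : ∀ᵐ z ∂μ, ∀ m ∈ S,
      (α m • ind μ m (c m)) z = (cell m (c m)).indicator (fun _ => α m) z := by
    refine (ae_ball_iff S.countable_toSet).2 fun m _ => ?_
    filter_upwards [Lp.coeFn_smul (α m) (ind μ m (c m)),
      indicatorConstLp_coeFn (p := 2) (hs := measurableSet_cell m (c m))
        (hμs := measure_ne_top μ _) (c := (1 : ℂ))] with z hsmul hind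
    rw [hsmul, Pi.smul_apply, ind, hind]
    by_cases hz : z ∈ cell m (c m) <;> simp [hz]
  filter_upwards [hall, Lp.coeFn_finsetSum S fun m => α m • ind μ m (c m)] with z hz hsum
  rw [hsum, Finset.sum_apply]
  exact Finset.sum_congr rfl hz

theorem spread_sum_smul_ind_le (α : ℕ → ℂ) (x : ℂ) (S : Finset ℕ) :
    spread x (∑ m ∈ S, α m • ind μ m (cellIdx m x)) ≤
      ∑ m ∈ S, 4 * (‖α m‖ₑ ^ 2 * 4⁻¹ ^ m) * μ (cell m (cellIdx m x)) := by
  have hmeas : ∀ m, Measurable ((cell m (cellIdx m x)).indicator (1 : ℂ → ℝ≥0∞)) := fun m =>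
    measurable_one.indicator (measurableSet_cell _ _)
  calc spread x (∑ m ∈ S, α m • ind μ m (cellIdx m x))
      ≤ ∫⁻ z, ∑ m ∈ S, 4 * (‖α m‖ₑ ^ 2 * 4⁻¹ ^ m) *
          (cell m (cellIdx m x)).indicator 1 z ∂μ := by
        refine lintegral_mono_ae ?_
        filter_upwards [coeFn_sum_smul_ind μ α (fun m => cellIdx m x) S] with z hz
        rw [hz]
        exact enorm_sub_sq_mul_enorm_sum_indicator_sq_le x z S α
    _ = _ := by
        rw [lintegral_finsetSum _ fun m _ => (hmeas m).const_mul _]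
        refine Finset.sum_congr rfl fun m _ => ?_
        rw [lintegral_const_mul _ (hmeas m), lintegral_indicator_one (measurableSet_cell _ _)]

theorem spread_filtrationFrame_le (b : ℕ → ℕ → ℝ) (M : ℕ → ℕ) (k : ℕ) (x : ℂ) :
    spread x (filtrationFrame (cellSpace μ) (nind μ) b M (k, cellIdx (M k) x)) ≤
      ∑ m ∈ Finset.range (M k + 1), 4 * (‖b k m - b k (m + 1)‖ₑ ^ 2 * 4⁻¹ ^ m) *
        (μ (cell (M k) (cellIdx (M k) x)) / μ (cell m (cellIdx m x))) := by
  by_cases h0 : μ (cell (M k) (cellIdx (M k) x)) = 0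
  · simp [filtrationFrame, nind_eq_zero μ h0, spread_zero]
  set A : ℕ → ℝ := fun m => μ.real (cell m (cellIdx m x))
  have hpos : ∀ m ≤ M k, 0 < A m := fun m hm =>
    ENNReal.toReal_pos (fun hm0 => h0 (measure_mono_null (cell_subset_of_le hm x) hm0))
      (by finiteness)
  set α : ℕ → ℂ := fun m =>
    ((b k m - b k (m + 1)) * ((√(A (M k)))⁻¹ * (A (M k) / A m)) : ℝ) with hα
  have hframe : filtrationFrame (cellSpace μ) (nind μ) b M (k, cellIdx (M k) x) =
      ∑ m ∈ Finset.range (M k + 1), α m • ind μ m (cellIdx m x) := by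
    refine Finset.sum_congr rfl fun m hm => ?_
    rw [nind_eq_smul_ind, map_smul, starProjection_ind μ (Finset.mem_range_succ_iff.1 hm),
      smul_smul, smul_smul, ← Complex.ofReal_mul, ← Complex.ofReal_mul, mul_assoc]
  rw [hframe]
  refine (spread_sum_smul_ind_le μ α x _).trans_eq (Finset.sum_congr rfl fun m hm => ?_)
  have hm0 := hpos m (Finset.mem_range_succ_iff.1 hm)
  have hM0 := hpos (M k) le_rfl
  have hratio : ‖α m‖ₑ ^ 2 * μ (cell m (cellIdx m x)) = ‖b k m - b k (m + 1)‖ₑ ^ 2 *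
      (μ (cell (M k) (cellIdx (M k) x)) / μ (cell m (cellIdx m x))) := by
    rw [enorm_sq_eq_ofReal, enorm_sq_eq_ofReal, ← ofReal_measureReal, ← ofReal_measureReal,
      ← ENNReal.ofReal_div_of_pos hm0, ← ENNReal.ofReal_mul (by positivity),
      ← ENNReal.ofReal_mul (by positivity), hα, Complex.norm_real, norm_mul, mul_pow, mul_assoc,
      Real.norm_of_nonneg (by positivity : 0 ≤ (√(A (M k)))⁻¹ * (A (M k) / A m)), mul_pow, inv_pow,
      Real.sq_sqrt hM0.le]
    congr 2
    change (A (M k))⁻¹ * (A (M k) / A m) ^ 2 * A m = A (M k) / A m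
    field_simp
  rw [mul_assoc, mul_right_comm (‖α m‖ₑ ^ 2), hratio]
  ring

theorem card_subcells (q : ℤ × ℤ) (m : ℕ) :
    (Finset.Ico (2 ^ m * q.1) (2 ^ m * q.1 + 2 ^ m) ×ˢ
      Finset.Ico (2 ^ m * q.2) (2 ^ m * q.2 + 2 ^ m)).card = 4 ^ m := by
  have htoNat : ((2 : ℤ) ^ m).toNat = 2 ^ m := by
    rw [← Nat.cast_ofNat (R := ℤ), ← Nat.cast_pow, Int.toNat_natCast]
  rw [Finset.card_product, Int.card_Ico, Int.card_Ico, add_sub_cancel_left, add_sub_cancel_left,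
    htoNat, ← mul_pow, show 2 * 2 = 4 from rfl]

theorem tsum_measure_inter_cell_div_le (μ : Measure ℂ) (m M : ℕ) (c' : ℤ × ℤ) :
    ∑' c, μ (cell M c ∩ cell m c') / μ (cell m c') ≤ 1 := by
  simp only [div_eq_mul_inv]
  rw [ENNReal.tsum_mul_right, ← div_eq_mul_inv]
  refine ENNReal.div_le_of_le_mul ?_
  rw [one_mul, ← measure_iUnion
    (fun c d hcd => (disjoint_cell M hcd).mono Set.inter_subset_left Set.inter_subset_left)
    fun c => (measurableSet_cell _ _).inter (measurableSet_cell _ _)]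
  exact measure_mono (Set.iUnion_subset fun c => Set.inter_subset_right)

theorem tsum_measure_ratio_le (μ : Measure ℂ) {q : ℤ × ℤ} (hq : μ (cell 0 q)ᶜ = 0) {m M : ℕ}
    (h : m ≤ M) (x : ℤ × ℤ → ℂ) (hx : ∀ c, μ (cell M c) ≠ 0 → x c ∈ cell M c) :
    ∑' c, μ (cell M c) / μ (cell m (cellIdx m (x c))) ≤ 4 ^ m := by
  set F := Finset.Ico (2 ^ m * q.1) (2 ^ m * q.1 + 2 ^ m) ×ˢ
      Finset.Ico (2 ^ m * q.2) (2 ^ m * q.2 + 2 ^ m) with hF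
  have hle : ∀ c, μ (cell M c) / μ (cell m (cellIdx m (x c))) ≤
      ∑ c' ∈ F, μ (cell M c ∩ cell m c') / μ (cell m c') := fun c => by
    by_cases h0 : μ (cell M c) = 0
    · simp [h0]
    have hsub : cell M c ⊆ cell m (cellIdx m (x c)) := by
      simpa only [mem_cell.1 (hx c h0)] using cell_subset_of_le h (x c)
    have hmem : cellIdx m (x c) ∈ F := by
      obtain ⟨z, hzc, hzq⟩ : (cell M c ∩ cell 0 q).Nonempty := by
        by_contra hne
        rw [Set.not_nonempty_iff_eq_empty, ← Set.disjoint_iff_inter_eq_empty] at hne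
        exact h0 (measure_mono_null hne.subset_compl_right hq)
      simpa only [mem_cell.1 (hsub hzc)] using cellIdx_mem_of_cellIdx_zero m (mem_cell.1 hzq)
    calc μ (cell M c) / μ (cell m (cellIdx m (x c)))
        = μ (cell M c ∩ cell m (cellIdx m (x c))) / μ (cell m (cellIdx m (x c))) := by
          rw [Set.inter_eq_left.2 hsub]
      _ ≤ ∑ c' ∈ F, μ (cell M c ∩ cell m c') / μ (cell m c') :=
          Finset.single_le_sum (f := fun c' => μ (cell M c ∩ cell m c') / μ (cell m c'))
            (fun _ _ => zero_le) hmem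
  calc ∑' c, μ (cell M c) / μ (cell m (cellIdx m (x c)))
      ≤ ∑' c, ∑ c' ∈ F, μ (cell M c ∩ cell m c') / μ (cell m c') := ENNReal.tsum_le_tsum hle
    _ = ∑ c' ∈ F, ∑' c, μ (cell M c ∩ cell m c') / μ (cell m c') :=
        Summable.tsum_finsetSum fun _ _ => ENNReal.summable
    _ ≤ ∑ c' ∈ F, 1 := Finset.sum_le_sum fun c' _ => tsum_measure_inter_cell_div_le μ m M c'
    _ = 4 ^ m := by
        rw [Finset.sum_const, nsmul_eq_mul, mul_one, hF, card_subcells, Nat.cast_pow,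
          Nat.cast_ofNat]

theorem tsum_spread_filtrationFrame_le {q : ℤ × ℤ} (hq : μ (cell 0 q)ᶜ = 0) (b : ℕ → ℕ → ℝ)
    (M : ℕ → ℕ) (k : ℕ) (x : ℤ × ℤ → ℂ)
    (hx : ∀ c, μ (cell (M k) c) ≠ 0 → x c ∈ cell (M k) c) :
    ∑' c, spread (x c) (filtrationFrame (cellSpace μ) (nind μ) b M (k, c)) ≤
      4 * ∑' m, ‖b k m - b k (m + 1)‖ₑ ^ 2 := by
  have hspread : ∀ c, spread (x c) (filtrationFrame (cellSpace μ) (nind μ) b M (k, c)) ≤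
      ∑ m ∈ Finset.range (M k + 1), 4 * (‖b k m - b k (m + 1)‖ₑ ^ 2 * 4⁻¹ ^ m) *
        (μ (cell (M k) c) / μ (cell m (cellIdx m (x c)))) := fun c => by
    by_cases h0 : μ (cell (M k) c) = 0
    · simp [filtrationFrame, nind_eq_zero μ h0, spread_zero]
    · simpa only [mem_cell.1 (hx c h0)] using spread_filtrationFrame_le μ b M k (x c)
  calc _ ≤ ∑' c, ∑ m ∈ Finset.range (M k + 1), 4 * (‖b k m - b k (m + 1)‖ₑ ^ 2 * 4⁻¹ ^ m) *
        (μ (cell (M k) c) / μ (cell m (cellIdx m (x c)))) := ENNReal.tsum_le_tsum hspread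
    _ = ∑ m ∈ Finset.range (M k + 1), 4 * (‖b k m - b k (m + 1)‖ₑ ^ 2 * 4⁻¹ ^ m) *
        ∑' c, μ (cell (M k) c) / μ (cell m (cellIdx m (x c))) := by
        rw [Summable.tsum_finsetSum fun _ _ => ENNReal.summable]
        exact Finset.sum_congr rfl fun m _ => ENNReal.tsum_mul_left
    _ ≤ ∑ m ∈ Finset.range (M k + 1), 4 * (‖b k m - b k (m + 1)‖ₑ ^ 2 * 4⁻¹ ^ m) * 4 ^ m := by
        gcongr with m hm
        exact tsum_measure_ratio_le μ hq (Finset.mem_range_succ_iff.1 hm) x hx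
    _ = 4 * ∑ m ∈ Finset.range (M k + 1), ‖b k m - b k (m + 1)‖ₑ ^ 2 := by
        rw [Finset.mul_sum]
        refine Finset.sum_congr rfl fun m _ => ?_
        rw [mul_assoc, mul_assoc, ← mul_pow,
          ENNReal.inv_mul_cancel (by norm_num) (by norm_num), one_pow, mul_one]
    _ ≤ 4 * ∑' m, ‖b k m - b k (m + 1)‖ₑ ^ 2 := by
        gcongr
        exact ENNReal.sum_le_tsum _

theorem exists_concentrated_frame {q : ℤ × ℤ} (hq : μ (cell 0 q)ᶜ = 0) {ε : ℝ≥0∞} (hε : 0 < ε) :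
    ∃ (v : ℕ × ℤ × ℤ → Lp ℂ 2 μ) (x : ℕ × ℤ × ℤ → ℂ),
      IsParseval v ∧ ∑' p, spread (x p) (v p) ≤ ε ∧ ∀ p, v p ≠ 0 → x p ∈ μ.support := by
  obtain ⟨b, M, hb, hslow⟩ := exists_slow_squarePartition
    (ENNReal.div_pos hε.ne' (by norm_num : (4 : ℝ≥0∞) ≠ ∞))
  have hpt : ∀ p : ℕ × ℤ × ℤ, ∃ x : ℂ, μ (cell (M p.1) p.2) ≠ 0 →
      x ∈ cell (M p.1) p.2 ∧ x ∈ μ.support := fun p => by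
    by_cases h0 : μ (cell (M p.1) p.2) = 0
    · exact ⟨0, fun h => absurd h0 h⟩
    · obtain ⟨x, hx⟩ := Measure.nonempty_inter_support_of_pos (pos_iff_ne_zero.2 h0)
      exact ⟨x, fun _ => hx⟩
  choose x hx using hpt
  refine ⟨filtrationFrame (cellSpace μ) (nind μ) b M, x,
    isParseval_filtrationFrame (monotone_cellSpace μ) (iSup_cellSpace_dense μ)
      (tsum_inner_nind_sq μ) hb, ?_, fun p hp => (hx p fun h0 => hp ?_).2⟩
  · rw [ENNReal.tsum_prod']
    calc ∑' k, ∑' c, spread (x (k, c)) (filtrationFrame (cellSpace μ) (nind μ) b M (k, c))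
        ≤ ∑' k, 4 * ∑' m, ‖b k m - b k (m + 1)‖ₑ ^ 2 :=
          ENNReal.tsum_le_tsum fun k => tsum_spread_filtrationFrame_le μ hq b M k _
            fun c hc => (hx (k, c) hc).1
      _ ≤ 4 * (ε / 4) := by
          rw [ENNReal.tsum_mul_left]
          gcongr
      _ = ε := ENNReal.mul_div_cancel (by norm_num) (by norm_num)
  · simp [filtrationFrame, nind_eq_zero μ h0]

end ConcentratedFrames

/-! ## Values of Lipschitz functions and small disjoint sets -/

section SmallSets

variable {X : Type*} [MeasurableSpace X] {μ : Measure X}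

theorem exists_seq_tendsto_of_mem_support [PseudoMetricSpace X] {x : X} (hx : x ∈ μ.support)
    {p : X → Prop} (hp : ∀ᵐ s ∂μ, p s) :
    ∃ s : ℕ → X, Filter.Tendsto s Filter.atTop (nhds x) ∧ ∀ n, p (s n) := by
  have hmem : x ∈ closure {s | p s} := Metric.mem_closure_iff.2 fun ε hε => by
    by_contra! hfar
    have hball : μ (Metric.ball x ε) ≠ 0 :=
      ((Measure.mem_support_iff_forall x).1 hx _ (Metric.ball_mem_nhds _ hε)).ne'
    refine hball (measure_mono_null (t := {s | ¬p s}) (fun s hs hps => ?_) (ae_iff.1 hp))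
    exact (hfar s hps).not_gt (by rwa [dist_comm])
  obtain ⟨s, hps, hs⟩ := mem_closure_iff_seq_limit.1 hmem
  exact ⟨s, hs, hps⟩

theorem exists_ae_dist_le_of_mem_support [PseudoMetricSpace X] [SFinite μ] {Y : Type*}
    [PseudoMetricSpace Y] [ProperSpace Y] {f : X → Y}
    (hf : ∀ᵐ p ∂μ.prod μ, dist (f p.1) (f p.2) ≤ dist p.1 p.2) {x : X} (hx : x ∈ μ.support) :
    ∃ c, ∀ᵐ t ∂μ, dist (f t) c ≤ dist t x := by
  obtain ⟨s, hs, hfs⟩ := exists_seq_tendsto_of_mem_support hx (Measure.ae_ae_of_ae_prod hf)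
  have hall : ∀ᵐ t ∂μ, ∀ n, dist (f (s n)) (f t) ≤ dist (s n) t := ae_all_iff.2 hfs
  have hμ : (ae μ).NeBot := ae_neBot.2 fun h => by simp [h] at hx
  obtain ⟨t₀, ht₀⟩ := hall.exists
  obtain ⟨r, hr⟩ := (Metric.isBounded_range_of_tendsto s hs).subset_closedBall t₀
  have hbdd : ∀ n, f (s n) ∈ Metric.closedBall (f t₀) r := fun n =>
    (ht₀ n).trans (hr ⟨n, rfl⟩)
  obtain ⟨c, -, φ, hφ, hc⟩ := tendsto_subseq_of_bounded Metric.isBounded_closedBall hbdd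
  refine ⟨c, ?_⟩
  filter_upwards [hall] with t ht
  rw [dist_comm, dist_comm t]
  exact le_of_tendsto_of_tendsto' (hc.dist tendsto_const_nhds)
    ((hs.comp hφ.tendsto_atTop).dist tendsto_const_nhds) fun n => ht (φ n)

theorem exists_subset_measure_le [TopologicalSpace X] [HereditarilyLindelofSpace X]
    [OpensMeasurableSpace X] [μ.OuterRegular] [NullSingletonClass μ]
    {A : Set X} (hA : MeasurableSet A) (h0 : μ A ≠ 0) {ε : ℝ≥0∞} (hε : ε ≠ 0) :
    ∃ B ⊆ A, MeasurableSet B ∧ μ B ≠ 0 ∧ μ B ≤ ε := by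
  obtain ⟨x, -, hx⟩ := Measure.nonempty_inter_support_of_pos (μ := μ.restrict A) (s := A)
    (by rw [Measure.restrict_apply_self]; exact pos_iff_ne_zero.2 h0)
  have hlt : μ {x} < ε := by rw [measure_singleton]; exact pos_iff_ne_zero.2 hε
  obtain ⟨U, hxU, hU, hUε⟩ := Set.exists_isOpen_lt_of_lt {x} ε hlt
  refine ⟨U ∩ A, Set.inter_subset_right, hU.measurableSet.inter hA, ?_,
    (measure_mono Set.inter_subset_left).trans hUε.le⟩
  rw [← Measure.restrict_apply hU.measurableSet]
  exact ((Measure.mem_support_iff_forall x).1 hx U (hU.mem_nhds (by simpa using hxU))).ne'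

theorem measure_iUnion_lt_of_geometric {C : ℕ → Set X} (h0 : μ (C 0) ≠ 0) (htop : μ (C 0) ≠ ∞)
    (hC : ∀ n, μ (C (n + 1)) ≤ μ (C n) * 3⁻¹) : μ (⋃ i, C (i + 1)) < μ (C 0) := by
  have hpow : ∀ i, μ (C i) ≤ μ (C 0) * 3⁻¹ ^ i := fun i => by
    induction i with
    | zero => simp
    | succ i ih =>
      refine (hC i).trans ?_
      rw [pow_succ, ← mul_assoc]
      gcongr
  have hsum : (3⁻¹ * (1 - 3⁻¹)⁻¹ : ℝ≥0∞) < 1 := by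
    rw [← div_eq_mul_inv]
    refine ENNReal.div_lt_of_lt_mul ?_
    rw [one_mul, lt_tsub_iff_right, ← ENNReal.toReal_lt_toReal (by finiteness) (by finiteness),
      ENNReal.toReal_add (by finiteness) (by finiteness)]
    norm_num
  calc μ (⋃ i, C (i + 1)) ≤ ∑' i, μ (C (i + 1)) := measure_iUnion_le _
    _ ≤ ∑' i, μ (C 0) * 3⁻¹ ^ (i + 1) := ENNReal.tsum_le_tsum fun i => hpow (i + 1)
    _ = μ (C 0) * (3⁻¹ * (1 - 3⁻¹)⁻¹) := by
        rw [ENNReal.tsum_mul_left, ENNReal.tsum_geometric_add_one]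
    _ < μ (C 0) * 1 := ENNReal.mul_lt_mul_right h0 htop hsum
    _ = μ (C 0) := mul_one _

variable [TopologicalSpace X] [HereditarilyLindelofSpace X] [OpensMeasurableSpace X]
  [μ.OuterRegular] [NullSingletonClass μ]

theorem exists_subsets_geometric {A : ℕ → Set X} (hA : ∀ n, MeasurableSet (A n))
    (h0 : ∀ n, μ (A n) ≠ 0) :
    ∃ C : ℕ → Set X, (∀ n, C n ⊆ A n) ∧ (∀ n, MeasurableSet (C n)) ∧ (∀ n, μ (C n) ≠ 0) ∧
      (∀ n, μ (C n) ≠ ∞) ∧ ∀ n, μ (C (n + 1)) ≤ μ (C n) * 3⁻¹ := by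
  have hstep : ∀ (n : ℕ) (t : {t : ℝ≥0∞ // t ≠ 0}), ∃ B ⊆ A n, MeasurableSet B ∧ μ B ≠ 0 ∧
      μ B ≤ min (t : ℝ≥0∞) 1 := fun n t =>
    exists_subset_measure_le (hA n) (h0 n)
      (lt_min (pos_iff_ne_zero.2 t.2) one_pos).ne'
  choose B hBA hBm hB0 hBt using hstep
  have hthird : ∀ n s, μ (B n s) * 3⁻¹ ≠ 0 := fun n s => mul_ne_zero (hB0 n s) (by simp)
  let t : ℕ → {t : ℝ≥0∞ // t ≠ 0} := fun n =>
    Nat.rec ⟨1, one_ne_zero⟩ (fun n s => ⟨μ (B n s) * 3⁻¹, hthird n s⟩) n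
  exact ⟨fun n => B n (t n), fun n => hBA n _, fun n => hBm n _, fun n => hB0 n _,
    fun n => ne_top_of_le_ne_top ENNReal.one_ne_top ((hBt n _).trans (min_le_right _ _)),
    fun n => (hBt (n + 1) (t (n + 1))).trans (min_le_left _ _)⟩

theorem exists_disjoint_subsets_nat {A : ℕ → Set X} (hA : ∀ n, MeasurableSet (A n))
    (h0 : ∀ n, μ (A n) ≠ 0) :
    ∃ N : ℕ → Set X, (∀ n, N n ⊆ A n) ∧ (∀ n, MeasurableSet (N n)) ∧ (∀ n, μ (N n) ≠ 0) ∧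
      (∀ n, μ (N n) ≠ ∞) ∧ Pairwise (Function.onFun Disjoint N) := by
  obtain ⟨C, hCA, hCm, hC0, hCtop, hC⟩ := exists_subsets_geometric hA h0
  have hlt : ∀ n, μ (⋃ i, C (n + (i + 1))) < μ (C n) := fun n =>
    measure_iUnion_lt_of_geometric (C := fun i => C (n + i)) (hC0 n) (hCtop n) fun i => hC (n + i)
  refine ⟨fun n => C n \ ⋃ i, C (n + (i + 1)), fun n => Set.sdiff_subset.trans (hCA n),
    fun n => (hCm n).diff (MeasurableSet.iUnion fun i => hCm _), fun n h => ?_,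
    fun n => ne_top_of_le_ne_top (hCtop n) (measure_mono Set.sdiff_subset), ?_⟩
  · have hle := measure_le_inter_add_sdiff μ (C n) (⋃ i, C (n + (i + 1)))
    rw [h, add_zero] at hle
    exact (hle.trans (measure_mono Set.inter_subset_right)).not_gt (hlt n)
  · refine (symm_disjoint.pairwise_on _).2 fun m n hmn => ?_
    obtain ⟨i, rfl⟩ := Nat.exists_eq_add_of_lt hmn
    refine Set.disjoint_sdiff_left.mono_right (Set.sdiff_subset.trans ?_)
    exact Set.subset_iUnion (fun i => C (m + (i + 1))) i

theorem exists_disjoint_subsets {κ : Type*} [Countable κ] {A : κ → Set X}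
    (hA : ∀ k, MeasurableSet (A k)) (h0 : ∀ k, μ (A k) ≠ 0) :
    ∃ N : κ → Set X, (∀ k, N k ⊆ A k) ∧ (∀ k, MeasurableSet (N k)) ∧ (∀ k, μ (N k) ≠ 0) ∧
      (∀ k, μ (N k) ≠ ∞) ∧ Pairwise (Function.onFun Disjoint N) := by
  rcases isEmpty_or_nonempty κ with hκ | hκ
  · exact ⟨A, isEmptyElim, isEmptyElim, isEmptyElim, isEmptyElim, isEmptyElim⟩
  · obtain ⟨j, hj⟩ := exists_injective_nat κ
    obtain ⟨N, hNA, hNm, hN0, hNtop, hd⟩ := exists_disjoint_subsets_nat (μ := μ)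
      (A := A ∘ Function.invFun j) (fun n => hA _) (fun n => h0 _)
    refine ⟨N ∘ j, fun k => ?_, fun k => hNm _, fun k => hN0 _, fun k => hNtop _,
      fun k k' hk => hd (hj.ne hk)⟩
    simpa only [Function.comp_apply, Function.leftInverse_invFun hj k] using hNA (j k)

end SmallSets

/-! ## Vectors and operators supported in a subset -/

section Supported

variable {Ω B : Set ℂ}

theorem enorm_sq_Lp_two {μ : Measure ℂ} (g : Lp ℂ 2 μ) : ‖g‖ₑ ^ 2 = ∫⁻ z, ‖g z‖ₑ ^ 2 ∂μ := by
  rw [Lp.enorm_def, eLpNorm_eq_lintegral_rpow_enorm_toReal (by norm_num) (by norm_num)]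
  simp only [ENNReal.toReal_ofNat, ← ENNReal.rpow_two]
  rw [← ENNReal.rpow_mul]
  norm_num

theorem spread_extOp (h : B ⊆ Ω) (hm : MeasurableSet B) (x : ℂ) (w : L2 B) :
    spread x (extOp h hm w) = spread x w := by
  calc spread x (extOp h hm w)
      = ∫⁻ z, B.indicator (fun z => ‖z - x‖ₑ ^ 2 * ‖w z‖ₑ ^ 2) z ∂leb Ω := by
        refine lintegral_congr_ae ?_
        filter_upwards [coeFn_extOp h hm w] with z hz
        rw [hz]
        by_cases hB : z ∈ B <;> simp [hB]
    _ = spread x w := by rw [lintegral_indicator hm, leb_restrict h hm, spread]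

theorem inner_extOp (h : B ⊆ Ω) (hm : MeasurableSet B) (w : L2 B) (g : L2 Ω) :
    inner ℂ (extOp h hm w) g = inner ℂ w (resOp h g) := by
  rw [← extOp_adjoint h hm, ContinuousLinearMap.adjoint_inner_right]

theorem enorm_sq_resOp (h : B ⊆ Ω) (g : L2 Ω) : ‖resOp h g‖ₑ ^ 2 = ∫⁻ z, ‖g z‖ₑ ^ 2 ∂leb B := by
  rw [enorm_sq_Lp_two]
  refine lintegral_congr_ae ?_
  filter_upwards [coeFn_resOp h g] with z hz
  rw [hz]

theorem tsum_enorm_sq_resOp_cell (hΩ : MeasurableSet Ω) (g : L2 Ω) :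
    ∑' q, ‖resOp (Set.inter_subset_left : Ω ∩ cell 0 q ⊆ Ω) g‖ₑ ^ 2 = ‖g‖ₑ ^ 2 := by
  simp only [enorm_sq_resOp]
  rw [enorm_sq_Lp_two, ← lintegral_iUnion (fun q => hΩ.inter (measurableSet_cell 0 q))
    (fun q q' hq => (disjoint_cell 0 hq).mono Set.inter_subset_right Set.inter_subset_right),
    ← Set.inter_iUnion, iUnion_cell, Set.inter_univ]

theorem coeFn_incl_mulOp (h : B ⊆ Ω) (hm : MeasurableSet B) (f : Lp ℂ ∞ (leb B)) (w : L2 Ω) :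
    incl h hm (mulOp f) w =ᵐ[leb Ω] B.indicator fun z => f z * w z := by
  filter_upwards [coeFn_extOp h hm (mulOp f (resOp h w)),
    ae_leb_imp h hm (coeFn_mulOp f (resOp h w)),
    ae_leb_imp h hm (coeFn_resOp h w)] with z hext hmul hres
  refine hext.trans ?_
  by_cases hz : z ∈ B
  · simp [hz, hmul hz, hres hz]
  · simp [hz]

theorem coeFn_incl_one (h : B ⊆ Ω) (hm : MeasurableSet B) (w : L2 Ω) :
    incl h hm 1 w =ᵐ[leb Ω] B.indicator w := by
  filter_upwards [coeFn_extOp h hm (resOp h w), ae_leb_imp h hm (coeFn_resOp h w)]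
    with z hext hres
  refine hext.trans ?_
  by_cases hz : z ∈ B
  · simp [hz, hres hz]
  · simp [hz]

theorem enorm_incl_mulOp_sub_sq_le_spread (h : B ⊆ Ω) (hm : MeasurableSet B) {f : Lp ℂ ∞ (leb B)}
    {w : L2 Ω} {c x : ℂ} (hf : ∀ᵐ t ∂leb B, dist (f t) c ≤ dist t x)
    (hw : ∀ᵐ t ∂leb Ω, w t ≠ 0 → t ∈ B) :
    ‖incl h hm (mulOp f) w - c • w‖ₑ ^ 2 ≤ spread x w := by
  rw [enorm_sq_Lp_two, spread]
  refine lintegral_mono_ae ?_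
  filter_upwards [Lp.coeFn_sub (incl h hm (mulOp f) w) (c • w), Lp.coeFn_smul c w,
    coeFn_incl_mulOp h hm f w, hw, ae_leb_imp h hm hf] with z hsub hsmul hincl hwz hfz
  rw [hsub, Pi.sub_apply, hsmul, hincl, Pi.smul_apply, smul_eq_mul]
  by_cases hz : w z = 0
  · by_cases hB : z ∈ B <;> simp [hz, hB]
  · have hB := hwz hz
    rw [Set.indicator_of_mem hB, ← sub_mul, enorm_mul, mul_pow, ← edist_eq_enorm_sub,
      ← edist_eq_enorm_sub]
    gcongr
    rw [edist_dist, edist_dist]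
    exact ENNReal.ofReal_le_ofReal (hfz hB)

theorem incl_mulOp_apply_of_disjoint (h : B ⊆ Ω) (hm : MeasurableSet B) (f : Lp ℂ ∞ (leb B))
    {w : L2 Ω} (hw : ∀ᵐ t ∂leb Ω, w t ≠ 0 → t ∉ B) : incl h hm (mulOp f) w = 0 := by
  refine Lp.eq_zero_iff_ae_eq_zero.2 ?_
  filter_upwards [coeFn_incl_mulOp h hm f w, hw] with z hincl hwz
  rw [hincl, Pi.zero_apply, Set.indicator_apply_eq_zero]
  intro hB
  rw [not_not.1 (mt hwz (not_not.2 hB)), mul_zero]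

theorem incl_one_apply_of_mem (h : B ⊆ Ω) (hm : MeasurableSet B) {w : L2 Ω}
    (hw : ∀ᵐ t ∂leb Ω, w t ≠ 0 → t ∈ B) : incl h hm 1 w = w := by
  refine Lp.ext ?_
  filter_upwards [coeFn_incl_one h hm w, hw] with z hincl hwz
  rw [hincl, Set.indicator_apply_eq_self]
  exact fun hB => not_not.1 (mt hwz hB)

theorem incl_one_apply_of_disjoint (h : B ⊆ Ω) (hm : MeasurableSet B) {w : L2 Ω}
    (hw : ∀ᵐ t ∂leb Ω, w t ≠ 0 → t ∉ B) : incl h hm 1 w = 0 := by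
  refine Lp.eq_zero_iff_ae_eq_zero.2 ?_
  filter_upwards [coeFn_incl_one h hm w, hw] with z hincl hwz
  rw [hincl, Pi.zero_apply, Set.indicator_apply_eq_zero]
  exact fun hB => not_not.1 (mt hwz (not_not.2 hB))

theorem ae_dist_le_of_eLpNorm_diffQuot_le {f : Lp ℂ ∞ (leb B)}
    (hf : eLpNorm (diffQuot f) ∞ ((leb B).prod (leb B)) ≤ 1) :
    ∀ᵐ p ∂(leb B).prod (leb B), dist (f p.1) (f p.2) ≤ dist p.1 p.2 := by
  rw [eLpNorm_exponent_top] at hf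
  filter_upwards [ae_le_eLpNormEssSup (f := diffQuot f) (μ := (leb B).prod (leb B))] with p hp
  have hquot : ‖diffQuot f p‖ ≤ 1 := by
    rw [← ENNReal.ofReal_le_one, ofReal_norm]
    exact hp.trans hf
  rw [diffQuot, norm_div, ← dist_eq_norm, ← dist_eq_norm] at hquot
  by_cases h0 : p.1 = p.2
  · simp [h0]
  · exact (div_le_one (dist_pos.2 h0)).1 hquot

theorem exists_ae_dist_le_of_eLpNorm_diffQuot_le {f : Lp ℂ ∞ (leb B)}
    (hf : eLpNorm (diffQuot f) ∞ ((leb B).prod (leb B)) ≤ 1) {x : ℂ} (hx : x ∈ (leb B).support) :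
    ∃ c, ∀ᵐ t ∂leb B, dist (f t) c ≤ dist t x :=
  exists_ae_dist_le_of_mem_support (ae_dist_le_of_eLpNorm_diffQuot_le hf) hx

theorem volume_cell_lt_top (q : ℤ × ℤ) : volume (cell 0 q) < ∞ := by
  refine Bornology.IsBounded.measure_lt_top (Metric.isBounded_iff.2 ⟨√2, fun z hz w hw => ?_⟩)
  simpa [dist_eq_norm] using
    norm_sub_le_of_cellIdx_eq (hz.trans hw.symm : cellIdx 0 z = cellIdx 0 w)

instance (q : ℤ × ℤ) : IsFiniteMeasure (leb (Ω ∩ cell 0 q)) :=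
  ⟨by
    rw [Measure.restrict_apply_univ]
    exact (measure_mono Set.inter_subset_right).trans_lt (volume_cell_lt_top q)⟩

theorem unitInd_ne_zero_imp_mem {N : Set ℂ} {μ : Measure ℂ} (hN : MeasurableSet N)
    (h : μ N ≠ ∞) : ∀ᵐ z ∂μ, unitInd hN h z ≠ 0 → z ∈ N := by
  filter_upwards [Lp.coeFn_smul (((√(μ.real N))⁻¹ : ℝ) : ℂ) (indicatorConstLp 2 hN h (1 : ℂ)),
    indicatorConstLp_coeFn (p := 2) (hs := hN) (hμs := h) (c := (1 : ℂ))] with z hsmul hind hz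
  by_contra hzN
  rw [unitInd, hsmul, Pi.smul_apply, hind, Set.indicator_of_notMem hzN, smul_zero] at hz
  exact hz rfl

theorem spread_le_of_norm_le {μ : Measure ℂ} {x : ℂ} {r : ℝ} {w : Lp ℂ 2 μ} (hw : ‖w‖ = 1)
    (h : ∀ᵐ t ∂μ, w t ≠ 0 → ‖t - x‖ ≤ r) : spread x w ≤ ENNReal.ofReal (r ^ 2) := by
  calc spread x w ≤ ∫⁻ z, ENNReal.ofReal (r ^ 2) * ‖w z‖ₑ ^ 2 ∂μ := by
        refine lintegral_mono_ae ?_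
        filter_upwards [h] with t ht
        by_cases h0 : w t = 0
        · simp [h0]
        · rw [enorm_sq_eq_ofReal (t - x)]
          have hr := ht h0
          gcongr
    _ = ENNReal.ofReal (r ^ 2) := by
        rw [lintegral_const_mul' _ _ ENNReal.ofReal_ne_top, ← enorm_sq_Lp_two, ← ofReal_norm, hw]
        simp

end Supported

/-! ## Concentrated frames of `L²(Ω)` -/

section ConcentratedFrames

variable {Ω : Set ℂ}

theorem exists_mem_support_cell (h0 : volume Ω ≠ 0) :
    ∃ q x, x ∈ (leb (Ω ∩ cell 0 q)).support := by
  by_contra! hempty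
  refine h0 ?_
  rw [← Set.inter_univ Ω, ← iUnion_cell 0, Set.inter_iUnion, measure_iUnion_null_iff]
  intro q
  have hq : ¬(leb (Ω ∩ cell 0 q)).support.Nonempty := fun ⟨x, hx⟩ => hempty q x hx
  rwa [Measure.nonempty_support_iff, not_not, Measure.restrict_eq_zero] at hq

theorem extOp_ne_zero_imp_mem {B : Set ℂ} (h : B ⊆ Ω) (hm : MeasurableSet B) (w : L2 B) :
    ∀ᵐ t ∂leb Ω, extOp h hm w t ≠ 0 → t ∈ B := by
  filter_upwards [coeFn_extOp h hm w] with t ht hne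
  rw [ht] at hne
  exact Set.mem_of_indicator_ne_zero hne

theorem isParseval_extOp_cell (hΩ : MeasurableSet Ω) {ι : Type*}
    {w : ∀ q, ι → L2 (Ω ∩ cell 0 q)} (hw : ∀ q, IsParseval (w q)) :
    IsParseval fun p : (ℤ × ℤ) × ι =>
      extOp Set.inter_subset_left (hΩ.inter (measurableSet_cell 0 p.1)) (w p.1 p.2) := fun h => by
  rw [ENNReal.tsum_prod', ← tsum_enorm_sq_resOp_cell hΩ h]
  refine tsum_congr fun q => ?_
  rw [← hw q]
  exact tsum_congr fun i => by rw [inner_extOp]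

theorem exists_concentrated_frame_cell (hΩ : MeasurableSet Ω) (h0 : volume Ω ≠ 0) {ε : ℝ≥0∞}
    (hε : ε ≠ 0) :
    ∃ (v : (ℤ × ℤ) × ℕ × ℤ × ℤ → L2 Ω) (x : (ℤ × ℤ) × ℕ × ℤ × ℤ → ℂ)
      (q : (ℤ × ℤ) × ℕ × ℤ × ℤ → ℤ × ℤ), IsParseval v ∧
      (∀ p, x p ∈ (leb (Ω ∩ cell 0 (q p))).support) ∧
      (∀ p, ∀ᵐ t ∂leb Ω, v p t ≠ 0 → t ∈ cell 0 (q p)) ∧ ∑' p, spread (x p) (v p) ≤ ε := by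
  obtain ⟨q₀, x₀, hx₀⟩ := exists_mem_support_cell h0
  obtain ⟨δ, hδ, hδε⟩ := ENNReal.exists_pos_sum_of_countable hε (ℤ × ℤ)
  have hcell : ∀ q, leb (Ω ∩ cell 0 q) (cell 0 q)ᶜ = 0 := fun q => by
    rw [Measure.restrict_apply (measurableSet_cell 0 q).compl, Set.inter_comm, Set.inter_assoc,
      Set.inter_compl_self, Set.inter_empty, measure_empty]
  choose w y hw hwδ hy using fun q => exists_concentrated_frame (leb (Ω ∩ cell 0 q)) (hcell q)
    (ENNReal.coe_pos.2 (hδ q))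
  let v : (ℤ × ℤ) × ℕ × ℤ × ℤ → L2 Ω := fun p =>
    extOp Set.inter_subset_left (hΩ.inter (measurableSet_cell 0 p.1)) (w p.1 p.2)
  -- A vanishing frame vector carries no point of its own, and is assigned `x₀`.
  have hpoint : ∀ p, ∃ q x, x ∈ (leb (Ω ∩ cell 0 q)).support ∧
      (∀ᵐ t ∂leb Ω, v p t ≠ 0 → t ∈ cell 0 q) ∧ spread x (v p) ≤ spread (y p.1 p.2) (w p.1 p.2) :=
    fun p => by
      by_cases hp : w p.1 p.2 = 0
      · have hv : v p = 0 := by simp only [v, hp, map_zero]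
        refine ⟨q₀, x₀, hx₀, ?_, by rw [hv, spread_zero]; exact zero_le⟩
        filter_upwards [Lp.coeFn_zero ℂ 2 (leb Ω)] with t ht hne
        exact absurd ht (hv ▸ hne)
      · exact ⟨p.1, y p.1 p.2, hy _ _ hp,
          (extOp_ne_zero_imp_mem _ _ _).mono fun t ht hne => (ht hne).2, (spread_extOp _ _ _ _).le⟩
  choose q x hx hvq hspread using hpoint
  refine ⟨v, x, q, isParseval_extOp_cell hΩ hw, hx, hvq, ?_⟩
  calc ∑' p, spread (x p) (v p)
      ≤ ∑' p : (ℤ × ℤ) × ℕ × ℤ × ℤ, spread (y p.1 p.2) (w p.1 p.2) := ENNReal.tsum_le_tsum hspread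
    _ = ∑' q, ∑' i, spread (y q i) (w q i) := ENNReal.tsum_prod'
    _ ≤ ∑' q, (δ q : ℝ≥0∞) := ENNReal.tsum_le_tsum hwδ
    _ ≤ ε := hδε.le

theorem exists_orthonormal_concentrated (hΩ : MeasurableSet Ω) {κ : Type*} [Countable κ]
    {x : κ → ℂ} {q : κ → ℤ × ℤ} (hx : ∀ p, x p ∈ (leb (Ω ∩ cell 0 (q p))).support) {ε : ℝ≥0∞}
    (hε : ε ≠ 0) :
    ∃ e : κ → L2 Ω, Orthonormal ℂ e ∧ (∀ p, ∀ᵐ t ∂leb Ω, e p t ≠ 0 → t ∈ cell 0 (q p)) ∧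
      ∑' p, spread (x p) (e p) ≤ ε := by
  obtain ⟨η, hη, hηε⟩ := ENNReal.exists_pos_sum_of_countable hε κ
  let A : κ → Set ℂ := fun p => Metric.ball (x p) √(η p) ∩ (Ω ∩ cell 0 (q p))
  have hA : ∀ p, MeasurableSet (A p) := fun p =>
    measurableSet_ball.inter (hΩ.inter (measurableSet_cell 0 _))
  have hA0 : ∀ p, leb Ω (A p) ≠ 0 := fun p => by
    rw [Measure.restrict_eq_self _ (Set.inter_subset_right.trans Set.inter_subset_left),
      ← Measure.restrict_apply measurableSet_ball]
    exact ((Measure.mem_support_iff_forall _).1 (hx p) _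
      (Metric.ball_mem_nhds _ (Real.sqrt_pos.2 (hη p)))).ne'
  obtain ⟨N, hNA, hNm, hN0, hNtop, hNd⟩ := exists_disjoint_subsets hA hA0
  have he := orthonormal_unitInd hNm hNtop hN0 hNd
  have heA : ∀ p, ∀ᵐ t ∂leb Ω, unitInd (hNm p) (hNtop p) t ≠ 0 → t ∈ A p := fun p =>
    (unitInd_ne_zero_imp_mem (hNm p) (hNtop p)).mono fun t ht hne => hNA p (ht hne)
  refine ⟨_, he, fun p => (heA p).mono fun t ht hne => (ht hne).2.2, ?_⟩
  refine (ENNReal.tsum_le_tsum fun p => ?_).trans hηε.le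
  refine (spread_le_of_norm_le (r := √(η p)) (he.1 p) ((heA p).mono fun t ht hne => ?_)).trans ?_
  · rw [← dist_eq_norm]
    exact (Metric.mem_ball.1 (ht hne).1).le
  · rw [Real.sq_sqrt (η p).coe_nonneg, ENNReal.ofReal_coe_nnreal]

end ConcentratedFrames

/-! ## Operators compatible with the unit cells -/

section Cellular

variable {Ω : Set ℂ}

theorem eq_zero_of_hsNorm_eq_zero {H : Type*} [NormedAddCommGroup H] [InnerProductSpace ℂ H]
    [CompleteSpace H] {T : H →L[ℂ] H} (h : hsNorm T = 0) : T = 0 := by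
  obtain ⟨w, b, -⟩ := exists_hilbertBasis ℂ H
  have hsum := hsNorm_sq_eq b T
  rw [h, zero_pow two_ne_zero, eq_comm, ENNReal.tsum_eq_zero] at hsum
  refine ContinuousLinearMap.ext_on
    (Submodule.dense_iff_topologicalClosure_eq_top.2 b.dense_span) ?_
  rintro _ ⟨i, rfl⟩
  simpa using hsum i

/-- The compression to `L²(B)` of an operator on `L²(Ω)`. -/
def compress {B : Set ℂ} (h : B ⊆ Ω) (hm : MeasurableSet B) (X : L2 Ω →L[ℂ] L2 Ω) :
    L2 B →L[ℂ] L2 B :=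
  resOp h ∘L X ∘L extOp h hm

section Compress

variable {B : Set ℂ} (h : B ⊆ Ω) (hm : MeasurableSet B)

theorem commutator_compress (X : L2 Ω →L[ℂ] L2 Ω) (M : L2 B →L[ℂ] L2 B) :
    M * compress h hm X - compress h hm X * M =
      resOp h ∘L (incl h hm M * X - X * incl h hm M) ∘L extOp h hm := by
  ext1 x
  simp [incl, compress, resOp_extOp]

theorem compress_algebraMap (c : ℂ) :
    compress h hm (algebraMap ℂ _ c) = algebraMap ℂ (L2 B →L[ℂ] L2 B) c := by
  ext1 x
  simp [compress, resOp_extOp, Algebra.algebraMap_eq_smul_one]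

theorem compress_add (X Y : L2 Ω →L[ℂ] L2 Ω) :
    compress h hm (X + Y) = compress h hm X + compress h hm Y := by
  ext1 x
  simp [compress]

theorem compress_mul {X : L2 Ω →L[ℂ] L2 Ω} (hX : Commute (incl h hm 1) X)
    (Y : L2 Ω →L[ℂ] L2 Ω) : compress h hm (X * Y) = compress h hm X * compress h hm Y := by
  ext1 x
  have hcomm := congrArg (resOp h) (DFunLike.congr_fun hX.eq (Y (extOp h hm x)))
  simpa [incl, compress, resOp_extOp] using hcomm

theorem compress_star (X : L2 Ω →L[ℂ] L2 Ω) :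
    compress h hm (star X) = star (compress h hm X) := by
  rw [ContinuousLinearMap.star_eq_adjoint, ContinuousLinearMap.star_eq_adjoint, compress, compress,
    ContinuousLinearMap.adjoint_comp, ContinuousLinearMap.adjoint_comp, extOp_adjoint,
    ← extOp_adjoint h hm, ContinuousLinearMap.adjoint_adjoint, ContinuousLinearMap.comp_assoc]

theorem mul_incl_mul {X Y : L2 Ω →L[ℂ] L2 Ω} (hX : Commute (incl h hm 1) X)
    (hY : Commute (incl h hm 1) Y) (S : L2 B →L[ℂ] L2 B) :
    X * incl h hm S * Y = incl h hm (compress h hm X * S * compress h hm Y) := by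
  have hS : incl h hm S = incl h hm 1 * incl h hm S * incl h hm 1 := by
    rw [← incl_mul, ← incl_mul, one_mul, mul_one]
  calc X * incl h hm S * Y
      = X * incl h hm 1 * incl h hm S * (incl h hm 1 * Y) := by
        conv_lhs => rw [hS]
        simp only [mul_assoc]
    _ = incl h hm 1 * X * incl h hm S * (Y * incl h hm 1) := by rw [← hX.eq, hY.eq]
    _ = incl h hm (compress h hm X * S * compress h hm Y) := by
        ext1 x
        simp [incl, compress]

end Compress

theorem compress_refl (hm : MeasurableSet Ω) (X : L2 Ω →L[ℂ] L2 Ω) :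
    compress subset_rfl hm X = X := by
  have hres : ∀ g : L2 Ω, resOp subset_rfl g = g := fun g => Lp.ext (coeFn_resOp _ g)
  have hext : ∀ g : L2 Ω, extOp subset_rfl hm g = g := fun g => by
    rw [← hres (extOp _ _ _), resOp_extOp]
  ext1 x
  simp [compress, hres, hext]

theorem mem_EL_of_compress_mem {B : Set ℂ} (hB : B = Ω) {hm : MeasurableSet B}
    {X : L2 Ω →L[ℂ] L2 Ω} (hX : compress hB.subset hm X ∈ EL B) : X ∈ EL Ω := by
  subst hB
  rwa [compress_refl] at hX

/-- The part of `Ω` that lies in the unit cells with index in `S`. -/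
def cellUnion (Ω : Set ℂ) (S : Set (ℤ × ℤ)) : Set ℂ :=
  Ω ∩ cellIdx 0 ⁻¹' S

theorem cellUnion_subset (Ω : Set ℂ) (S : Set (ℤ × ℤ)) : cellUnion Ω S ⊆ Ω :=
  Set.inter_subset_left

theorem measurableSet_cellUnion (hΩ : MeasurableSet Ω) (S : Set (ℤ × ℤ)) :
    MeasurableSet (cellUnion Ω S) :=
  hΩ.inter (measurableSet_preimage_cellIdx 0 S)

/-- The operator `T ⊕ 0` on `L²(Ω)`, for `T` acting on the part of `Ω` in the cells of `S`. -/
abbrev inclCells (hΩ : MeasurableSet Ω) (S : Set (ℤ × ℤ))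
    (T : L2 (cellUnion Ω S) →L[ℂ] L2 (cellUnion Ω S)) : L2 Ω →L[ℂ] L2 Ω :=
  incl (cellUnion_subset Ω S) (measurableSet_cellUnion hΩ S) T

/-- The operators on `L²(Ω)` that are reduced by every union of unit cells and whose compressions to
these unions lie in `EΛ`. Conjugation by such operators preserves the operators with bounded
support. -/
def cellularAlg (hΩ : MeasurableSet Ω) : StarSubalgebra ℂ (L2 Ω →L[ℂ] L2 Ω) where
  carrier := {X | ∀ S, Commute (inclCells hΩ S 1) X ∧
      compress (cellUnion_subset Ω S) (measurableSet_cellUnion hΩ S) X ∈ EL (cellUnion Ω S)}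
  algebraMap_mem' c S :=
    ⟨(Algebra.commutes c _).symm, by rw [compress_algebraMap]; exact algebraMap_mem _ c⟩
  add_mem' hX hY S :=
    ⟨(hX S).1.add_right (hY S).1, by rw [compress_add]; exact add_mem (hX S).2 (hY S).2⟩
  mul_mem' hX hY S :=
    ⟨(hX S).1.mul_right (hY S).1, by
      rw [compress_mul _ _ (hX S).1]; exact mul_mem (hX S).2 (hY S).2⟩
  star_mem' hX S :=
    ⟨by simpa only [← incl_star, star_one] using (hX S).1.star_star, by
      rw [compress_star]; exact star_mem (hX S).2⟩

theorem cellularAlg_le_EL (hΩ : MeasurableSet Ω) : cellularAlg hΩ ≤ EL Ω := fun _ hX =>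
  mem_EL_of_compress_mem (Set.inter_univ Ω : cellUnion Ω Set.univ = Ω) (hX Set.univ).2

theorem mem_cellularAlg_of_hsNorm_commutator_le (hΩ : MeasurableSet Ω) {X : L2 Ω →L[ℂ] L2 Ω}
    (hone : ∀ S, hsNorm (inclCells hΩ S 1 * X - X * inclCells hΩ S 1) = 0)
    {C : ℝ≥0∞} (hC : C ≠ ∞)
    (hmul : ∀ S (f : Lp ℂ ∞ (leb (cellUnion Ω S))),
      eLpNorm (diffQuot f) ∞ ((leb (cellUnion Ω S)).prod (leb (cellUnion Ω S))) ≤ 1 →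
      hsNorm (inclCells hΩ S (mulOp f) * X - X * inclCells hΩ S (mulOp f)) ≤ C) :
    X ∈ cellularAlg hΩ := fun S => by
  refine ⟨sub_eq_zero.1 (eq_zero_of_hsNorm_eq_zero (hone S)), ?_⟩
  refine (lipNorm_le _ (‖resOp (cellUnion_subset Ω S)‖ₑ *
    (C * ‖extOp (cellUnion_subset Ω S) (measurableSet_cellUnion hΩ S)‖ₑ)) fun f hf => ?_).trans_lt
    (by finiteness)
  rw [commutator_compress]
  refine (hsNorm_comp_le _ _).trans ?_
  gcongr
  refine (hsNorm_comp_le' _ _).trans ?_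
  gcongr
  exact hmul S f hf

end Cellular

section CellularIsometries

variable {Ω : Set ℂ} {S : Set (ℤ × ℤ)} {κ : Type*} {q : κ → ℤ × ℤ} {x : κ → ℂ}

theorem mem_cellUnion_iff_of_mem_cell {q : ℤ × ℤ} {t : ℂ} (ht : t ∈ Ω) (hq : t ∈ cell 0 q) :
    t ∈ cellUnion Ω S ↔ q ∈ S := by
  rw [cellUnion, Set.mem_inter_iff, Set.mem_preimage, mem_cell.1 hq]
  exact and_iff_right ht

theorem ae_mem_cellUnion_iff (hΩ : MeasurableSet Ω) {q : ℤ × ℤ} {w : L2 Ω}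
    (hw : ∀ᵐ t ∂leb Ω, w t ≠ 0 → t ∈ cell 0 q) :
    ∀ᵐ t ∂leb Ω, w t ≠ 0 → (t ∈ cellUnion Ω S ↔ q ∈ S) := by
  filter_upwards [hw, ae_restrict_mem hΩ] with t hq ht hne
  exact mem_cellUnion_iff_of_mem_cell ht (hq hne)

theorem exists_eigenDefect_incl_one_eq_zero (hΩ : MeasurableSet Ω) (S : Set (ℤ × ℤ))
    (q : κ → ℤ × ℤ) :
    ∃ c : κ → ℂ, ∀ w : κ → L2 Ω, (∀ p, ∀ᵐ t ∂leb Ω, w p t ≠ 0 → t ∈ cell 0 (q p)) →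
      eigenDefect (inclCells hΩ S 1) c w = 0 := by
  classical
  refine ⟨fun p => if q p ∈ S then 1 else 0, fun w hw => ?_⟩
  have heigen : ∀ p, inclCells hΩ S 1 (w p) = (if q p ∈ S then (1 : ℂ) else 0) • w p := fun p => by
    have hmem := ae_mem_cellUnion_iff (S := S) hΩ (hw p)
    split_ifs with hq
    · rw [one_smul]
      exact incl_one_apply_of_mem _ _ (hmem.mono fun t ht hne => (ht hne).2 hq)
    · rw [zero_smul]
      exact incl_one_apply_of_disjoint _ _ (hmem.mono fun t ht hne => mt (ht hne).1 hq)
  simp only [eigenDefect, ← incl_star, star_one, heigen, apply_ite conj, map_one, map_zero,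
    sub_self, enorm_zero, ne_eq, OfNat.ofNat_ne_zero, not_false_eq_true, zero_pow,
    tsum_zero, add_zero]

theorem exists_eigenvalue_incl_mulOp (hΩ : MeasurableSet Ω) {f : Lp ℂ ∞ (leb (cellUnion Ω S))}
    (hf : eLpNorm (diffQuot f) ∞ ((leb (cellUnion Ω S)).prod (leb (cellUnion Ω S))) ≤ 1)
    {q : ℤ × ℤ} {x : ℂ} (hx : x ∈ (leb (Ω ∩ cell 0 q)).support) :
    ∃ c : ℂ, ∀ w : L2 Ω, (∀ᵐ t ∂leb Ω, w t ≠ 0 → t ∈ cell 0 q) →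
      ‖inclCells hΩ S (mulOp f) w - c • w‖ₑ ^ 2 ≤ spread x w ∧
        ‖star (inclCells hΩ S (mulOp f)) w - conj c • w‖ₑ ^ 2 ≤ spread x w := by
  rw [← incl_star, mulOp_adjoint]
  by_cases hq : q ∈ S
  · have hsub : Ω ∩ cell 0 q ⊆ cellUnion Ω S := fun t ht =>
      (mem_cellUnion_iff_of_mem_cell ht.1 ht.2).2 hq
    obtain ⟨c, hc⟩ := exists_ae_dist_le_of_eLpNorm_diffQuot_le hf
      (Measure.support_mono (leb_mono hsub) hx)
    have hc_star : ∀ᵐ t ∂leb (cellUnion Ω S), dist (star f t) (conj c) ≤ dist t x := by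
      filter_upwards [hc, Lp.coeFn_star f] with t hct hstar
      rwa [hstar, Pi.star_apply, ← starRingEnd_apply, dist_eq_norm, ← map_sub, RCLike.norm_conj,
        ← dist_eq_norm]
    refine ⟨c, fun w hw => ?_⟩
    have hmem := (ae_mem_cellUnion_iff (S := S) hΩ hw).mono fun t ht hne => (ht hne).2 hq
    exact ⟨enorm_incl_mulOp_sub_sq_le_spread _ _ hc hmem,
      enorm_incl_mulOp_sub_sq_le_spread _ _ hc_star hmem⟩
  · refine ⟨0, fun w hw => ?_⟩
    have hmem := (ae_mem_cellUnion_iff (S := S) hΩ hw).mono fun t ht hne => mt (ht hne).1 hq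
    simp [incl_mulOp_apply_of_disjoint _ _ _ hmem]

theorem exists_eigenDefect_incl_mulOp_le (hΩ : MeasurableSet Ω)
    {f : Lp ℂ ∞ (leb (cellUnion Ω S))}
    (hf : eLpNorm (diffQuot f) ∞ ((leb (cellUnion Ω S)).prod (leb (cellUnion Ω S))) ≤ 1)
    (hx : ∀ p, x p ∈ (leb (Ω ∩ cell 0 (q p))).support) :
    ∃ c : κ → ℂ, ∀ w : κ → L2 Ω, (∀ p, ∀ᵐ t ∂leb Ω, w p t ≠ 0 → t ∈ cell 0 (q p)) →
      eigenDefect (inclCells hΩ S (mulOp f)) c w ≤ 2 * ∑' p, spread (x p) (w p) := by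
  choose c hc using fun p => exists_eigenvalue_incl_mulOp hΩ hf (hx p)
  refine ⟨c, fun w hw => ?_⟩
  rw [eigenDefect, two_mul]
  exact add_le_add (ENNReal.tsum_le_tsum fun p => (hc p _ (hw p)).1)
    (ENNReal.tsum_le_tsum fun p => (hc p _ (hw p)).2)

theorem exists_frames_concentrated_with_orthonormal (hΩ : MeasurableSet Ω) (h0 : volume Ω ≠ 0)
    {ε : ℝ≥0∞} (hε : ε ≠ 0) :
    ∃ (v : ℕ → (ℤ × ℤ) × ℕ × ℤ × ℤ → L2 Ω) (e : ℕ × (ℤ × ℤ) × ℕ × ℤ × ℤ → L2 Ω)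
      (x : ℕ × (ℤ × ℤ) × ℕ × ℤ × ℤ → ℂ) (q : ℕ × (ℤ × ℤ) × ℕ × ℤ × ℤ → ℤ × ℤ),
      (∀ l, IsParseval (v l)) ∧ Orthonormal ℂ e ∧
      (∀ p, x p ∈ (leb (Ω ∩ cell 0 (q p))).support) ∧
      ((∀ p, ∀ᵐ t ∂leb Ω, v p.1 p.2 t ≠ 0 → t ∈ cell 0 (q p)) ∧
        ∑' p, spread (x p) (v p.1 p.2) ≤ ε) ∧
      (∀ p, ∀ᵐ t ∂leb Ω, e p t ≠ 0 → t ∈ cell 0 (q p)) ∧ ∑' p, spread (x p) (e p) ≤ ε := by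
  obtain ⟨δ, hδ, hδε⟩ := ENNReal.exists_pos_sum_of_countable hε ℕ
  choose v x q hv hx hvq hspread using fun l =>
    exists_concentrated_frame_cell hΩ h0 (ENNReal.coe_ne_zero.2 (hδ l).ne')
  obtain ⟨e, he, heq, hespread⟩ := exists_orthonormal_concentrated hΩ
    (x := fun p : ℕ × (ℤ × ℤ) × ℕ × ℤ × ℤ => x p.1 p.2) (q := fun p => q p.1 p.2)
    (fun p => hx p.1 p.2) hε
  refine ⟨v, e, fun p => x p.1 p.2, fun p => q p.1 p.2, hv, he, fun p => hx p.1 p.2,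
    ⟨fun p => hvq p.1 p.2, ?_⟩, heq, hespread⟩
  rw [ENNReal.tsum_prod']
  exact (ENNReal.tsum_le_tsum hspread).trans hδε.le

theorem exists_complementary_isometries_mem_cellularAlg (hΩ : MeasurableSet Ω) :
    ∃ R ∈ cellularAlg hΩ, ∃ W ∈ cellularAlg hΩ,
      star R * R = 1 ∧ star W * W = 1 ∧ R * star R + W * star W = 1 := by
  by_cases h0 : volume Ω = 0
  · have : Subsingleton (L2 Ω) := ⟨fun f g => Lp.ext (by
      rw [Filter.EventuallyEq, ae_eq_bot.2 (Measure.restrict_eq_zero.2 h0)]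
      exact Filter.eventually_bot)⟩
    exact ⟨0, zero_mem _, 0, zero_mem _, Subsingleton.elim _ _, Subsingleton.elim _ _,
      Subsingleton.elim _ _⟩
  obtain ⟨v, e, x, q, hv, he, hx, ⟨hvq, hvx⟩, heq, hex⟩ :=
    exists_frames_concentrated_with_orthonormal hΩ h0 (ε := 2⁻¹) (by simp)
  obtain ⟨R, W, hR, hW, hRW, hcomm⟩ := exists_complementary_isometries_of_frames he hv
  have htwo : 2 * (2⁻¹ : ℝ≥0∞) = 1 ^ 2 := by
    rw [ENNReal.mul_inv_cancel two_ne_zero ENNReal.ofNat_ne_top, one_pow]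
  have hmul : ∀ S (f : Lp ℂ ∞ (leb (cellUnion Ω S))),
      eLpNorm (diffQuot f) ∞ ((leb (cellUnion Ω S)).prod (leb (cellUnion Ω S))) ≤ 1 →
      hsNorm (inclCells hΩ S (mulOp f) * R - R * inclCells hΩ S (mulOp f)) ≤ 2 * 1 ∧
      hsNorm (inclCells hΩ S (mulOp f) * W - W * inclCells hΩ S (mulOp f)) ≤ 8 * 1 :=
    fun S f hf => by
      obtain ⟨c, hc⟩ := exists_eigenDefect_incl_mulOp_le hΩ hf hx
      exact hcomm _ c 1 ((hc e heq).trans (by rw [← htwo]; gcongr))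
        ((hc _ hvq).trans (by rw [← htwo]; gcongr))
  have hone : ∀ S,
      hsNorm (inclCells hΩ S 1 * R - R * inclCells hΩ S 1) ≤ 2 * 0 ∧
      hsNorm (inclCells hΩ S 1 * W - W * inclCells hΩ S 1) ≤ 8 * 0 := fun S => by
    obtain ⟨c, hc⟩ := exists_eigenDefect_incl_one_eq_zero hΩ S q
    exact hcomm _ c 0 ((hc e heq).trans_le zero_le) ((hc _ hvq).trans_le zero_le)
  refine ⟨R, ?_, W, ?_, hR, hW, hRW⟩
  · exact mem_cellularAlg_of_hsNorm_commutator_le hΩ (fun S => by simpa using (hone S).1)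
      (by finiteness) fun S f hf => (hmul S f hf).1
  · exact mem_cellularAlg_of_hsNorm_commutator_le hΩ (fun S => by simpa using (hone S).2)
      (by finiteness) fun S f hf => (hmul S f hf).2

end CellularIsometries

section Conjugation

variable {Ω : Set ℂ} {X Y T : L2 Ω →L[ℂ] L2 Ω}

theorem isBounded_preimage_cellIdx_image {B : Set ℂ} (hB : Bornology.IsBounded B) :
    Bornology.IsBounded (cellIdx 0 ⁻¹' (cellIdx 0 '' B)) := by
  refine (hB.cthickening (δ := √2)).subset ?_
  rintro z ⟨b, hb, hbz⟩
  refine Metric.mem_cthickening_of_dist_le z b _ _ hb ?_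
  rw [dist_comm, dist_eq_norm]
  simpa using norm_sub_le_of_cellIdx_eq hbz

theorem mul_bddPart_mul (hΩ : MeasurableSet Ω) (hX : X ∈ cellularAlg hΩ) (hY : Y ∈ cellularAlg hΩ)
    (hT : T ∈ bddPart Ω) : X * T * Y ∈ bddPart Ω := by
  obtain ⟨B, h, hm, hb, S, hS, rfl⟩ := hT
  set E := cellUnion Ω (cellIdx 0 '' B)
  have hBE : B ⊆ E := Set.subset_inter h (Set.subset_preimage_image _ _)
  have hEb : Bornology.IsBounded E :=
    (isBounded_preimage_cellIdx_image hb).subset Set.inter_subset_right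
  have hEm : MeasurableSet E := measurableSet_cellUnion hΩ _
  rw [← incl_incl hBE (cellUnion_subset Ω _) hm hEm, mul_incl_mul _ _ (hX _).1 (hY _).1]
  exact ⟨E, _, hEm, hEb, _, mul_mem (mul_mem (hX _).2 (incl_mem_EL _ _ hS)) (hY _).2, rfl⟩

theorem mul_EL0_mul (hΩ : MeasurableSet Ω) (hX : X ∈ cellularAlg hΩ) (hY : Y ∈ cellularAlg hΩ)
    (hT : T ∈ EL0 Ω) : X * T * Y ∈ EL0 Ω := by
  obtain ⟨hT, happrox⟩ := hT
  have hX' := cellularAlg_le_EL hΩ hX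
  have hY' := cellularAlg_le_EL hΩ hY
  refine ⟨mul_mem (mul_mem hX' hT) hY', fun ε hε => ?_⟩
  obtain ⟨δ, hδ, hδε⟩ := ENNReal.exists_pos_mul_lt
    (ENNReal.mul_ne_top ((tripleNorm_lt_top_iff X).2 hX').ne
      ((tripleNorm_lt_top_iff Y).2 hY').ne) hε.ne'
  obtain ⟨S, hS, hSδ⟩ := happrox δ hδ
  refine ⟨X * S * Y, mul_bddPart_mul hΩ hX hY hS, ?_⟩
  rw [← sub_mul, ← mul_sub]
  calc tripleNorm (X * (T - S) * Y)
      ≤ tripleNorm X * tripleNorm (T - S) * tripleNorm Y :=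
        (tripleNorm_mul_le _ _).trans (by gcongr; exact tripleNorm_mul_le _ _)
    _ ≤ tripleNorm X * δ * tripleNorm Y := by gcongr
    _ = δ * (tripleNorm X * tripleNorm Y) := by ring
    _ < ε := hδε

end Conjugation

/-! ## Cuntz families and amplifications -/

/-- A finite family whose adjoints satisfy the Cuntz relations: the `star (V k)` are isometries
whose range projections `star (V k) * V k` sum to `1`. The coisometries rather than the isometries
are taken as the family because they are the components of a unitary `H → H ⊗ 𝕜ⁿ`. -/
structure IsCuntzFamily {A ι : Type*} [Semiring A] [StarRing A] [Fintype ι] [DecidableEq ι]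
    (V : ι → A) : Prop where
  mul_star : ∀ k l, V k * star (V l) = if k = l then 1 else 0
  sum_star_mul : ∑ k, star (V k) * V k = 1

section CuntzFamily

variable {A : Type*} [Ring A] [StarRing A]

theorem star_mul_eq_zero_of_add_eq_one {R W : A} (hR : star R * R = 1) (hW : star W * W = 1)
    (hRW : R * star R + W * star W = 1) : star R * W = 0 := by
  have h : star R * W + star R * W = star R * W :=
    calc star R * W + star R * W
        = (star R * R) * star R * W + star R * W * (star W * W) := by simp [hR, hW]
      _ = star R * (R * star R + W * star W) * W := by noncomm_ring
      _ = star R * W := by rw [hRW, mul_one]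
  simpa using h

theorem IsCuntzFamily.cons {R W : A} (hR : star R * R = 1) (hW : star W * W = 1)
    (hRW : R * star R + W * star W = 1) {n : ℕ} {V : Fin n → A} (hV : IsCuntzFamily V) :
    IsCuntzFamily (Fin.cons (star R) fun k => V k * star W : Fin (n + 1) → A) where
  mul_star k l := by
    have hRW0 : star R * W = 0 := star_mul_eq_zero_of_add_eq_one hR hW hRW
    have hWR0 : star W * R = 0 := by simpa using congrArg star hRW0
    cases k using Fin.cases <;> cases l using Fin.cases
    · simp [hR]
    · simp [← mul_assoc, hRW0, (Fin.succ_ne_zero _).symm]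
    · simp [mul_assoc, hWR0]
    · simp only [Fin.cons_succ, star_mul, star_star, Fin.succ_inj, ← hV.mul_star]
      rw [mul_assoc, ← mul_assoc (star W), hW, one_mul]
  sum_star_mul := by
    have hsum : ∑ k, W * star (V k) * (V k * star W) = W * star W := by
      calc ∑ k, W * star (V k) * (V k * star W) = W * (∑ k, star (V k) * V k) * star W := by
            simp only [Finset.mul_sum, Finset.sum_mul, mul_assoc]
        _ = W * star W := by rw [hV.sum_star_mul, mul_one]
    simp [Fin.sum_univ_succ, hsum, hRW]

theorem exists_isCuntzFamily {R W : A} (hR : star R * R = 1) (hW : star W * W = 1)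
    (hRW : R * star R + W * star W = 1) {n : ℕ} (hn : 1 ≤ n) :
    ∃ V : Fin n → A, IsCuntzFamily V := by
  induction n, hn using Nat.le_induction with
  | base => exact ⟨fun _ => 1, fun k l => by simp [Subsingleton.elim k l], by simp⟩
  | succ n _ ih => exact ih.elim fun V hV => ⟨_, hV.cons hR hW hRW⟩

end CuntzFamily

theorem exists_isCuntzFamily_mem_cellularAlg {Ω : Set ℂ} (hΩ : MeasurableSet Ω) {n : ℕ}
    (hn : 1 ≤ n) :
    ∃ V : Fin n → L2 Ω →L[ℂ] L2 Ω, IsCuntzFamily V ∧ ∀ k, V k ∈ cellularAlg hΩ := by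
  obtain ⟨R, hR, W, hW, hRR, hWW, hRW⟩ := exists_complementary_isometries_mem_cellularAlg hΩ
  obtain ⟨V, hV⟩ := exists_isCuntzFamily (A := cellularAlg hΩ) (R := ⟨R, hR⟩) (W := ⟨W, hW⟩)
    (Subtype.ext hRR) (Subtype.ext hWW) (Subtype.ext hRW) hn
  refine ⟨fun k => V k, ⟨fun k l => ?_, ?_⟩, fun k => (V k).2⟩
  · have h := congrArg Subtype.val (hV.mul_star k l)
    split_ifs at h ⊢ <;> exact h
  · simpa using congrArg Subtype.val hV.sum_star_mul

namespace IsCuntzFamily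

variable {B ι : Type*} [Semiring B] [StarRing B] [Fintype ι] [DecidableEq ι] {V : ι → B}

theorem sum_mul_star_mul_mul (hV : IsCuntzFamily V) (X Y : B) :
    ∑ k, X * star (V k) * (V k * Y) = X * Y := by
  calc ∑ k, X * star (V k) * (V k * Y) = X * (∑ k, star (V k) * V k) * Y := by
        simp only [Finset.mul_sum, Finset.sum_mul, mul_assoc]
    _ = X * Y := by rw [hV.sum_star_mul, mul_one]

theorem ext (hV : IsCuntzFamily V) {X Y : B}
    (h : ∀ k l, V k * X * star (V l) = V k * Y * star (V l)) : X = Y := by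
  have hleft : ∀ k, V k * X = V k * Y := fun k => by
    rw [← mul_one (V k * X), ← mul_one (V k * Y), ← hV.sum_mul_star_mul_mul (V k * X),
      ← hV.sum_mul_star_mul_mul (V k * Y)]
    simp only [h]
  rw [← one_mul X, ← one_mul Y, ← hV.sum_mul_star_mul_mul 1 X, ← hV.sum_mul_star_mul_mul 1 Y]
  simp only [hleft]

theorem mul_sum_mul_star (hV : IsCuntzFamily V) (c : ι → ι → B) (k l : ι) :
    V k * (∑ p, ∑ q, star (V p) * c p q * V q) * star (V l) = c k l := by
  calc V k * (∑ p, ∑ q, star (V p) * c p q * V q) * star (V l)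
      = ∑ p, ∑ q, (V k * star (V p)) * c p q * (V q * star (V l)) := by
        simp only [Finset.mul_sum, Finset.sum_mul, mul_assoc]
    _ = c k l := by simp [hV.mul_star]

end IsCuntzFamily

section TensorEntry

variable {R A ι : Type*} [CommSemiring R]

/-- The entry at `(k, l)` of an element of `A ⊗ M_ι(R)`, viewed as a matrix over `A`; the algebra
`A` may lack a unit, so Mathlib's `matrixEquivTensor` does not apply. -/
def tensorEntry [AddCommMonoid A] [Module R A] (k l : ι) : A ⊗[R] Matrix ι ι R →ₗ[R] A :=
  TensorProduct.rid R A ∘ₗ TensorProduct.map .id (Matrix.entryLinearMap R R k l)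

section Module

variable [AddCommMonoid A] [Module R A]

@[simp]
theorem tensorEntry_tmul (k l : ι) (a : A) (m : Matrix ι ι R) :
    tensorEntry k l (a ⊗ₜ[R] m) = m k l • a := by
  simp [tensorEntry]

theorem sum_tensorEntry_tmul_single [Fintype ι] [DecidableEq ι] (x : A ⊗[R] Matrix ι ι R) :
    ∑ k, ∑ l, tensorEntry k l x ⊗ₜ[R] Matrix.single k l 1 = x := by
  induction x with
  | zero => simp
  | add x y hx hy =>
    simp only [map_add, TensorProduct.add_tmul, Finset.sum_add_distrib, hx, hy]
  | tmul a m =>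
    conv_rhs => rw [Matrix.matrix_eq_sum_single m]
    simp [TensorProduct.tmul_sum, TensorProduct.smul_tmul, Matrix.smul_single]

theorem tensorEntry_ext [Finite ι] {x y : A ⊗[R] Matrix ι ι R}
    (h : ∀ k l, tensorEntry k l x = tensorEntry k l y) : x = y := by
  classical
  have := Fintype.ofFinite ι
  rw [← sum_tensorEntry_tmul_single x, ← sum_tensorEntry_tmul_single y]
  simp only [h]

theorem exists_tensorEntry_eq [Finite ι] (c : ι → ι → A) :
    ∃ x : A ⊗[R] Matrix ι ι R, ∀ k l, tensorEntry k l x = c k l := by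
  classical
  have := Fintype.ofFinite ι
  refine ⟨∑ k, ∑ l, c k l ⊗ₜ[R] Matrix.single k l 1, fun k l => ?_⟩
  simp [Matrix.single_apply, ite_and]

end Module

theorem tensorEntry_mul [Fintype ι] [NonUnitalSemiring A] [Module R A] [IsScalarTower R A A]
    [SMulCommClass R A A] (k l : ι) (x y : A ⊗[R] Matrix ι ι R) :
    tensorEntry k l (x * y) = ∑ i, tensorEntry k i x * tensorEntry i l y := by
  induction x with
  | zero => simp
  | add x₁ x₂ h₁ h₂ => simp only [add_mul, map_add, h₁, h₂, Finset.sum_add_distrib]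
  | tmul a m =>
    induction y with
    | zero => simp
    | add y₁ y₂ h₁ h₂ => simp only [mul_add, map_add, h₁, h₂, Finset.sum_add_distrib]
    | tmul b m' =>
      simp [Matrix.mul_apply, Finset.sum_smul, smul_mul_smul_comm]

theorem tensorEntry_star [StarRing R] [AddCommMonoid A] [Module R A] [StarAddMonoid A]
    [StarModule R A] (k l : ι) (x : A ⊗[R] Matrix ι ι R) :
    tensorEntry k l (star x) = star (tensorEntry l k x) := by
  induction x with
  | zero => simp
  | add x y hx hy => simp only [star_add, map_add, hx, hy]
  | tmul a m => simp [TensorProduct.star_tmul]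

end TensorEntry

section Amplification

variable {R A B ι : Type*} [CommSemiring R] [StarRing R] [Fintype ι] [DecidableEq ι]
  [NonUnitalSemiring A] [StarRing A] [Module R A] [IsScalarTower R A A] [SMulCommClass R A A]
  [StarModule R A] [Semiring B] [StarRing B] [Algebra R B]

theorem IsCuntzFamily.exists_starAlgEquiv {V : ι → B} (hV : IsCuntzFamily V) (j : A →⋆ₙₐ[R] B)
    (hj : Function.Injective j) (hcompress : ∀ k l a, V k * j a * star (V l) ∈ Set.range j)
    (hdilate : ∀ k l a, star (V k) * j a * V l ∈ Set.range j) :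
    ∃ Φ : A ≃⋆ₐ[R] A ⊗[R] Matrix ι ι R,
      ∀ a k l, j (tensorEntry k l (Φ a)) = V k * j a * star (V l) := by
  choose c hc using hcompress
  choose d hd using hdilate
  choose F hF using fun a => exists_tensorEntry_eq (R := R) fun k l => c k l a
  have hjF : ∀ a k l, j (tensorEntry k l (F a)) = V k * j a * star (V l) := fun a k l => by
    rw [hF, hc]
  have hext : ∀ {x y : A ⊗[R] Matrix ι ι R},
      (∀ k l, j (tensorEntry k l x) = j (tensorEntry k l y)) → x = y := fun h =>
    tensorEntry_ext fun k l => hj (h k l)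
  let Φ : A →⋆ₙₐ[R] A ⊗[R] Matrix ι ι R :=
    { toFun := F
      map_zero' := hext fun k l => by simp [hjF]
      map_add' a b := hext fun k l => by simp [hjF, mul_add, add_mul]
      map_smul' r a := hext fun k l => by simp [hjF]
      map_mul' a b := hext fun k l => by
        simp only [hjF, tensorEntry_mul, map_sum, map_mul]
        rw [← mul_assoc, mul_assoc, ← hV.sum_mul_star_mul_mul]
        simp only [mul_assoc]
      map_star' a := hext fun k l => by
        simp only [hjF, tensorEntry_star, map_star, star_mul, star_star, mul_assoc] }
  have hinj : Function.Injective Φ := fun a b hab => hj <| hV.ext fun k l => by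
    rw [← hjF, ← hjF]
    exact congrArg (fun x => j (tensorEntry k l x)) hab
  have hsurj : Function.Surjective Φ := fun x =>
    ⟨∑ p, ∑ q, d p q (tensorEntry p q x), hext fun k l => by
      refine (hjF _ k l).trans ?_
      simp only [map_sum, hd]
      exact hV.mul_sum_mul_star (fun p q => j (tensorEntry p q x)) k l⟩
  exact ⟨StarAlgEquiv.ofBijective Φ ⟨hinj, hsurj⟩, hjF⟩

end Amplification

theorem IsCuntzFamily.exists_linearIsometryEquiv {𝕜 H ι : Type*} [RCLike 𝕜]
    [NormedAddCommGroup H] [InnerProductSpace 𝕜 H] [CompleteSpace H] [Fintype ι] [DecidableEq ι]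
    {V : ι → H →L[𝕜] H} (hV : IsCuntzFamily V) :
    ∃ U : H ≃ₗᵢ[𝕜] H ⊗[𝕜] EuclideanSpace 𝕜 ι,
      ∀ h, U h = ∑ k, V k h ⊗ₜ[𝕜] EuclideanSpace.single k 1 := by
  let F : H →ₗ[𝕜] H ⊗[𝕜] EuclideanSpace 𝕜 ι :=
    ∑ k, (TensorProduct.mk 𝕜 H (EuclideanSpace 𝕜 ι)).flip (EuclideanSpace.single k 1) ∘ₗ
      (V k : H →ₗ[𝕜] H)
  have hF : ∀ h, F h = ∑ k, V k h ⊗ₜ[𝕜] EuclideanSpace.single k 1 := fun h => by simp [F]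
  have hinner : ∀ h g, inner 𝕜 (F h) (F g) = inner 𝕜 h g := fun h g =>
    calc inner 𝕜 (F h) (F g) = ∑ k, inner 𝕜 h (star (V k) (V k g)) := by
          simp [hF, sum_inner, inner_sum, TensorProduct.inner_tmul,
            ContinuousLinearMap.star_eq_adjoint, ContinuousLinearMap.adjoint_inner_right,
            EuclideanSpace.inner_single_left]
      _ = inner 𝕜 h g := by
          rw [← inner_sum]
          congr 1
          simpa using DFunLike.congr_fun hV.sum_star_mul g
  have hstar : ∀ k h, F (star (V k) h) = h ⊗ₜ[𝕜] EuclideanSpace.single k 1 := fun k h => by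
    have hmul : ∀ l, V l (star (V k) h) = if l = k then h else 0 := fun l => by
      rw [← mul_apply_eq_comp, hV.mul_star]
      split_ifs <;> rfl
    simp [hF, hmul, TensorProduct.ite_tmul]
  have hsurj : Function.Surjective F := by
    rw [← LinearMap.range_eq_top, eq_top_iff, ← TensorProduct.span_tmul_eq_top, Submodule.span_le]
    rintro _ ⟨h, v, rfl⟩
    rw [← (EuclideanSpace.basisFun ι 𝕜).sum_repr v, TensorProduct.tmul_sum]
    refine sum_mem fun k _ => ?_
    rw [TensorProduct.tmul_smul, EuclideanSpace.basisFun_apply, ← hstar]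
    exact Submodule.smul_mem _ _ (LinearMap.mem_range_self F _)
  exact ⟨.ofSurjective (F.isometryOfInner hinner) hsurj, hF⟩

section Spatial

variable {Ω : Set ℂ} {n : ℕ}

theorem tensorOp_tmul_single {A : Type*} [AddCommGroup A] [Module ℂ A]
    (j : A →ₗ[ℂ] (L2 Ω →L[ℂ] L2 Ω)) (x : A ⊗[ℂ] Mn n) (h : L2 Ω) (k : Fin n) :
    tensorOp j n x (h ⊗ₜ EuclideanSpace.single k 1) =
      ∑ l, j (tensorEntry l k x) h ⊗ₜ (EuclideanSpace.single l 1 : Cn n) := by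
  induction x with
  | zero => simp
  | add x y hx hy =>
    simp only [map_add, LinearMap.add_apply, add_apply, hx, hy, TensorProduct.add_tmul,
      Finset.sum_add_distrib]
  | tmul a m =>
    have hcol : Matrix.toEuclideanLin m (EuclideanSpace.single k 1) =
        ∑ l, m l k • (EuclideanSpace.single l 1 : Cn n) := by
      ext i
      simp [Matrix.toLpLin_apply, Pi.single_apply]
    have htmul : tensorOp j n (a ⊗ₜ m) (h ⊗ₜ EuclideanSpace.single k 1) =
        j a h ⊗ₜ Matrix.toEuclideanLin m (EuclideanSpace.single k 1) := rfl
    simp [htmul, hcol, TensorProduct.tmul_sum, TensorProduct.smul_tmul]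

variable {V : Fin n → L2 Ω →L[ℂ] L2 Ω} {U : L2 Ω ≃ₗᵢ[ℂ] L2 Ω ⊗[ℂ] Cn n}

theorem IsCuntzFamily.tensorOp_eq_conjBy {A : Type*} [AddCommGroup A] [Module ℂ A]
    {j : A →ₗ[ℂ] (L2 Ω →L[ℂ] L2 Ω)} (hV : IsCuntzFamily V)
    (hU : ∀ h, U h = ∑ k, V k h ⊗ₜ[ℂ] EuclideanSpace.single k 1) {x : A ⊗[ℂ] Mn n}
    {T : L2 Ω →L[ℂ] L2 Ω} (hx : ∀ k l, j (tensorEntry k l x) = V k * T * star (V l)) :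
    tensorOp j n x = conjBy U T := by
  have hcomp : ∀ l g, ∑ k, (V l * T * star (V k)) (V k g) = V l (T g) := fun l g => by
    simpa using DFunLike.congr_fun (hV.sum_mul_star_mul_mul (V l * T) 1) g
  have hintertwine : ∀ g, tensorOp j n x (U g) = U (T g) := fun g => by
    simp only [hU, map_sum, tensorOp_tmul_single, hx]
    rw [Finset.sum_comm]
    simp only [← TensorProduct.sum_tmul, hcomp]
  refine LinearMap.ext fun y => ?_
  obtain ⟨g, rfl⟩ := U.surjective y
  simp [conjBy, LinearEquiv.conj_apply, hintertwine]

theorem IsCuntzFamily.exists_spatial_starAlgEquiv {A : Type*} [NonUnitalRing A] [StarRing A]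
    [Module ℂ A] [IsScalarTower ℂ A A] [SMulCommClass ℂ A A] [StarModule ℂ A]
    (hV : IsCuntzFamily V) (hU : ∀ h, U h = ∑ k, V k h ⊗ₜ[ℂ] EuclideanSpace.single k 1)
    (j : A →⋆ₙₐ[ℂ] (L2 Ω →L[ℂ] L2 Ω)) (hj : Function.Injective j)
    (hcompress : ∀ k l a, V k * j a * star (V l) ∈ Set.range j)
    (hdilate : ∀ k l a, star (V k) * j a * V l ∈ Set.range j) :
    conjBy U '' Set.range j = Set.range (tensorOp (j : A →ₗ[ℂ] (L2 Ω →L[ℂ] L2 Ω)) n) ∧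
      ∃ Φ : A ≃⋆ₐ[ℂ] A ⊗[ℂ] Mn n,
        ∀ a, tensorOp (j : A →ₗ[ℂ] (L2 Ω →L[ℂ] L2 Ω)) n (Φ a) = conjBy U (j a) := by
  obtain ⟨Φ, hΦ⟩ := hV.exists_starAlgEquiv j hj hcompress hdilate
  have hspatial : ∀ a, tensorOp (j : A →ₗ[ℂ] (L2 Ω →L[ℂ] L2 Ω)) n (Φ a) = conjBy U (j a) :=
    fun a => hV.tensorOp_eq_conjBy hU (hΦ a)
  refine ⟨?_, Φ, hspatial⟩
  rw [← Φ.surjective.range_comp, ← Set.range_comp]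
  exact congrArg Set.range (funext fun a => (hspatial a).symm)

theorem IsCuntzFamily.EL_amplification (hV : IsCuntzFamily V)
    (hU : ∀ h, U h = ∑ k, V k h ⊗ₜ[ℂ] EuclideanSpace.single k 1) (hmem : ∀ k, V k ∈ EL Ω) :
    conjBy U '' (EL Ω : Set (L2 Ω →L[ℂ] L2 Ω)) = Set.range (ELtensorOp Ω n) ∧
      ∃ Φ : EL Ω ≃⋆ₐ[ℂ] EL Ω ⊗[ℂ] Mn n, ∀ T : EL Ω, ELtensorOp Ω n (Φ T) = conjBy U T := by
  have h := hV.exists_spatial_starAlgEquiv hU (EL Ω).subtype.toNonUnitalStarAlgHom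
    Subtype.val_injective
    (fun k l a => ⟨⟨_, mul_mem (mul_mem (hmem k) a.2) (star_mem (hmem l))⟩, rfl⟩)
    (fun k l a => ⟨⟨_, mul_mem (mul_mem (star_mem (hmem k)) a.2) (hmem l)⟩, rfl⟩)
  rwa [show Set.range (EL Ω).subtype.toNonUnitalStarAlgHom = EL Ω from Subtype.range_coe] at h

theorem IsCuntzFamily.EL0_amplification (hV : IsCuntzFamily V)
    (hU : ∀ h, U h = ∑ k, V k h ⊗ₜ[ℂ] EuclideanSpace.single k 1) (hΩ : MeasurableSet Ω)
    (hmem : ∀ k, V k ∈ cellularAlg hΩ) :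
    conjBy U '' (EL0 Ω : Set (L2 Ω →L[ℂ] L2 Ω)) = Set.range (EL0tensorOp Ω n) ∧
      ∃ Φ : EL0 Ω ≃⋆ₐ[ℂ] EL0 Ω ⊗[ℂ] Mn n, ∀ T : EL0 Ω, EL0tensorOp Ω n (Φ T) = conjBy U T := by
  have h := hV.exists_spatial_starAlgEquiv hU (NonUnitalStarSubalgebraClass.subtype (EL0 Ω))
    Subtype.val_injective
    (fun k l a => ⟨⟨_, mul_EL0_mul hΩ (hmem k) (star_mem (hmem l)) a.2⟩, rfl⟩)
    (fun k l a => ⟨⟨_, mul_EL0_mul hΩ (star_mem (hmem k)) (hmem l) a.2⟩, rfl⟩)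
  rwa [show Set.range (NonUnitalStarSubalgebraClass.subtype (EL0 Ω)) = EL0 Ω from
    Subtype.range_coe] at h

end Spatial

end ELam

theorem mainTheorem9_general (n : ℕ) (hn : 1 ≤ n) (Ω : Set ℂ) (hΩ : MeasurableSet Ω) :
    ∃ (V : Fin n → ELam.EL Ω) (U : ELam.L2 Ω ≃ₗᵢ[ℂ] ELam.L2 Ω ⊗[ℂ] ELam.Cn n),
      (∀ h : ELam.L2 Ω, U h = ∑ k, (V k : ELam.L2 Ω →L[ℂ] ELam.L2 Ω) h ⊗ₜ[ℂ]
        (EuclideanSpace.single k 1 : ELam.Cn n)) ∧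
      (ELam.conjBy U '' (ELam.EL Ω : Set (ELam.L2 Ω →L[ℂ] ELam.L2 Ω)) =
        Set.range (ELam.ELtensorOp Ω n)) ∧
      (∃ Φ : ELam.EL Ω ≃⋆ₐ[ℂ] ELam.EL Ω ⊗[ℂ] ELam.Mn n,
        ∀ T : ELam.EL Ω, ELam.ELtensorOp Ω n (Φ T) = ELam.conjBy U T) ∧
      (ELam.conjBy U '' (ELam.EL0 Ω : Set (ELam.L2 Ω →L[ℂ] ELam.L2 Ω)) =
        Set.range (ELam.EL0tensorOp Ω n)) ∧
      (∃ Ψ : ELam.EL0 Ω ≃⋆ₐ[ℂ] ELam.EL0 Ω ⊗[ℂ] ELam.Mn n,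
        ∀ T : ELam.EL0 Ω, ELam.EL0tensorOp Ω n (Ψ T) = ELam.conjBy U T) := by
  obtain ⟨V, hV, hcell⟩ := ELam.exists_isCuntzFamily_mem_cellularAlg hΩ hn
  obtain ⟨U, hU⟩ := hV.exists_linearIsometryEquiv
  have hEL : ∀ k, V k ∈ ELam.EL Ω := fun k => ELam.cellularAlg_le_EL hΩ (hcell k)
  obtain ⟨himage, hequiv⟩ := hV.EL_amplification hU hEL
  exact ⟨fun k => ⟨V k, hEL k⟩, U, hU, himage, hequiv, hV.EL0_amplification hU hΩ hcell⟩

end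

theorem mainTheorem9 (n : ℕ) (hn : 1 ≤ n) (Ω : Set ℂ) (hΩ : MeasurableSet Ω) :
    ∃ (V : Fin n → ELam.EL Ω) (U : ELam.L2 Ω ≃ₗᵢ[ℂ] ELam.L2 Ω ⊗[ℂ] ELam.Cn n),
      (∀ h : ELam.L2 Ω, U h = ∑ k, (V k : ELam.L2 Ω →L[ℂ] ELam.L2 Ω) h ⊗ₜ[ℂ]
        (EuclideanSpace.single k 1 : ELam.Cn n)) ∧
      (ELam.conjBy U '' (ELam.EL Ω : Set (ELam.L2 Ω →L[ℂ] ELam.L2 Ω)) =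
        Set.range (ELam.ELtensorOp Ω n)) ∧
      (∃ Φ : ELam.EL Ω ≃⋆ₐ[ℂ] ELam.EL Ω ⊗[ℂ] ELam.Mn n,
        ∀ T : ELam.EL Ω, ELam.ELtensorOp Ω n (Φ T) = ELam.conjBy U T) ∧
      (Ω = Set.univ →
        (ELam.conjBy U '' (ELam.EL0 Ω : Set (ELam.L2 Ω →L[ℂ] ELam.L2 Ω)) =
          Set.range (ELam.EL0tensorOp Ω n)) ∧
        (∃ Ψ : ELam.EL0 Ω ≃⋆ₐ[ℂ] ELam.EL0 Ω ⊗[ℂ] ELam.Mn n,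
          ∀ T : ELam.EL0 Ω, ELam.EL0tensorOp Ω n (Ψ T) = ELam.conjBy U T)) := by
  obtain ⟨V, U, hU, hEL, hΦ, hEL0⟩ := mainTheorem9_general n hn Ω hΩ
  exact ⟨V, U, hU, hEL, hΦ, fun _ => hEL0⟩
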